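/- Let $K$ be an algebraically closed field of arbitrary characteristic, $p,U\in K[[x,y]]$ with $p(0,0)=0$, $x\nmid p$, $U$ a unit, let $c>0$, $q=x^cU$, and consider the special pencil $r=p/q$ with members $C_t=\{p-tq=0\}$, $t\in K$. Let $S$ be the minimal resolution of its base points, obtained from $\operatorname{Spec}K[[x,y]]$ by blowing up the origin and then successively all infinitely near base points, i.e. the points where (the pull-back of) $r$ is undetermined. A *dicritical* is an exceptional component $E$ on which the pull-back of $r$ is not constant; $q_E$ denotes the restriction of $r$ to $E\cong\mathbb P^1$ and $d_E$ its degree; $q_E$ is *separable* if $q_E'\not\equiv0$. The branches of $C_t$ at $E$ are the branches, counted without multiplicities, of the strict transform of $C_t$ on $S$ that meet $E$. A value $t\in K$ is *typical at $E$* if there are exactly $d_E$ of them, all nonsingular and transversal to $E$, and meeting $E$ in $d_E$ distinct points; otherwise $t$ is *atypical at $E$*. A value $t\in K$ is *atypical* (for the pencil) if it is atypical at some dicritical. Then: 1. If $E$ is a dicritical with $q_E$ separable, there are at most $d_E$ atypical values at $E$. 2. If $E$ is a dicritical with $q_E$ separable and, for some $t_0\in K$, $C_{t_0}$ has exactly $r$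 branches at $E$ (without multiplicities), then there are at most $r$ atypical values at $E$ different from $t_0$. 3. Suppose that $q_E$ is separable for every dicritical $E$. For $t\in K$ let $\nu(t)$ be the number of branches of $C_t$ at the origin, i.e. of irreducible factors of $p-tq$ in $K[[x,y]]$, without multiplicities. Then $\nu(t)$ has the same value $\nu^{\mathrm{gen}}$ for all but finitely many $t\in K$, and, with $\nu^{\min}=\min_{t\in K}\nu(t)$, the number of atypical values of the pencil is at most $\min(\nu^{\mathrm{gen}},\nu^{\min}+1)$. -/

import Mathlib

open Polynomial

noncomputable section

namespace PlanePencil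

/-- The formal power series ring `K[[x, y]]`, with `x = X 0` and `y = X 1`. -/
abbrev Ser (K : Type*) [Field K] : Type _ := MvPowerSeries (Fin 2) K

/-- The `x`-coordinate. -/
abbrev x (K : Type*) [Field K] : Ser K := MvPowerSeries.X 0

/-- The `y`-coordinate. -/
abbrev y (K : Type*) [Field K] : Ser K := MvPowerSeries.X 1

/-- The points of the exceptional line `ℙ¹(K)` of the blow-up of the closed point of
`Spec K[[x, y]]`: `fin a` is the direction of `y = a x`, and `inf` is the direction of `x = 0`. -/
inductive Dir (K : Type*) where
  | fin (a : K) : Dir K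
  | inf : Dir K

section

variable {K : Type*} [Field K]

/-- The images of `x` and `y` under the blow-up (quadratic transformation), in coordinates centred
at the given point of the exceptional line:
`(x, y) ↦ (x, x (y + a))` at `fin a`, and `(x, y) ↦ (x y, y)` at `inf`. -/
def blowupCoord : Dir K → Fin 2 → Ser K
  | .fin a => ![x K, x K * (y K + MvPowerSeries.C a)]
  | .inf => ![x K * y K, y K]

theorem hasSubst_blowupCoord (s : Dir K) : MvPowerSeries.HasSubst (blowupCoord s) := by
  apply MvPowerSeries.hasSubst_of_constantCoeff_zero
  intro i
  cases s <;> fin_cases i <;> simp [blowupCoord]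

/-- The homomorphism `K[[x, y]] → K[[x, y]]` from the local ring at the origin to the
(completed) local ring at the point `s` of the exceptional line of the blow-up. -/
def blowup (s : Dir K) : Ser K →ₐ[K] Ser K :=
  MvPowerSeries.substAlgHom (hasSubst_blowupCoord s)

/-- The infinitely near points of the origin: the list `[s₁, …, sₖ]` is the point reached by
blowing up the origin, then the point `s₁` of the exceptional line, then the point `s₂` of the
new exceptional line, and so on. The origin is `[]`. -/
abbrev NearPoint (K : Type*) := List (Dir K)

/-- The pull-back of power series to the completed local ring at an infinitely near point. -/
def pullback : NearPoint K → (Ser K →ₐ[K] Ser K)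
  | [] => AlgHom.id K (Ser K)
  | s :: P => (pullback P).comp (blowup s)

/-- `P` is a base point of the pencil `r = p / q`: the pull-back of `r` to `P` is undetermined,
that is, it has a value neither in `K` nor at infinity. -/
def IsBasePoint (p q : Ser K) (P : NearPoint K) : Prop :=
  ¬ pullback P q ∣ pullback P p ∧ ¬ pullback P p ∣ pullback P q

/-- The initial form `∑_{i + j = μ} c_{i j} x^i y^j` (`μ` the order of `f`), evaluated at
`x = 1`, `y = z`, as a polynomial in `z`. -/
def initialPoly (f : Ser K) : K[X] :=
  ∑ j ∈ Finset.range (f.order.toNat + 1),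
    Polynomial.monomial j
      (MvPowerSeries.coeff (Finsupp.single 0 (f.order.toNat - j) + Finsupp.single 1 j) f)

/-- For an infinitely near point `Q`, let `E_Q` be the exceptional line of the blow-up of `Q`, with
affine coordinate `z` (the point `z = a` is `fin a`). If the pull-backs of `p` and `q` to `Q`
have the same order, then the pull-back of `r = p / q` restricts to `E_Q` as this rational
function of `z`; if the orders differ, then the restriction of `r` is constant, `0` or `∞`. -/
def restr (p q : Ser K) (Q : NearPoint K) : RatFunc K :=
  algebraMap K[X] (RatFunc K) (initialPoly (pullback Q p)) /
    algebraMap K[X] (RatFunc K) (initialPoly (pullback Q q))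

/-- `E_Q` is a dicritical divisor of `p / q`: the pull-back of `p / q` is not constant on it. -/
def IsDicritical (p q : Ser K) (Q : NearPoint K) : Prop :=
  (pullback Q p).order = (pullback Q q).order ∧
    ∀ a : K, restr p q Q ≠ RatFunc.C a

/-- The degree of the restriction of `p / q` to `E_Q` as a map `ℙ¹ → ℙ¹`
(for a polynomial, its degree). -/
def dicriticalDegree (p q : Ser K) (Q : NearPoint K) : ℕ :=
  max (restr p q Q).num.natDegree (restr p q Q).denom.natDegree

/-- The restriction of `p / q` to `E_Q` is separable: its derivative is not identically zero (the
numerator of the derivative of the rational function is written out; for a polynomial the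
denominator is `1`). -/
def IsSeparableAt (p q : Ser K) (Q : NearPoint K) : Prop :=
  derivative (restr p q Q).num * (restr p q Q).denom
    - (restr p q Q).num * derivative (restr p q Q).denom ≠ 0

/-- The member `C_t : p - t q = 0` of the pencil. -/
def fibre (p q : Ser K) (t : K) : Ser K := p - MvPowerSeries.C t * q

/-- The branches of the germ `C_t` at the origin (without multiplicities): the irreducible
components of `Spec K[[x, y]] / (p - t q)`. -/
def branches (p q : Ser K) (t : K) : Set (Ideal (Ser K)) :=
  (Ideal.span {fibre p q t}).minimalPrimes

/-- The branches at `P` (without multiplicities) of the strict transform of `C_t`: those irreducible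
components of the total transform of `C_t` at `P` that are not exceptional, i.e. are not mapped to
the origin. -/
def strictBranches (p q : Ser K) (t : K) (P : NearPoint K) : Set (Ideal (Ser K)) :=
  {I | I ∈ (Ideal.span {pullback P (fibre p q t)}).minimalPrimes ∧
    ¬ (pullback P (x K) ∈ I ∧ pullback P (y K) ∈ I)}

/-- The direction of the strict transform of `E_Q` at the point `s` of `E_Q`, and at all the points
that are infinitely near to `s` and on `E_Q`. -/
def Dir.along : Dir K → Dir K
  | .fin _ => .inf
  | .inf => .fin 0

/-- The local equation of (the strict transform of) `E_Q` at the point `s` of `E_Q`, and at all the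
points that are infinitely near to `s` and on `E_Q`. -/
def Dir.eqn : Dir K → Ser K
  | .fin _ => x K
  | .inf => y K

/-- The point over `s ∈ E_Q` on the strict transform of `E_Q` after `k` further blow-ups of
the points over `s` on it. -/
def pointAlong (Q : NearPoint K) (s : Dir K) (k : ℕ) : NearPoint K :=
  Q ++ s :: List.replicate k s.along

/-- Let `S` be the minimal resolution of the base points of `p / q`, i.e. the surface obtained by
blowing up the origin and then successively all base points. For a base point `Q`, the points of
(the strict transform of) `E_Q` on `S` are the `pointAlong Q s k` with this property. -/
def IsResolvedPoint (p q : Ser K) (Q : NearPoint K) (s : Dir K) (k : ℕ) : Prop :=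
  (∀ j < k, IsBasePoint p q (pointAlong Q s j)) ∧ ¬ IsBasePoint p q (pointAlong Q s k)

/-- The branches at `E_Q` of `C_t` (without multiplicities): the branches of the strict transform
of `C_t` on the minimal resolution that meet `E_Q`, each with the point where it does. -/
def branchesAt (p q : Ser K) (Q : NearPoint K) (t : K) : Set ((Dir K × ℕ) × Ideal (Ser K)) :=
  {b | IsResolvedPoint p q Q b.1.1 b.1.2 ∧ b.2 ∈ strictBranches p q t (pointAlong Q b.1.1 b.1.2)}

/-- `t` is typical at `E_Q`: exactly `d_E` branches of the strict transform of `C_t` meet `E_Q`, all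
of them are curvettes (the branch and `E_Q` generate the maximal ideal of the local ring, that is,
the branch is nonsingular and transversal to `E_Q`), and they meet `E_Q` in distinct points. -/
def IsTypicalAt (p q : Ser K) (Q : NearPoint K) (t : K) : Prop :=
  (branchesAt p q Q t).encard = dicriticalDegree p q Q ∧
  (∀ b ∈ branchesAt p q Q t, b.2 ⊔ Ideal.span {b.1.1.eqn} = Ideal.span {x K, y K}) ∧
  Set.InjOn Prod.fst (branchesAt p q Q t)

/-- The atypical values at `E_Q`. -/
def atypicalAt (p q : Ser K) (Q : NearPoint K) : Set K :=
  {t | ¬ IsTypicalAt p q Q t}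

/-- The atypical values of the pencil: those not typical at all dicritical divisors. -/
def atypical (p q : Ser K) : Set K :=
  {t | ¬ ∀ Q, IsDicritical p q Q → IsTypicalAt p q Q t}

end

end PlanePencil

end

open Polynomial

noncomputable section

namespace PlanePencil

/-! ### Branches as height-one primes of the two-dimensional factorial ring `K[[x, y]]` -/

section Algebra

variable {K : Type*} [Field K]

/-! At every infinitely near point the pull-backs of `p` and `q` are, up to a common exceptional
factor, a series `h` and a monomial `mon m` without common factor (`Chart`). The normal form also
records that where two polar curves cross, the restriction of `h` to one of them vanishes to order
less than the pole order along the other. This survives blowing up (`Chart.step_coord`) and forbids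
dicriticals over such crossings. So a dicritical `E` arises from `h / (X i) ^ n` with `h` of order
`n` (`Polar`), and `q_E` is a polynomial `G` of degree `d_E` in a coordinate `z` of `E`.

Away from the pole of `G` the function `r` is regular and restricts to `G` in a local parameter;
over the pole no branch of any `C_t` meets `E`. Hence the branches of `C_t` at `E` sit over the
roots of `G - t`, and over a simple root there is at most one, a curvette. It can be missing only at
`z = 0`, the one other point of `E` through which an older exceptional curve may pass. So atypical
values at `E` are among `G(0)` and the critical values of `G`. If `G'` is nonzero it has at most
`d_E - 1` roots, which gives the first bound. For the second, `G'` vanishes on the fibre over `t₀`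
to total order at least `d_E` minus the number of points of the fibre, so fewer critical points than
that number remain outside the fibre (`card_critical_lt`); the point `z = 0` is accounted for
separately (`Polar.encard_atypicalAt_diff_le`).

For the global statement, a branch at the origin has a unique strict transform at each stage, so
branches at different dicriticals come from different branches at the origin (`toBranch_injective`).
Conversely, if `t` is typical everywhere, each branch of `C_t` ends on a dicritical
(`exists_toBranch_eq`): otherwise it would end on an exceptional curve where `r` is identically `t`,
and following such a curve towards its pole reaches a dicritical where `t` is atypical
(`ConstAlong.exists_not_isTypicalAt`). Thus the generic number of branches is the sum of the `d_E`,
and summing the local bounds over the dicriticals finishes. There are finitely many dicriticals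
because the branches of `C_t` number at most the intersection multiplicity of `p` with `x = 0`
(`finite_setOf_isDicritical`). -/

instance isPrincipalIdealRing_mvPowerSeries_fin_one :
    IsPrincipalIdealRing (MvPowerSeries (Fin 1) K) :=
  IsPrincipalIdealRing.of_surjective
    (MvPowerSeries.renameEquiv K (Equiv.ofUnique Unit (Fin 1)) : PowerSeries K →+* _)
    (MvPowerSeries.renameEquiv K (Equiv.ofUnique Unit (Fin 1))).surjective

instance isDomain_mvPowerSeries {σ : Type*} : IsDomain (MvPowerSeries σ K) :=
  NoZeroDivisors.to_isDomain _

instance uniqueFactorizationMonoid_ser : UniqueFactorizationMonoid (Ser K) :=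
  (MvPowerSeries.finSuccEquiv K 1).symm.toMulEquiv.uniqueFactorizationMonoid
    (inferInstanceAs (UniqueFactorizationMonoid (PowerSeries (MvPowerSeries (Fin 1) K))))

/-- An index of a coordinate different from `i` is `i.rev`. -/
theorem eq_rev_of_ne {i j : Fin 2} (h : j ≠ i) : j = i.rev := by
  revert i j; decide

theorem rev_ne (i : Fin 2) : i.rev ≠ i := by revert i; decide

theorem isUnit_iff_constantCoeff_ne_zero {f : Ser K} :
    IsUnit f ↔ MvPowerSeries.constantCoeff f ≠ 0 := by
  rw [MvPowerSeries.isUnit_iff_constantCoeff, isUnit_iff_ne_zero]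

theorem exists_eq_add_of_constantCoeff_eq_zero {f : Ser K}
    (hf : MvPowerSeries.constantCoeff f = 0) : ∃ g h, f = x K * g + y K * h := by
  classical
  let a : Ser K := fun d ↦ if d 0 = 0 then MvPowerSeries.coeff d f else 0
  have ha : ∀ d, MvPowerSeries.coeff d a = if d 0 = 0 then MvPowerSeries.coeff d f else 0 :=
    fun d ↦ rfl
  have h1 : x K ∣ f - a := by
    rw [MvPowerSeries.X_dvd_iff]
    intro m hm
    rw [map_sub, ha, if_pos hm, sub_self]
  have h2 : y K ∣ a := by
    rw [MvPowerSeries.X_dvd_iff]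
    intro m hm
    rw [ha]
    split_ifs with h0
    · have : m = 0 := by
        ext i; fin_cases i <;> simpa
      rw [this, MvPowerSeries.coeff_zero_eq_constantCoeff_apply, hf]
    · rfl
  obtain ⟨g, hg⟩ := h1
  obtain ⟨h, hh⟩ := h2
  exact ⟨g, h, by rw [← hg, ← hh]; ring⟩

theorem not_isUnit_X (i : Fin 2) : ¬ IsUnit (MvPowerSeries.X i : Ser K) := by
  simp [isUnit_iff_constantCoeff_ne_zero]

theorem mem_maximalIdeal_iff {f : Ser K} :
    f ∈ IsLocalRing.maximalIdeal (Ser K) ↔ MvPowerSeries.constantCoeff f = 0 := by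
  rw [IsLocalRing.mem_maximalIdeal, mem_nonunits_iff, isUnit_iff_constantCoeff_ne_zero, not_not]

theorem maximalIdeal_eq_span :
    IsLocalRing.maximalIdeal (Ser K) = Ideal.span {x K, y K} := by
  apply le_antisymm
  · intro f hf
    obtain ⟨g, h, rfl⟩ := exists_eq_add_of_constantCoeff_eq_zero (mem_maximalIdeal_iff.1 hf)
    exact Ideal.add_mem _ (Ideal.mul_mem_right _ _ (Ideal.subset_span (by simp)))
      (Ideal.mul_mem_right _ _ (Ideal.subset_span (by simp)))
  · rw [Ideal.span_le]
    rintro f (rfl | rfl) <;>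
    exact mem_maximalIdeal_iff.2 (by simp)

theorem hasSubst_res (k : Fin 2) :
    MvPowerSeries.HasSubst (fun j : Fin 2 ↦ if j = k then 0 else (PowerSeries.X : PowerSeries K)) := by
  apply MvPowerSeries.hasSubst_of_constantCoeff_zero
  intro i
  split_ifs
  · simp
  · exact PowerSeries.constantCoeff_X

/-- The restriction of a power series to the line `X k = 0`. -/
def res (k : Fin 2) : Ser K →ₐ[K] PowerSeries K :=
  MvPowerSeries.substAlgHom (hasSubst_res k)

@[simp]
theorem res_X_self (k : Fin 2) : res k (MvPowerSeries.X k : Ser K) = 0 := by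
  rw [res, MvPowerSeries.substAlgHom_X, if_pos rfl]

@[simp]
theorem res_X_rev (k : Fin 2) : res k (MvPowerSeries.X k.rev : Ser K) = PowerSeries.X := by
  rw [res, MvPowerSeries.substAlgHom_X, if_neg (rev_ne k)]

@[simp]
theorem res_rev_X (k : Fin 2) : res k.rev (MvPowerSeries.X k : Ser K) = PowerSeries.X := by
  simpa using res_X_rev (K := K) k.rev

@[simp]
theorem res_C (k : Fin 2) (a : K) : res k (MvPowerSeries.C a : Ser K) = PowerSeries.C a :=
  (res (K := K) k).commutes a

theorem coeff_res (k : Fin 2) (f : Ser K) (n : ℕ) :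
    PowerSeries.coeff n (res k f) = MvPowerSeries.coeff (Finsupp.single k.rev n) f := by
  classical
  rw [res, MvPowerSeries.substAlgHom_apply, PowerSeries.coeff,
    MvPowerSeries.coeff_subst (hasSubst_res k)]
  have key : ∀ d : Fin 2 →₀ ℕ, (d.prod fun s e ↦
      (if s = k then 0 else (PowerSeries.X : PowerSeries K)) ^ e) =
      if d k = 0 then PowerSeries.X ^ d k.rev else 0 := by
    intro d
    rw [Finsupp.prod_fintype _ _ (by simp), Fin.prod_univ_two]
    fin_cases k
    · by_cases h : d 0 = 0 <;> simp [h]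
    · by_cases h : d 1 = 0 <;> simp [h]
  rw [finsum_eq_single _ (Finsupp.single k.rev n)]
  · rw [key]
    have : (Finsupp.single k.rev n) k = 0 := by
      rw [Finsupp.single_apply, if_neg (rev_ne k)]
    rw [if_pos this, Finsupp.single_eq_same]
    have h2 := PowerSeries.coeff_X_pow_self (R := K) n
    rw [PowerSeries.coeff] at h2
    rw [h2, smul_eq_mul, mul_one]
  · intro d hd
    rw [key]
    split_ifs with h
    · have h3 : d k.rev ≠ n := by
        rintro rfl
        apply hd
        ext j
        by_cases hj : j = k
        · subst hj
          rw [h, Finsupp.single_apply, if_neg (rev_ne j)]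
        · rw [eq_rev_of_ne hj, Finsupp.single_eq_same]
      have h2 := PowerSeries.coeff_X_pow (R := K) n (d k.rev)
      rw [if_neg h3.symm, PowerSeries.coeff] at h2
      rw [h2, smul_zero]
    · simp

theorem constantCoeff_res (k : Fin 2) (f : Ser K) :
    PowerSeries.constantCoeff (res k f) = MvPowerSeries.constantCoeff f := by
  rw [← PowerSeries.coeff_zero_eq_constantCoeff_apply, coeff_res, Finsupp.single_zero,
    MvPowerSeries.coeff_zero_eq_constantCoeff_apply]

theorem res_eq_zero_iff {k : Fin 2} {f : Ser K} : res k f = 0 ↔ MvPowerSeries.X k ∣ f := by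
  constructor
  · intro h
    rw [MvPowerSeries.X_dvd_iff]
    intro m hm
    have : m = Finsupp.single k.rev (m k.rev) := by
      ext j
      by_cases hj : j = k
      · subst hj
        rw [hm, Finsupp.single_apply, if_neg (rev_ne j)]
      · rw [eq_rev_of_ne hj, Finsupp.single_eq_same]
    rw [this, ← coeff_res, h, map_zero]
  · rintro ⟨g, rfl⟩
    simp

theorem prime_X (i : Fin 2) : Prime (MvPowerSeries.X i : Ser K) := by
  refine ⟨fun h ↦ ?_, fun h ↦ ?_, fun f g h ↦ ?_⟩
  · exact one_ne_zero (α := K) (by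
      rw [← MvPowerSeries.coeff_index_single_self_X (R := K) i, h, map_zero])
  · rw [isUnit_iff_constantCoeff_ne_zero] at h
    simp at h
  · simp only [← res_eq_zero_iff, map_mul, mul_eq_zero] at h ⊢
    exact h

/-- A branch at the closed point: a prime of `K[[x, y]]` of height one. -/
structure IsBranch (J : Ideal (Ser K)) : Prop where
  isPrime : J.IsPrime
  ne_bot : J ≠ ⊥
  not_mem : ¬ (x K ∈ J ∧ y K ∈ J)

theorem IsBranch.lt_maximalIdeal {J : Ideal (Ser K)} (hJ : IsBranch J) :
    J < IsLocalRing.maximalIdeal (Ser K) := by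
  refine lt_of_le_of_ne (IsLocalRing.le_maximalIdeal hJ.isPrime.ne_top) ?_
  rintro rfl
  exact hJ.not_mem ⟨not_isUnit_X 0, not_isUnit_X 1⟩

theorem height_maximalIdeal_le : (IsLocalRing.maximalIdeal (Ser K)).height ≤ 2 := by
  refine (Ideal.height_le_spanFinrank _ Ideal.IsPrime.ne_top').trans ?_
  rw [maximalIdeal_eq_span]
  have := Submodule.spanFinrank_span_le_ncard_of_finite (R := Ser K) (s := {x K, y K})
    (Set.toFinite _)
  exact_mod_cast this.trans ((Set.ncard_insert_le _ _).trans (by simp))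

/-- A strict inclusion would give a chain of primes `0 < I < J < (x, y)`, while an ideal with two
generators has height at most 2. -/
theorem IsBranch.eq_of_le {I J : Ideal (Ser K)} (hJ : IsBranch J) (hI : I.IsPrime) (h0 : I ≠ ⊥)
    (hIJ : I ≤ J) : I = J := by
  by_contra hne
  have hp := hJ.isPrime
  have h1 := Ideal.height_add_one_le_of_lt_of_isPrime (lt_of_le_of_ne hIJ hne)
  have h2 := Ideal.height_add_one_le_of_lt_of_isPrime hJ.lt_maximalIdeal
  have h3 := Ideal.height_add_one_le_of_lt_of_isPrime (bot_lt_iff_ne_bot.2 h0)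
  have h4 : (3 : ℕ∞) ≤ 2 := by
    refine le_trans ?_ (h2.trans height_maximalIdeal_le)
    calc (3 : ℕ∞) = 0 + 1 + 1 + 1 := by norm_num
      _ ≤ _ := by gcongr; exact le_trans (by gcongr; exact le_trans (by gcongr; exact zero_le) h3) h1
  exact absurd h4 (by norm_num)

theorem IsBranch.exists_eq_span {J : Ideal (Ser K)} (hJ : IsBranch J) :
    ∃ g, Prime g ∧ J = Ideal.span {g} := by
  obtain ⟨g, hg, hgp⟩ := hJ.isPrime.exists_mem_prime_of_ne_bot hJ.ne_bot
  refine ⟨g, hgp, (hJ.eq_of_le ((Ideal.span_singleton_prime hgp.ne_zero).2 hgp) ?_ ?_).symm⟩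
  · simpa using hgp.ne_zero
  · simpa [Ideal.span_singleton_le_iff_mem] using hg

theorem isBranch_span_singleton {g : Ser K} (hg : Prime g) : IsBranch (Ideal.span {g}) := by
  refine ⟨(Ideal.span_singleton_prime hg.ne_zero).2 hg, by simpa using hg.ne_zero, ?_⟩
  simp only [Ideal.mem_span_singleton]
  rintro ⟨h1, h2⟩
  have h := (hg.dvd_prime_iff_associated (prime_X 0)).1 h1
  have h3 : (x K) ∣ y K := h.symm.dvd.trans h2
  rw [MvPowerSeries.X_dvd_iff] at h3
  have := h3 (Finsupp.single 1 1) (by simp)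
  rw [MvPowerSeries.coeff_index_single_self_X] at this
  exact one_ne_zero this

/-- Reduces membership among the components of a germ to two conditions that behave well under
pull-back. -/
theorem mem_minimalPrimes_span_singleton_iff {F : Ser K} (hF : F ≠ 0) {J : Ideal (Ser K)} :
    J ∈ (Ideal.span {F}).minimalPrimes ↔ IsBranch J ∧ F ∈ J := by
  constructor
  · intro h
    have hFJ : F ∈ J := h.1.2 (Ideal.mem_span_singleton_self F)
    refine ⟨?_, hFJ⟩
    have hp := h.1.1
    obtain ⟨g, hg, hgF⟩ : ∃ g, Prime g ∧ g ∣ F ∧ g ∈ J := by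
      have hu : ¬ IsUnit F := fun hu ↦ hp.ne_top (Ideal.eq_top_of_isUnit_mem _ hFJ hu)
      have hm := UniqueFactorizationMonoid.factors_prod hF
      have : (UniqueFactorizationMonoid.factors F).prod ∈ J := by
        obtain ⟨u, hu⟩ := hm
        rw [← hu] at hFJ
        exact (hp.mem_or_mem hFJ).resolve_right
          fun h ↦ hp.ne_top (Ideal.eq_top_of_isUnit_mem _ h u.isUnit)
      obtain ⟨g, hg, hgJ⟩ := (hp.multiset_prod_mem_iff_exists_mem _).1 this
      exact ⟨g, UniqueFactorizationMonoid.prime_of_factor g hg,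
        UniqueFactorizationMonoid.dvd_of_mem_factors hg, hgJ⟩
    have h1 : Ideal.span {g} ≤ J := by simpa [Ideal.span_singleton_le_iff_mem] using hgF.2
    have h2 : J ≤ Ideal.span {g} :=
      h.2 ⟨(isBranch_span_singleton hg).isPrime, by
        simpa [Ideal.span_singleton_le_iff_mem, Ideal.mem_span_singleton] using hgF.1⟩ h1
    rw [le_antisymm h2 h1]
    exact isBranch_span_singleton hg
  · rintro ⟨hJ, hFJ⟩
    refine ⟨⟨hJ.isPrime, by simpa [Ideal.span_singleton_le_iff_mem] using hFJ⟩, ?_⟩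
    rintro I ⟨hI, hFI⟩ hIJ
    refine (hJ.eq_of_le hI ?_ hIJ).ge
    rintro rfl
    exact hF (by simpa [Ideal.span_singleton_le_iff_mem] using hFI)

end Algebra

/-! ### Weierstrass preparation in either variable -/

section Weierstrass

variable {K : Type*} [Field K]

/-- A power series in one variable as a power series in the variable `X i`. -/
def inVar (i : Fin 2) : PowerSeries K →ₐ[K] Ser K :=
  PowerSeries.substAlgHom (PowerSeries.HasSubst.X i)

theorem coeff_inVar (i : Fin 2) (α : PowerSeries K) (e : Fin 2 →₀ ℕ) :
    MvPowerSeries.coeff e (inVar i α) =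
      if e = Finsupp.single i (e i) then PowerSeries.coeff (e i) α else 0 := by
  rw [inVar, PowerSeries.coe_substAlgHom, PowerSeries.coeff_subst_single]

theorem constantCoeff_inVar (i : Fin 2) (α : PowerSeries K) :
    MvPowerSeries.constantCoeff (inVar i α) = PowerSeries.constantCoeff α := by
  rw [← MvPowerSeries.coeff_zero_eq_constantCoeff_apply, coeff_inVar]
  simp

theorem substAlgHom_inVar {b : Fin 2 → Ser K} (hb : MvPowerSeries.HasSubst b) (i : Fin 2)
    (α : PowerSeries K) :
    MvPowerSeries.substAlgHom hb (inVar i α) = PowerSeries.subst (b i) α := by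
  rw [inVar, PowerSeries.coe_substAlgHom, PowerSeries.subst, MvPowerSeries.substAlgHom_apply,
    MvPowerSeries.subst_comp_subst_apply (PowerSeries.HasSubst.X i).const hb,
    MvPowerSeries.subst_X hb]
  rfl

theorem finSuccEquiv_symm_C (c : MvPowerSeries (Fin 1) K) :
    (MvPowerSeries.finSuccEquiv K 1).symm (PowerSeries.C c) =
      inVar 1 (PowerSeries.mk fun n ↦ MvPowerSeries.coeff (Finsupp.single 0 n) c) := by
  rw [AlgEquiv.symm_apply_eq]
  ext k d
  rw [MvPowerSeries.coeff_coeff_finSuccEquiv, coeff_inVar, PowerSeries.coeff_C]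
  have hd : d = Finsupp.single 0 (d 0) := by
    refine Finsupp.ext fun j ↦ ?_
    rw [Subsingleton.elim j 0, Finsupp.single_eq_same]
  have h1 : (Finsupp.cons k d : Fin 2 →₀ ℕ) 1 = d 0 := Finsupp.cons_succ (0 : Fin 1) k d
  have h0 : (Finsupp.cons k d : Fin 2 →₀ ℕ) 0 = k := Finsupp.cons_zero k d
  rw [h1, PowerSeries.coeff_mk, ← hd]
  by_cases hk : k = 0
  · subst hk
    rw [if_pos rfl, if_pos]
    ext j
    fin_cases j
    · simp
    · simpa using h1
  · rw [if_neg hk, if_neg, map_zero]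
    intro h
    apply hk
    rw [← h0, h]
    simp

theorem maximalIdeal_mvPowerSeries_fin_one :
    IsLocalRing.maximalIdeal (MvPowerSeries (Fin 1) K) =
      Ideal.span (Set.range MvPowerSeries.X) := by
  ext f
  rw [IsLocalRing.mem_maximalIdeal, mem_nonunits_iff, MvPowerSeries.isUnit_iff_constantCoeff,
    isUnit_iff_ne_zero, not_not, Set.range_unique, Ideal.mem_span_singleton,
    MvPowerSeries.X_dvd_iff]
  constructor
  · intro h m hm
    have : m = 0 := by
      refine Finsupp.ext fun j ↦ ?_
      rw [Subsingleton.elim j default, hm, Finsupp.zero_apply]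
    rw [this, MvPowerSeries.coeff_zero_eq_constantCoeff_apply, h]
  · intro h
    rw [← MvPowerSeries.coeff_zero_eq_constantCoeff_apply]
    exact h 0 rfl

instance isAdicComplete_mvPowerSeries_fin_one :
    IsAdicComplete (IsLocalRing.maximalIdeal (MvPowerSeries (Fin 1) K))
      (MvPowerSeries (Fin 1) K) := by
  rw [maximalIdeal_mvPowerSeries_fin_one]
  infer_instance

/-- Weierstrass preparation over the complete local ring `K[[y]]`: regularity in `x` means that the
reduction modulo `y` is nonzero. -/
theorem exists_weierstrass_zero {h : Ser K} (hh : ¬ y K ∣ h) :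
    ∃ (u : Ser K) (n : ℕ) (α : ℕ → PowerSeries K), IsUnit u ∧
      (∀ k < n, PowerSeries.constantCoeff (α k) = 0) ∧
      h * u = x K ^ n + ∑ k ∈ Finset.range n, inVar 1 (α k) * x K ^ k := by
  set e := MvPowerSeries.finSuccEquiv K 1 with he
  have hne : (e h).map (IsLocalRing.residue (MvPowerSeries (Fin 1) K)) ≠ 0 := by
    intro h0
    apply hh
    rw [MvPowerSeries.X_dvd_iff]
    intro m hm
    have h1 := congrArg (PowerSeries.coeff (m 0)) h0
    rw [PowerSeries.coeff_map, map_zero (PowerSeries.coeff _), IsLocalRing.residue_eq_zero_iff,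
      IsLocalRing.mem_maximalIdeal, mem_nonunits_iff, MvPowerSeries.isUnit_iff_constantCoeff,
      isUnit_iff_ne_zero, not_not, ← MvPowerSeries.coeff_zero_eq_constantCoeff_apply,
      MvPowerSeries.coeff_coeff_finSuccEquiv] at h1
    have hm' : m = Finsupp.cons (m 0) 0 := by
      refine Finsupp.ext fun j ↦ ?_
      fin_cases j
      · simp
      · exact hm.trans (Finsupp.cons_succ (0 : Fin 1) (m 0) 0).symm
    rwa [← hm'] at h1
  obtain ⟨f, w, hf⟩ := PowerSeries.exists_isWeierstrassFactorization hne
  obtain ⟨v, hv⟩ := hf.isUnit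
  refine ⟨e.symm ↑v⁻¹, f.natDegree, fun k ↦ PowerSeries.mk fun n ↦
    MvPowerSeries.coeff (Finsupp.single 0 n) (f.coeff k), v⁻¹.isUnit.map e.symm, ?_, ?_⟩
  · intro k hk
    have := hf.isDistinguishedAt.mem hk
    rw [IsLocalRing.mem_maximalIdeal, mem_nonunits_iff, MvPowerSeries.isUnit_iff_constantCoeff,
      isUnit_iff_ne_zero, not_not, ← MvPowerSeries.coeff_zero_eq_constantCoeff_apply] at this
    rw [← PowerSeries.coeff_zero_eq_constantCoeff_apply, PowerSeries.coeff_mk,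
      Finsupp.single_zero, this]
  · have h1 : h * e.symm ↑v⁻¹ = e.symm (f : PowerSeries _) := by
      rw [AlgEquiv.eq_symm_apply, map_mul, AlgEquiv.apply_symm_apply, hf.eq_mul, ← hv, mul_assoc,
        Units.mul_inv, mul_one]
    have h2 : (f : PowerSeries (MvPowerSeries (Fin 1) K)) = PowerSeries.X ^ f.natDegree +
        ∑ k ∈ Finset.range f.natDegree, PowerSeries.C (f.coeff k) * PowerSeries.X ^ k := by
      conv_lhs => rw [hf.isDistinguishedAt.monic.as_sum]
      rw [← Polynomial.coeToPowerSeries.ringHom_apply, map_add, map_sum]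
      simp
    have h3 : e.symm PowerSeries.X = x K := by
      rw [AlgEquiv.symm_apply_eq, he, MvPowerSeries.finSuccEquiv_X_zero]
    rw [h1, h2]
    simp only [map_add, map_sum, map_mul, map_pow, h3]
    simp only [he, finSuccEquiv_symm_C]

theorem hasSubst_X_rev : MvPowerSeries.HasSubst fun j : Fin 2 ↦ (MvPowerSeries.X j.rev : Ser K) :=
  MvPowerSeries.hasSubst_of_constantCoeff_zero (by simp)

/-- The automorphism interchanging the coordinates. -/
def swap : Ser K →ₐ[K] Ser K := MvPowerSeries.substAlgHom hasSubst_X_rev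

@[simp]
theorem swap_X (i : Fin 2) : swap (MvPowerSeries.X i : Ser K) = MvPowerSeries.X i.rev := by
  rw [swap, MvPowerSeries.substAlgHom_X]

@[simp]
theorem swap_inVar (i : Fin 2) (α : PowerSeries K) : swap (inVar i α) = inVar i.rev α := by
  rw [swap, substAlgHom_inVar, inVar, PowerSeries.coe_substAlgHom]

@[simp]
theorem swap_swap (f : Ser K) : swap (swap f) = f := by
  rw [swap, MvPowerSeries.substAlgHom_comp_substAlgHom_apply, MvPowerSeries.substAlgHom_apply]
  have : (fun s : Fin 2 ↦ MvPowerSeries.substAlgHom (hasSubst_X_rev (K := K))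
      (MvPowerSeries.X s.rev : Ser K)) = MvPowerSeries.X := by
    funext s
    rw [MvPowerSeries.substAlgHom_X, Fin.rev_rev]
  rw [this, MvPowerSeries.subst_self, id]

/-- Weierstrass preparation. -/
theorem exists_weierstrass (i : Fin 2) {h : Ser K} (hh : ¬ MvPowerSeries.X i.rev ∣ h) :
    ∃ (u : Ser K) (n : ℕ) (α : ℕ → PowerSeries K), IsUnit u ∧
      (∀ k < n, PowerSeries.constantCoeff (α k) = 0) ∧
      h * u = MvPowerSeries.X i ^ n +
        ∑ k ∈ Finset.range n, inVar i.rev (α k) * MvPowerSeries.X i ^ k := by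
  fin_cases i
  · exact exists_weierstrass_zero hh
  · have h1 : ¬ y K ∣ swap h := by
      intro hd
      apply hh
      have := map_dvd (swap (K := K)) hd
      rwa [swap_swap, swap_X] at this
    obtain ⟨u, n, α, hu, hα, hE⟩ := exists_weierstrass_zero h1
    refine ⟨swap u, n, α, hu.map (swap (K := K)), hα, ?_⟩
    have := congrArg (swap (K := K)) hE
    simpa using this

end Weierstrass

/-! ### Blowing up: initial forms and strict transforms -/

section Blowup

variable {K : Type*} [Field K]

/-- The direction of the line `X i = 0`. -/
def coord (i : Fin 2) : Dir K := ![.inf, .fin 0] i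

/-- The index of the local equation of the exceptional line. -/
def Dir.idx : Dir K → Fin 2
  | .fin _ => 0
  | .inf => 1

theorem eqn_eq_X (s : Dir K) : s.eqn = MvPowerSeries.X s.idx := by
  cases s <;> rfl

@[simp]
theorem idx_coord (i : Fin 2) : (coord i : Dir K).idx = i.rev := by
  fin_cases i <;> rfl

@[simp]
theorem eqn_coord (i : Fin 2) : (coord i : Dir K).eqn = MvPowerSeries.X i.rev := by
  rw [eqn_eq_X, idx_coord]

@[simp]
theorem along_coord (i : Fin 2) : (coord i : Dir K).along = coord i.rev := by
  fin_cases i <;> rfl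

theorem Dir.eq_coord_or (s : Dir K) : (∃ i, s = coord i) ∨ ∃ a, a ≠ 0 ∧ s = .fin a := by
  rcases s with a | _
  · by_cases ha : a = 0
    · exact .inl ⟨1, by rw [ha]; rfl⟩
    · exact .inr ⟨a, ha, rfl⟩
  · exact .inl ⟨0, rfl⟩

theorem blowup_X (s : Dir K) (i : Fin 2) : blowup s (MvPowerSeries.X i) = blowupCoord s i := by
  rw [blowup, MvPowerSeries.substAlgHom_X]

@[simp]
theorem blowup_C (s : Dir K) (a : K) : blowup s (MvPowerSeries.C a) = MvPowerSeries.C a :=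
  (blowup s).commutes a

@[simp]
theorem blowup_coord_X_self (i : Fin 2) :
    blowup (coord i) (MvPowerSeries.X i : Ser K) = MvPowerSeries.X i.rev * MvPowerSeries.X i := by
  rw [blowup_X]
  fin_cases i <;> simp [coord, blowupCoord, mul_comm]

@[simp]
theorem blowup_coord_X_rev (i : Fin 2) :
    blowup (coord i) (MvPowerSeries.X i.rev : Ser K) = MvPowerSeries.X i.rev := by
  rw [blowup_X]
  fin_cases i <;> simp [coord, blowupCoord]

@[simp]
theorem blowup_fin_x (a : K) : blowup (.fin a) (x K) = x K := by
  rw [blowup_X]; rfl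

@[simp]
theorem blowup_fin_y (a : K) :
    blowup (.fin a) (y K) = x K * (y K + MvPowerSeries.C a) := by
  rw [blowup_X]; rfl

theorem blowup_X_idx (s : Dir K) : blowup s (MvPowerSeries.X s.idx) = s.eqn := by
  rw [blowup_X]
  cases s <;> rfl

theorem eqn_dvd_blowup_X (s : Dir K) (i : Fin 2) : s.eqn ∣ blowup s (MvPowerSeries.X i) := by
  rw [blowup_X]
  cases s <;> fin_cases i <;> simp [blowupCoord, Dir.eqn]

theorem prime_eqn (s : Dir K) : Prime s.eqn := by
  rw [eqn_eq_X]; exact prime_X _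

theorem constantCoeff_blowup (s : Dir K) (f : Ser K) :
    MvPowerSeries.constantCoeff (blowup s f) = MvPowerSeries.constantCoeff f := by
  have h : MvPowerSeries.constantCoeff (f - MvPowerSeries.C (MvPowerSeries.constantCoeff f)) =
    0 := by simp
  obtain ⟨g, k, hgk⟩ := exists_eq_add_of_constantCoeff_eq_zero h
  have h2 : ∀ i, MvPowerSeries.constantCoeff (blowup s (MvPowerSeries.X i)) = 0 := by
    intro i
    obtain ⟨c, hc⟩ := eqn_dvd_blowup_X s i
    rw [hc, eqn_eq_X]
    simp
  have h3 := congrArg (fun f ↦ MvPowerSeries.constantCoeff (blowup s f)) hgk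
  simp only [map_sub, map_add, map_mul, blowup_C, h2, zero_mul, add_zero,
    MvPowerSeries.constantCoeff_C, sub_eq_zero] at h3
  exact h3

/-- Give weight 1 to the exceptional coordinate and 0 to the other: both substituted series have
weight at least 1, so order turns into exceptional multiplicity. -/
theorem eqn_pow_dvd_blowup (s : Dir K) {f : Ser K} {n : ℕ} (hf : (n : ℕ∞) ≤ f.order) :
    s.eqn ^ n ∣ blowup s f := by
  classical
  let w : Fin 2 → ℕ := fun j ↦ if j = s.idx then 1 else 0
  have hw : ∀ d : Fin 2 →₀ ℕ, Finsupp.weight w d = d s.idx := by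
    intro d
    rw [Finsupp.weight_apply, Finsupp.sum_fintype _ _ (by simp)]
    simp [w]
  have hX : (1 : ℕ∞) ≤ MvPowerSeries.weightedOrder w s.eqn := by
    rw [eqn_eq_X, MvPowerSeries.X, MvPowerSeries.weightedOrder_monomial_of_ne_zero w one_ne_zero,
      hw]
    simp
  have h1 : ∀ i, (1 : ℕ∞) ≤ MvPowerSeries.weightedOrder w (blowupCoord s i) := by
    intro i
    obtain ⟨c, hc⟩ := eqn_dvd_blowup_X s i
    rw [← blowup_X, hc]
    exact (hX.trans le_self_add).trans (MvPowerSeries.le_weightedOrder_mul w)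
  have h2 := MvPowerSeries.le_weightedOrder_subst w (hasSubst_blowupCoord s) f
  have h3 : (n : ℕ∞) ≤ MvPowerSeries.weightedOrder w (blowup s f) := by
    rw [blowup, MvPowerSeries.substAlgHom_apply]
    refine le_trans ?_ h2
    refine le_iInf fun d ↦ le_iInf fun hd ↦ ?_
    refine hf.trans ((MvPowerSeries.order_le hd).trans ?_)
    rw [Finsupp.weight_apply, Finsupp.sum_fintype _ _ (by simp), Finsupp.degree_eq_sum,
      Nat.cast_sum]
    refine Finset.sum_le_sum fun i _ ↦ ?_
    rw [nsmul_eq_mul]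
    exact le_mul_of_one_le_right' (h1 i)
  rw [eqn_eq_X, MvPowerSeries.X_pow_dvd_iff]
  intro m hm
  refine MvPowerSeries.coeff_eq_zero_of_lt_weightedOrder w ?_
  rw [hw]
  exact lt_of_lt_of_le (by exact_mod_cast hm) h3

/-- The part of degree `n` of a power series, with the variable `X k` set to `1`. -/
def hform (k : Fin 2) (n : ℕ) (f : Ser K) : K[X] :=
  ∑ j ∈ Finset.range (n + 1), Polynomial.monomial j
    (MvPowerSeries.coeff (Finsupp.single k (n - j) + Finsupp.single k.rev j) f)

theorem initialPoly_eq (f : Ser K) : initialPoly f = hform 0 f.order.toNat f := rfl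

theorem coeff_hform (k : Fin 2) (n : ℕ) (f : Ser K) (j : ℕ) :
    (hform k n f).coeff j = if j ≤ n then
      MvPowerSeries.coeff (Finsupp.single k (n - j) + Finsupp.single k.rev j) f else 0 := by
  rw [hform, Polynomial.finsetSum_coeff]
  simp only [Polynomial.coeff_monomial]
  rw [Finset.sum_ite_eq' (Finset.range (n + 1)) j]
  simp

theorem natDegree_hform_le (k : Fin 2) (n : ℕ) (f : Ser K) : (hform k n f).natDegree ≤ n := by
  rw [Polynomial.natDegree_le_iff_coeff_eq_zero]
  intro j hj
  rw [coeff_hform, if_neg (by omega)]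

theorem hform_rev (k : Fin 2) (n : ℕ) (f : Ser K) :
    hform k.rev n f = Polynomial.reflect n (hform k n f) := by
  ext j
  rw [Polynomial.coeff_reflect, coeff_hform, coeff_hform, Fin.rev_rev]
  by_cases h : j ≤ n
  · rw [if_pos h, Polynomial.revAt_le h, if_pos (by omega), Nat.sub_sub_self h, add_comm]
  · rw [if_neg h, Polynomial.revAt_eq_self_of_lt (by omega), if_neg h]

theorem eq_single_add_single (k : Fin 2) (d : Fin 2 →₀ ℕ) :
    d = Finsupp.single k (d k) + Finsupp.single k.rev (d k.rev) := by
  ext j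
  by_cases hj : j = k
  · subst hj
    simp [rev_ne]
  · rw [eq_rev_of_ne hj]
    simp [(rev_ne k).symm]

theorem degree_eq_add (k : Fin 2) (d : Fin 2 →₀ ℕ) : d.degree = d k + d k.rev := by
  rw [Finsupp.degree_eq_sum, Fin.sum_univ_two]
  fin_cases k
  · rfl
  · exact add_comm _ _

@[simp]
theorem single_rev_apply (k : Fin 2) (n : ℕ) : (Finsupp.single k.rev n : Fin 2 →₀ ℕ) k = 0 := by
  rw [Finsupp.single_apply, if_neg (rev_ne k)]

@[simp]
theorem single_apply_rev (k : Fin 2) (n : ℕ) : (Finsupp.single k n : Fin 2 →₀ ℕ) k.rev = 0 := by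
  rw [Finsupp.single_apply, if_neg (rev_ne k).symm]

theorem hform_eq_zero_iff (k : Fin 2) {n : ℕ} {f : Ser K} (hf : (n : ℕ∞) ≤ f.order) :
    hform k n f = 0 ↔ ((n + 1 : ℕ) : ℕ∞) ≤ f.order := by
  constructor
  · intro h
    refine MvPowerSeries.nat_le_order fun d hd ↦ ?_
    rcases Nat.lt_succ_iff_lt_or_eq.1 hd with h1 | h1
    · exact MvPowerSeries.coeff_of_lt_order (lt_of_lt_of_le (by exact_mod_cast h1) hf)
    · have h2 := congrArg (fun p ↦ Polynomial.coeff p (d k.rev)) h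
      simp only [coeff_hform, Polynomial.coeff_zero] at h2
      have h3 := degree_eq_add k d
      rw [if_pos (by omega)] at h2
      have h4 : n - d k.rev = d k := by omega
      rwa [h4, ← eq_single_add_single] at h2
  · intro h
    ext j
    rw [coeff_hform, Polynomial.coeff_zero]
    split_ifs with hj
    · refine MvPowerSeries.coeff_of_lt_order (lt_of_lt_of_le ?_ h)
      rw [degree_eq_add k]
      simp
      norm_cast
      omega
    · rfl

/-- The part of degree `n` of a power series. -/
theorem le_order_sub_hform (k : Fin 2) {n : ℕ} {f : Ser K} (hf : (n : ℕ∞) ≤ f.order) :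
    ((n + 1 : ℕ) : ℕ∞) ≤ (f - ∑ j ∈ Finset.range (n + 1),
      MvPowerSeries.C ((hform k n f).coeff j) * MvPowerSeries.X k ^ (n - j) *
        MvPowerSeries.X k.rev ^ j).order := by
  classical
  refine MvPowerSeries.nat_le_order fun d hd ↦ ?_
  have key : ∀ (j : ℕ) (c : K), MvPowerSeries.coeff d (MvPowerSeries.C c *
      MvPowerSeries.X k ^ (n - j) * MvPowerSeries.X k.rev ^ j : Ser K) =
      if d k = n - j ∧ d k.rev = j then c else 0 := by
    intro j c
    rw [mul_assoc, MvPowerSeries.coeff_C_mul, MvPowerSeries.X_pow_eq, MvPowerSeries.X_pow_eq,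
      MvPowerSeries.monomial_mul_monomial, MvPowerSeries.coeff_monomial]
    have : d = Finsupp.single k (n - j) + Finsupp.single k.rev j ↔ d k = n - j ∧ d k.rev = j := by
      constructor
      · intro h
        rw [h]
        simp
      · rintro ⟨h1, h2⟩
        conv_lhs => rw [eq_single_add_single k d]
        rw [h1, h2]
    simp only [this]
    split_ifs <;> simp
  have h3 := degree_eq_add k d
  rw [map_sub, map_sum, Finset.sum_congr rfl fun j _ ↦ key j _]
  rcases Nat.lt_succ_iff_lt_or_eq.1 hd with h1 | h1
  · rw [MvPowerSeries.coeff_of_lt_order (lt_of_lt_of_le (by exact_mod_cast h1) hf), zero_sub,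
      Finset.sum_eq_zero, neg_zero]
    intro j hj
    rw [if_neg]
    rintro ⟨h4, h5⟩
    rw [Finset.mem_range] at hj
    omega
  · rw [Finset.sum_eq_single (d k.rev), if_pos ⟨by omega, rfl⟩, coeff_hform, if_pos (by omega)]
    · have : n - d k.rev = d k := by omega
      rw [this, ← eq_single_add_single, sub_self]
    · intro j _ hj
      rw [if_neg]
      rintro ⟨_, h5⟩
      exact hj h5.symm
    · intro h
      rw [Finset.mem_range] at h
      omega

/-- The initial form of degree `n` in the coordinate of the exceptional line at `s`. -/
def tform : Dir K → ℕ → Ser K → K[X]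
  | .fin a, n, f => (hform 0 n f).comp (Polynomial.X + Polynomial.C a)
  | .inf, n, f => hform 1 n f

@[simp]
theorem tform_coord (i : Fin 2) (n : ℕ) (f : Ser K) :
    tform (coord i) n f = hform i.rev n f := by
  fin_cases i
  · rfl
  · simp [tform, coord]

theorem natDegree_tform_le (s : Dir K) (n : ℕ) (f : Ser K) : (tform s n f).natDegree ≤ n := by
  cases s with
  | fin a =>
    rw [tform, Polynomial.natDegree_comp, Polynomial.natDegree_X_add_C, mul_one]
    exact natDegree_hform_le _ _ _
  | inf => exact natDegree_hform_le _ _ _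

theorem tform_eq_zero_iff (s : Dir K) {n : ℕ} {f : Ser K} (hf : (n : ℕ∞) ≤ f.order) :
    tform s n f = 0 ↔ ((n + 1 : ℕ) : ℕ∞) ≤ f.order := by
  cases s with
  | fin a =>
    rw [tform, ← hform_eq_zero_iff 0 hf]
    constructor
    · intro h
      rw [Polynomial.comp_eq_zero_iff] at h
      rcases h with h | ⟨_, h⟩
      · exact h
      · have := congrArg Polynomial.natDegree h
        simp at this
    · intro h
      rw [h, Polynomial.zero_comp]
  | inf => exact hform_eq_zero_iff 1 hf

/-- Terms of degree above `n` pick up an extra exceptional factor, so after division by the `n`-th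
power only the form of degree `n`, dehomogenized at `s`, survives on the exceptional line. -/
theorem exists_blowup_eq (s : Dir K) {n : ℕ} {f : Ser K} (hf : (n : ℕ∞) ≤ f.order) :
    ∃ g, blowup s f = s.eqn ^ n *
      (Polynomial.aeval (MvPowerSeries.X s.idx.rev : Ser K) (tform s n f) + s.eqn * g) := by
  obtain ⟨g, hg⟩ := eqn_pow_dvd_blowup s (le_order_sub_hform s.idx hf)
  refine ⟨g, ?_⟩
  rw [map_sub, sub_eq_iff_eq_add, map_sum] at hg
  rw [hg]
  have : ∑ j ∈ Finset.range (n + 1), blowup s (MvPowerSeries.C ((hform s.idx n f).coeff j) *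
      MvPowerSeries.X s.idx ^ (n - j) * MvPowerSeries.X s.idx.rev ^ j) =
      s.eqn ^ n * Polynomial.aeval (MvPowerSeries.X s.idx.rev : Ser K) (tform s n f) := by
    have h1 : ∃ b, blowup s (MvPowerSeries.X s.idx.rev) = s.eqn * b ∧
        Polynomial.aeval (MvPowerSeries.X s.idx.rev : Ser K) (tform s n f) =
          Polynomial.aeval b (hform s.idx n f) := by
      cases s with
      | fin a =>
        refine ⟨y K + MvPowerSeries.C a, blowup_fin_y a, ?_⟩
        rw [tform, Polynomial.aeval_comp]
        congr 2
        rw [map_add, Polynomial.aeval_X, Polynomial.aeval_C]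
        rfl
      | inf =>
        refine ⟨x K, ?_, rfl⟩
        rw [blowup_X]
        exact mul_comm _ _
    obtain ⟨b, hb, h2⟩ := h1
    rw [h2, Polynomial.aeval_eq_sum_range' (Nat.lt_succ_of_le (natDegree_hform_le _ _ _)),
      Finset.mul_sum]
    refine Finset.sum_congr rfl fun j hj ↦ ?_
    rw [Finset.mem_range] at hj
    rw [map_mul, map_mul, map_pow, map_pow, hb, blowup_C, blowup_X_idx, mul_pow,
      MvPowerSeries.smul_eq_C_mul]
    have : s.eqn ^ n = s.eqn ^ (n - j) * s.eqn ^ j := by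
      rw [← pow_add]
      congr 1
      omega
    rw [this]
    ring
  rw [this, pow_succ]
  ring

theorem res_aeval_X (k : Fin 2) (P : K[X]) :
    res k (Polynomial.aeval (MvPowerSeries.X k.rev : Ser K) P) = (P : PowerSeries K) := by
  rw [← Polynomial.aeval_algHom_apply, res_X_rev]
  have : Polynomial.aeval (PowerSeries.X : PowerSeries K) =
      Polynomial.coeToPowerSeries.algHom (R := K) K := by
    apply Polynomial.algHom_ext
    simp
  rw [this]
  simp

/-- The strict transform of a power series. -/
theorem exists_strictTransform (s : Dir K) {f : Ser K} (hf : f ≠ 0) :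
    ∃ g, blowup s f = s.eqn ^ f.order.toNat * g ∧
      res s.idx g = (tform s f.order.toNat f : PowerSeries K) ∧
      tform s f.order.toNat f ≠ 0 := by
  have h1 := (MvPowerSeries.ne_zero_iff_order_finite).1 hf
  obtain ⟨g, hg⟩ := exists_blowup_eq s h1.le
  refine ⟨_, hg, ?_, ?_⟩
  · rw [map_add, res_aeval_X, map_mul, eqn_eq_X, res_X_self, zero_mul, add_zero]
  · rw [Ne, tform_eq_zero_iff s h1.le]
    intro h
    have h2 := h.trans_eq h1.symm
    norm_cast at h2
    omega

theorem blowup_injective (s : Dir K) : Function.Injective (blowup s) := by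
  rw [injective_iff_map_eq_zero]
  intro f hf
  by_contra h
  obtain ⟨g, hg, hr, hne⟩ := exists_strictTransform s h
  rw [hf, eq_comm, mul_eq_zero, pow_eq_zero_iff'] at hg
  rcases hg with h1 | h1
  · exact (prime_eqn s).ne_zero h1.1
  · rw [h1, map_zero, eq_comm, Polynomial.coe_eq_zero_iff] at hr
    exact hne hr

theorem eqn_dvd_iff (s : Dir K) {f : Ser K} : s.eqn ∣ f ↔ res s.idx f = 0 := by
  rw [eqn_eq_X, res_eq_zero_iff]

/-- The blow-up map is multiplicative; dividing by exceptional powers and restricting to the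
exceptional line transports this to the forms. -/
theorem hform_mul (k : Fin 2) {n m : ℕ} {f g : Ser K} (hf : (n : ℕ∞) ≤ f.order)
    (hg : (m : ℕ∞) ≤ g.order) : hform k (n + m) (f * g) = hform k n f * hform k m g := by
  have hfg : ((n + m : ℕ) : ℕ∞) ≤ (f * g).order := by
    rw [MvPowerSeries.order_mul, Nat.cast_add]
    exact add_le_add hf hg
  obtain ⟨f', hf'⟩ := exists_blowup_eq (coord k.rev) hf
  obtain ⟨g', hg'⟩ := exists_blowup_eq (coord k.rev) hg
  obtain ⟨r, hr⟩ := exists_blowup_eq (coord k.rev) hfg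
  rw [map_mul, hf', hg', pow_add, mul_mul_mul_comm] at hr
  have := mul_left_cancel₀ (mul_ne_zero (pow_ne_zero _ (prime_eqn _).ne_zero)
    (pow_ne_zero _ (prime_eqn _).ne_zero)) hr
  have := congrArg (res (coord k.rev : Dir K).idx) this
  simp only [eqn_eq_X, map_mul, map_add, res_X_self, zero_mul, add_zero, res_aeval_X,
    tform_coord, Fin.rev_rev] at this
  exact_mod_cast this.symm

end Blowup

/-! ### Strict transforms of branches: existence and uniqueness -/

section Branch

variable {K : Type*} [Field K]

theorem blowup_inVar_idx (s : Dir K) (α : PowerSeries K) :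
    blowup s (inVar s.idx α) = inVar s.idx α := by
  rw [blowup, substAlgHom_inVar, inVar, PowerSeries.coe_substAlgHom]
  congr 1
  cases s <;> rfl

/-- A linear form with tangent direction `s`. -/
theorem exists_linearForm (s : Dir K) : ∃ L : Ser K,
    blowup s L = s.eqn * MvPowerSeries.X s.idx.rev ∧
    ∀ s', s' ≠ s → ∃ b, IsUnit b ∧ blowup s' L = s'.eqn * b := by
  cases s with
  | fin a =>
    refine ⟨y K - MvPowerSeries.C a * x K, ?_, fun s' hs ↦ ?_⟩
    · rw [map_sub, map_mul, blowup_C, blowup_fin_x, blowup_fin_y]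
      change _ = x K * y K
      ring
    · cases s' with
      | fin b =>
        refine ⟨y K + MvPowerSeries.C b - MvPowerSeries.C a, ?_, ?_⟩
        · rw [isUnit_iff_constantCoeff_ne_zero]
          simp only [map_sub, map_add, MvPowerSeries.constantCoeff_X,
            MvPowerSeries.constantCoeff_C, zero_add, sub_ne_zero]
          rintro rfl
          exact hs rfl
        · rw [map_sub, map_mul, blowup_C, blowup_fin_x, blowup_fin_y]
          change _ = x K * _
          ring
      | inf =>
        refine ⟨1 - MvPowerSeries.C a * x K, ?_, ?_⟩
        · rw [isUnit_iff_constantCoeff_ne_zero]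
          simp
        · rw [map_sub, map_mul, blowup_C, blowup_X, blowup_X]
          change y K - _ * (x K * y K) = y K * _
          ring
  | inf =>
    refine ⟨x K, ?_, fun s' hs ↦ ?_⟩
    · rw [blowup_X]
      exact mul_comm _ _
    · cases s' with
      | fin b => exact ⟨1, isUnit_one, by rw [blowup_fin_x, mul_one]; rfl⟩
      | inf => exact absurd rfl hs

/-- A power series with a prescribed strict transform at `s`, and which has none elsewhere. -/
theorem exists_blowup_eq_mul_unit (s : Dir K) {h : Ser K} (hh : ¬ s.eqn ∣ h) :
    ∃ (H : Ser K) (n : ℕ), (∃ u, IsUnit u ∧ blowup s H = s.eqn ^ n * (h * u)) ∧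
      ∀ s', s' ≠ s → ∃ u, IsUnit u ∧ blowup s' H = s'.eqn ^ n * u := by
  obtain ⟨L, hL, hL'⟩ := exists_linearForm s
  obtain ⟨u, n, α, hu, hα, hE⟩ := exists_weierstrass s.idx.rev (h := h)
    (by rwa [Fin.rev_rev, ← eqn_eq_X])
  rw [Fin.rev_rev] at hE
  have key : ∀ (φ : Ser K →ₐ[K] Ser K) (e b c : Ser K), φ L = e * b →
      φ (MvPowerSeries.X s.idx) = e * c →
      φ (L ^ n + ∑ k ∈ Finset.range n,
        inVar s.idx (α k) * MvPowerSeries.X s.idx ^ (n - k) * L ^ k) =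
      e ^ n * (b ^ n + ∑ k ∈ Finset.range n,
        φ (inVar s.idx (α k)) * c ^ (n - k) * b ^ k) := by
    intro φ e b c h1 h2
    simp only [map_add, map_sum, map_mul, map_pow, h1, h2, mul_add, mul_pow, Finset.mul_sum]
    congr 1
    refine Finset.sum_congr rfl fun k hk ↦ ?_
    rw [Finset.mem_range] at hk
    have : e ^ n = e ^ (n - k) * e ^ k := by
      rw [← pow_add, Nat.sub_add_cancel hk.le]
    rw [this]
    ring
  -- The Weierstrass polynomial of `h`, homogenized with `L` in place of its variable and powers of
  -- `X s.idx` filling up the degree. At `s` this undoes the homogenization; elsewhere `L` is the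
  -- exceptional equation times a unit and all other terms vanish at the point, because the lower
  -- coefficients do.
  refine ⟨L ^ n + ∑ k ∈ Finset.range n,
    inVar s.idx (α k) * MvPowerSeries.X s.idx ^ (n - k) * L ^ k, n, ⟨u, hu, ?_⟩, fun s' hs ↦ ?_⟩
  · rw [key _ _ _ 1 hL (by rw [blowup_X_idx, mul_one]), hE]
    simp only [blowup_inVar_idx, one_pow, mul_one]
  · obtain ⟨b, hb, hbL⟩ := hL' s' hs
    obtain ⟨c, hc⟩ := eqn_dvd_blowup_X s' s.idx
    refine ⟨_, ?_, key _ _ _ c hbL hc⟩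
    rw [isUnit_iff_constantCoeff_ne_zero] at hb ⊢
    rw [map_add, map_sum, Finset.sum_eq_zero, add_zero, map_pow]
    · exact pow_ne_zero _ hb
    · intro k hk
      rw [map_mul, map_mul, constantCoeff_blowup, constantCoeff_inVar,
        hα k (Finset.mem_range.1 hk), zero_mul, zero_mul]

theorem IsBranch.not_isUnit {J : Ideal (Ser K)} (hJ : IsBranch J) {f : Ser K} (hf : f ∈ J) :
    ¬ IsUnit f :=
  fun h ↦ hJ.isPrime.ne_top (Ideal.eq_top_of_isUnit_mem _ hf h)

theorem isBranch_of_eqn_notMem {s : Dir K} {J : Ideal (Ser K)} (hJ : J.IsPrime) (h0 : J ≠ ⊥)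
    (hs : s.eqn ∉ J) : IsBranch J := by
  refine ⟨hJ, h0, ?_⟩
  rintro ⟨hx, hy⟩
  cases s with
  | fin a => exact hs hx
  | inf => exact hs hy

theorem isBranch_comap_blowup {s : Dir K} {J : Ideal (Ser K)} (hJ : IsBranch J)
    (hs : s.eqn ∉ J) (h0 : J.comap (blowup s) ≠ ⊥) : IsBranch (J.comap (blowup s)) := by
  have := hJ.isPrime
  refine ⟨Ideal.IsPrime.comap _, h0, ?_⟩
  rintro ⟨hx, hy⟩
  apply hs
  rw [← blowup_X_idx]
  cases s with
  | fin a => exact hx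
  | inf => exact hy

/-- The strict transform of a branch passes through a single point of the exceptional line and is
unibranch there. -/
theorem branch_lift_unique {s s' : Dir K} {J J' : Ideal (Ser K)} (hJ : IsBranch J)
    (hs : s.eqn ∉ J) (hJ' : IsBranch J') (hs' : s'.eqn ∉ J')
    (h : J.comap (blowup s) = J'.comap (blowup s')) : s = s' ∧ J = J' := by
  have key : ∀ {s s' : Dir K} {J J' : Ideal (Ser K)}, IsBranch J → s.eqn ∉ J → IsBranch J' →
      s'.eqn ∉ J' → J.comap (blowup s) = J'.comap (blowup s') → s = s' ∧ J ≤ J' := by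
    intro s s' J J' hJ hs hJ' hs' h
    have hp := hJ'.isPrime
    have h1 : s = s' := by
      by_contra hne
      obtain ⟨g, hg, rfl⟩ := hJ.exists_eq_span
      -- The descended series `H` lies in the common contraction, yet away from `s` it becomes an
      -- exceptional power times a unit, so no second point can carry the branch.
      obtain ⟨H, n, ⟨u, hu, hH⟩, hH'⟩ := exists_blowup_eq_mul_unit s (h := g)
        (fun hd ↦ hs (Ideal.mem_span_singleton.2
          ((prime_eqn s).dvd_prime_iff_associated hg |>.1 hd).symm.dvd))
      have hm : H ∈ (Ideal.span {g}).comap (blowup s) := by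
        rw [Ideal.mem_comap, hH, Ideal.mem_span_singleton]
        exact dvd_mul_of_dvd_right (dvd_mul_right _ _) _
      obtain ⟨v, hv, hE⟩ := hH' s' (Ne.symm hne)
      rw [h, Ideal.mem_comap, hE] at hm
      rcases hp.mem_or_mem hm with h2 | h2
      · exact hs' (hp.mem_of_pow_mem _ h2)
      · exact hJ'.not_isUnit h2 hv
    subst h1
    refine ⟨rfl, ?_⟩
    obtain ⟨g, hg, rfl⟩ := hJ.exists_eq_span
    obtain ⟨H, n, ⟨u, hu, hH⟩, -⟩ := exists_blowup_eq_mul_unit s (h := g)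
      (fun hd ↦ hs (Ideal.mem_span_singleton.2
        ((prime_eqn s).dvd_prime_iff_associated hg |>.1 hd).symm.dvd))
    have hm : H ∈ (Ideal.span {g}).comap (blowup s) := by
      rw [Ideal.mem_comap, hH, Ideal.mem_span_singleton]
      exact dvd_mul_of_dvd_right (dvd_mul_right _ _) _
    rw [h, Ideal.mem_comap, hH] at hm
    rw [Ideal.span_singleton_le_iff_mem]
    rcases hp.mem_or_mem hm with h2 | h2
    · exact absurd (hp.mem_of_pow_mem _ h2) hs'
    · exact (hp.mem_or_mem h2).resolve_right fun h3 ↦ hJ'.not_isUnit h3 hu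
  obtain ⟨h1, h2⟩ := key hJ hs hJ' hs' h
  exact ⟨h1, le_antisymm h2 (key hJ' hs' hJ hs h.symm).2⟩

/-- A binary form of positive degree has a zero on the projective line; when the dehomogenized form
is constant, the zero is at infinity. -/
theorem exists_tform_coeff_zero_eq_zero [IsAlgClosed K] {f : Ser K} {n : ℕ} (hn : n ≠ 0) :
    ∃ s : Dir K, (tform s n f).coeff 0 = 0 := by
  by_cases hd : (hform 0 n f).natDegree = 0
  · refine ⟨.inf, ?_⟩
    rw [tform, show (1 : Fin 2) = Fin.rev 0 from rfl, hform_rev, Polynomial.coeff_reflect,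
      Polynomial.revAt_le (Nat.zero_le n), Nat.sub_zero]
    exact Polynomial.coeff_eq_zero_of_natDegree_lt (by omega)
  · obtain ⟨a, ha⟩ := IsAlgClosed.exists_root (hform 0 n f)
      (fun h ↦ hd (Polynomial.natDegree_eq_of_degree_eq_some h))
    refine ⟨.fin a, ?_⟩
    rw [tform, Polynomial.coeff_zero_eq_eval_zero, Polynomial.eval_comp]
    simpa using ha

theorem exists_prime_factor {f : Ser K} (hf : f ≠ 0) (hu : ¬ IsUnit f) :
    ∃ g, Prime g ∧ g ∣ f := by
  obtain ⟨g, hg, hgf⟩ := WfDvdMonoid.exists_irreducible_factor hu hf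
  exact ⟨g, hg.prime, hgf⟩

/-- At a zero of the initial form the strict transform of an equation is a nonunit not divisible by
the exceptional equation, so it has a non-exceptional prime factor. Its contraction contains `J`,
hence equals `J`. -/
theorem branch_lift_exists [IsAlgClosed K] {J : Ideal (Ser K)} (hJ : IsBranch J) :
    ∃ (s : Dir K) (J' : Ideal (Ser K)), IsBranch J' ∧ s.eqn ∉ J' ∧ J'.comap (blowup s) = J := by
  obtain ⟨g, hg, rfl⟩ := hJ.exists_eq_span
  have hn : g.order.toNat ≠ 0 := by
    have h1 := (MvPowerSeries.ne_zero_iff_order_finite).1 hg.ne_zero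
    intro h0
    rw [h0, eq_comm, Nat.cast_zero] at h1
    refine (MvPowerSeries.order_ne_zero_iff_constCoeff_eq_zero.2 ?_) h1
    by_contra h2
    exact hg.not_isUnit (isUnit_iff_constantCoeff_ne_zero.2 h2)
  obtain ⟨s, hs⟩ := exists_tform_coeff_zero_eq_zero (f := g) hn
  obtain ⟨f, hf, hr, hne⟩ := exists_strictTransform s hg.ne_zero
  have hres : res s.idx f ≠ 0 := by rwa [hr, Ne, Polynomial.coe_eq_zero_iff]
  have hf0 : f ≠ 0 := by rintro rfl; exact hres (map_zero _)
  have hfu : ¬ IsUnit f := by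
    rw [isUnit_iff_constantCoeff_ne_zero, not_not, ← constantCoeff_res s.idx, hr,
      ← PowerSeries.coeff_zero_eq_constantCoeff_apply, Polynomial.coeff_coe, hs]
  obtain ⟨k, hk, hkf⟩ := exists_prime_factor hf0 hfu
  have hsk : s.eqn ∉ Ideal.span {k} := by
    rw [Ideal.mem_span_singleton]
    intro h
    apply hres
    rw [← eqn_dvd_iff]
    exact ((hk.dvd_prime_iff_associated (prime_eqn s)).1 h).symm.dvd.trans hkf
  have hle : Ideal.span {g} ≤ (Ideal.span {k}).comap (blowup s) := by
    rw [Ideal.span_singleton_le_iff_mem, Ideal.mem_comap, hf, Ideal.mem_span_singleton]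
    exact dvd_mul_of_dvd_right hkf _
  have hb := isBranch_span_singleton hk
  refine ⟨s, Ideal.span {k}, hb, hsk, ?_⟩
  refine ((isBranch_comap_blowup hb hsk ?_).eq_of_le hJ.isPrime hJ.ne_bot hle).symm
  intro h
  exact hJ.ne_bot (le_bot_iff.1 (h ▸ hle))

theorem pullback_cons (s : Dir K) (P : NearPoint K) (f : Ser K) :
    pullback (s :: P) f = pullback P (blowup s f) := rfl

theorem pullback_append (P R : NearPoint K) (f : Ser K) :
    pullback (P ++ R) f = pullback R (pullback P f) := by
  induction P generalizing f with
  | nil => rfl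
  | cons s P ih => rw [List.cons_append, pullback_cons, ih, pullback_cons]

theorem pullback_concat (P : NearPoint K) (s : Dir K) (f : Ser K) :
    pullback (P ++ [s]) f = blowup s (pullback P f) :=
  pullback_append P [s] f

theorem pullback_injective (P : NearPoint K) : Function.Injective (pullback P) := by
  induction P with
  | nil => exact fun _ _ h ↦ h
  | cons s P ih => exact ih.comp (blowup_injective s)

theorem constantCoeff_pullback (P : NearPoint K) (f : Ser K) :
    MvPowerSeries.constantCoeff (pullback P f) = MvPowerSeries.constantCoeff f := by
  induction P generalizing f with
  | nil => rfl
  | cons s P ih => rw [pullback_cons, ih, constantCoeff_blowup]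

@[simp]
theorem pullback_C (P : NearPoint K) (a : K) :
    pullback P (MvPowerSeries.C a) = MvPowerSeries.C a :=
  (pullback P).commutes a

/-- `J` is a branch at the point `P` of the strict transform of the branch `I` at the origin. -/
structure LiesOver (P : NearPoint K) (J I : Ideal (Ser K)) : Prop where
  isBranch : IsBranch J
  base : IsBranch I
  comap_eq : J.comap (pullback P) = I

theorem LiesOver.of_cons {s : Dir K} {P : NearPoint K} {J I : Ideal (Ser K)}
    (h : LiesOver (s :: P) J I) :
    s.eqn ∉ J.comap (pullback P) ∧ LiesOver P J (J.comap (pullback P)) ∧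
      (J.comap (pullback P)).comap (blowup s) = I := by
  have hc : (J.comap (pullback P)).comap (blowup s) = I := h.comap_eq
  have hp := h.isBranch.isPrime
  have hs : s.eqn ∉ J.comap (pullback P) := by
    intro hs
    apply h.base.not_mem
    rw [← hc]
    exact ⟨Ideal.mem_of_dvd (J.comap (pullback P)) (eqn_dvd_blowup_X s 0) hs,
      Ideal.mem_of_dvd (J.comap (pullback P)) (eqn_dvd_blowup_X s 1) hs⟩
  refine ⟨hs, ⟨h.isBranch, isBranch_of_eqn_notMem (Ideal.IsPrime.comap _) ?_ hs, rfl⟩, hc⟩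
  intro h0
  apply h.base.ne_bot
  rw [← hc, h0, eq_bot_iff]
  intro f hf
  exact (blowup_injective s) (by simpa using hf)

theorem LiesOver.nil_eq {J I : Ideal (Ser K)} (h : LiesOver [] J I) : J = I :=
  h.comap_eq

/-- By uniqueness of lifts, a branch determines the sequence of points through which its strict
transforms pass. -/
theorem LiesOver.prefix_or {P P' : NearPoint K} {J J' I : Ideal (Ser K)} (h : LiesOver P J I)
    (h' : LiesOver P' J' I) : P <+: P' ∨ P' <+: P := by
  induction P generalizing P' I with
  | nil => exact .inl List.nil_prefix
  | cons s P ih =>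
    cases P' with
    | nil => exact .inr List.nil_prefix
    | cons s' P' =>
      obtain ⟨h1, h2, h3⟩ := h.of_cons
      obtain ⟨h1', h2', h3'⟩ := h'.of_cons
      obtain ⟨rfl, h4⟩ := branch_lift_unique h2.base h1 h2'.base h1' (h3.trans h3'.symm)
      rw [List.prefix_cons_inj, List.prefix_cons_inj]
      exact ih h2 (h4 ▸ h2')

theorem LiesOver.unique {P : NearPoint K} {J J' I : Ideal (Ser K)} (h : LiesOver P J I)
    (h' : LiesOver P J' I) : J = J' := by
  induction P generalizing I with
  | nil => exact h.nil_eq.trans h'.nil_eq.symm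
  | cons s P ih =>
    obtain ⟨h1, h2, h3⟩ := h.of_cons
    obtain ⟨h1', h2', h3'⟩ := h'.of_cons
    obtain ⟨-, h4⟩ := branch_lift_unique h2.base h1 h2'.base h1' (h3.trans h3'.symm)
    exact ih h2 (h4 ▸ h2')

theorem LiesOver.exists_concat [IsAlgClosed K] {P : NearPoint K} {J I : Ideal (Ser K)}
    (h : LiesOver P J I) : ∃ (s : Dir K) (J' : Ideal (Ser K)), LiesOver (P ++ [s]) J' I := by
  obtain ⟨s, J', hJ', hs, hc⟩ := branch_lift_exists h.isBranch
  refine ⟨s, J', hJ', h.base, ?_⟩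
  rw [← h.comap_eq, ← hc]
  ext f
  rw [Ideal.mem_comap, Ideal.mem_comap, Ideal.mem_comap, pullback_concat]

/-- The branches which are not exceptional. -/
theorem liesOver_comap {P : NearPoint K} {J : Ideal (Ser K)} (hJ : IsBranch J) {f : Ser K}
    (hf : f ≠ 0) (hfJ : pullback P f ∈ J) (hn : ¬ (pullback P (x K) ∈ J ∧ pullback P (y K) ∈ J)) :
    LiesOver P J (J.comap (pullback P)) := by
  have := hJ.isPrime
  refine ⟨hJ, ⟨Ideal.IsPrime.comap _, ?_, hn⟩, rfl⟩
  intro h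
  have : f ∈ J.comap (pullback P) := hfJ
  rw [h] at this
  exact hf this

theorem mem_strictBranches_iff {p q : Ser K} {t : K} {P : NearPoint K} (hf : fibre p q t ≠ 0)
    {J : Ideal (Ser K)} : J ∈ strictBranches p q t P ↔
      IsBranch J ∧ pullback P (fibre p q t) ∈ J ∧
        ¬ (pullback P (x K) ∈ J ∧ pullback P (y K) ∈ J) := by
  rw [strictBranches, Set.mem_ofPred_eq, mem_minimalPrimes_span_singleton_iff, and_assoc]
  rwa [Ne, map_eq_zero_iff _ (pullback_injective P)]

theorem mem_branches_iff {p q : Ser K} {t : K} (hf : fibre p q t ≠ 0) {J : Ideal (Ser K)} :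
    J ∈ branches p q t ↔ IsBranch J ∧ fibre p q t ∈ J :=
  mem_minimalPrimes_span_singleton_iff hf

/-- A branch through a coordinate line of an infinitely near point which is exceptional. -/
theorem X_mem_of_pullback_mem {P : NearPoint K} {J : Ideal (Ser K)} (hJ : J.IsPrime)
    {f : Ser K} (hf : ∀ J : Ideal (Ser K), J.IsPrime → f ∈ J → x K ∈ J ∨ y K ∈ J)
    (h : pullback P f ∈ J) : x K ∈ J ∨ y K ∈ J := by
  induction P using List.reverseRecOn generalizing J with
  | nil => exact hf J hJ h
  | append_singleton P s ih =>
    rw [pullback_concat] at h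
    have h1 := ih (Ideal.IsPrime.comap (blowup s)) (J := J.comap (blowup s)) h
    rw [Ideal.mem_comap, Ideal.mem_comap] at h1
    rcases s with a | _
    · by_cases hx : x K ∈ J
      · exact .inl hx
      rw [blowup_fin_x, blowup_fin_y] at h1
      have h2 := (hJ.mem_or_mem (h1.resolve_left hx)).resolve_left hx
      by_cases ha : a = 0
      · subst ha
        right
        simpa using h2
      · exfalso
        refine hJ.ne_top (Ideal.eq_top_of_isUnit_mem _ h2 ?_)
        rw [isUnit_iff_constantCoeff_ne_zero]
        simpa using ha
    · rw [blowup_X, blowup_X] at h1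
      rcases h1 with h1 | h1
      · exact hJ.mem_or_mem h1
      · exact .inr h1

end Branch

/-! ### Normal form of the pencil at infinitely near points -/

section Chart

variable {K : Type*} [Field K]

theorem res_blowup_coord (i : Fin 2) (f : Ser K) : res i (blowup (coord i) f) = res i f := by
  rw [res, blowup, MvPowerSeries.substAlgHom_comp_substAlgHom_apply, MvPowerSeries.substAlgHom_apply,
    MvPowerSeries.substAlgHom_apply]
  congr 1
  funext j
  change res i (blowupCoord (coord i) j) = _
  rw [← blowup_X]
  split_ifs with h
  · subst h
    rw [blowup_coord_X_self, map_mul, res_X_self, mul_zero]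
  · rw [eq_rev_of_ne h, blowup_coord_X_rev, res_X_rev]

theorem order_le_order_res (k : Fin 2) (f : Ser K) : f.order ≤ (res k f).order := by
  refine PowerSeries.le_order _ _ fun n hn ↦ ?_
  rw [coeff_res]
  refine MvPowerSeries.coeff_of_lt_order (lt_of_eq_of_lt ?_ hn)
  simp

theorem order_coe_le {P : K[X]} (hP : P ≠ 0) {n : ℕ} (hn : P.natDegree ≤ n) :
    (P : PowerSeries K).order ≤ n := by
  refine (PowerSeries.order_le P.natDegree ?_).trans (by exact_mod_cast hn)
  rw [Polynomial.coeff_coe]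
  exact Polynomial.leadingCoeff_ne_zero.2 hP

/-- The monomial with the given exponents. -/
def mon (m : Fin 2 → ℕ) : Ser K := MvPowerSeries.X 0 ^ m 0 * MvPowerSeries.X 1 ^ m 1

theorem mon_eq (i : Fin 2) (m : Fin 2 → ℕ) :
    (mon m : Ser K) = MvPowerSeries.X i ^ m i * MvPowerSeries.X i.rev ^ m i.rev := by
  fin_cases i
  · rfl
  · exact mul_comm _ _

theorem add_eq (i : Fin 2) (m : Fin 2 → ℕ) : m 0 + m 1 = m i + m i.rev := by
  fin_cases i
  · rfl
  · exact add_comm _ _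

theorem mon_ne_zero (m : Fin 2 → ℕ) : (mon m : Ser K) ≠ 0 :=
  mul_ne_zero (pow_ne_zero _ (prime_X 0).ne_zero) (pow_ne_zero _ (prime_X 1).ne_zero)

theorem isUnit_mon_iff {m : Fin 2 → ℕ} : IsUnit (mon m : Ser K) ↔ m = 0 := by
  constructor
  · intro h
    funext i
    rw [mon_eq i] at h
    by_contra hi
    exact not_isUnit_X i ((isUnit_pow_iff hi).1 (isUnit_of_mul_isUnit_left h))
  · rintro rfl
    simp [mon]

theorem order_X_pow (i : Fin 2) (n : ℕ) : (MvPowerSeries.X i ^ n : Ser K).order = n := by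
  rw [MvPowerSeries.X_pow_eq, MvPowerSeries.order_monomial_of_ne_zero one_ne_zero]
  simp

theorem order_mon (m : Fin 2 → ℕ) : (mon m : Ser K).order = (m 0 + m 1 : ℕ) := by
  rw [mon, MvPowerSeries.order_mul, order_X_pow, order_X_pow, Nat.cast_add]

/-- The normal form of the pull-backs of `p` and `q` at an infinitely near point: up to a common
exceptional factor they are `h` and the monomial with exponents `m`. -/
structure Chart (p q : Ser K) (P : NearPoint K) (h : Ser K) (m : Fin 2 → ℕ) : Prop where
  factor : ∃ e, e ≠ 0 ∧ (∀ J : Ideal (Ser K), J.IsPrime → e ∈ J →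
    pullback P (x K) ∈ J ∧ pullback P (y K) ∈ J) ∧
    pullback P p = e * h ∧ pullback P q = e * mon m
  ne_zero : h ≠ 0
  not_dvd : ∀ k, m k ≠ 0 → ¬ MvPowerSeries.X k ∣ h
  inv : (∃ i, m i = 0) ∨ ∃ i, (res i.rev h).order < m i

variable {p q : Ser K} {P : NearPoint K} {h : Ser K} {m : Fin 2 → ℕ}

theorem Chart.order_toNat (hc : Chart p q P h m) : (h.order.toNat : ℕ∞) = h.order :=
  (MvPowerSeries.ne_zero_iff_order_finite).1 hc.ne_zero

/-- As `h` and `mon m` have no common prime factor, one divides the other only if it is a unit. -/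
theorem Chart.isBasePoint_iff (hc : Chart p q P h m) :
    IsBasePoint p q P ↔ ¬ IsUnit h ∧ m ≠ 0 := by
  obtain ⟨e, he, -, hp, hq⟩ := hc.factor
  rw [IsBasePoint, hp, hq, mul_dvd_mul_iff_left he, mul_dvd_mul_iff_left he]
  by_cases hm : m = 0
  · have : IsUnit (mon m : Ser K) := isUnit_mon_iff.2 hm
    simp [hm, isUnit_mon_iff.2]
  · obtain ⟨k, hk⟩ := Function.ne_iff.1 hm
    have h1 : ¬ mon m ∣ h := by
      rw [mon_eq k]
      intro hd
      exact hc.not_dvd k hk ((dvd_pow_self _ hk).trans ((dvd_mul_right _ _).trans hd))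
    have h2 : h ∣ mon m ↔ IsUnit h := by
      refine ⟨fun hd ↦ ?_, fun hu ↦ hu.dvd⟩
      by_contra hu
      obtain ⟨g, hg, hgh⟩ := exists_prime_factor hc.ne_zero hu
      have h3 : ∀ i, g ∣ MvPowerSeries.X i ^ m i → False := by
        intro i hi
        have hi0 : m i ≠ 0 := by
          intro h0
          rw [h0, pow_zero] at hi
          exact hg.not_isUnit (isUnit_of_dvd_one hi)
        have := (hg.dvd_prime_iff_associated (prime_X i)).1 (hg.dvd_of_dvd_pow hi)
        exact hc.not_dvd i hi0 (this.symm.dvd.trans hgh)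
      rcases hg.dvd_or_dvd (hgh.trans hd) with h4 | h4
      · exact h3 0 h4
      · exact h3 1 h4
    simp [h1, h2, hm]

/-- The common part of the two exceptional powers goes into `e`. The excess stays in `h` if
`h.order` is the larger one and in the monomial otherwise; truncated subtraction covers both cases
in one formula. -/
theorem Chart.step (hc : Chart p q P h m) {s : Dir K} {g v w : Ser K} {m' : Fin 2 → ℕ}
    (hg : blowup s h = s.eqn ^ h.order.toNat * g) (hgE : ¬ s.eqn ∣ g)
    (hv : blowup s (mon m) = s.eqn ^ (m 0 + m 1) * (MvPowerSeries.X s.idx.rev ^ m' s.idx.rev * v))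
    (hvw : v * w = 1) (hm' : m' s.idx = m 0 + m 1 - h.order.toNat)
    (hnd : m' s.idx.rev ≠ 0 → ¬ MvPowerSeries.X s.idx.rev ∣ g)
    (hinv : (∃ i, m' i = 0) ∨
      ∃ i, (res i.rev (s.eqn ^ (h.order.toNat - (m 0 + m 1)) * (g * w))).order < m' i) :
    Chart p q (P ++ [s]) (s.eqn ^ (h.order.toNat - (m 0 + m 1)) * (g * w)) m' := by
  obtain ⟨e, he, hJ, hp, hq⟩ := hc.factor
  have hE := (prime_eqn s).ne_zero
  have aux : ∀ a b : ℕ, min a b + (a - b) = a ∧ min a b + (b - a) = b := by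
    clear * -
    omega
  have hu : IsUnit w := IsUnit.of_mul_eq_one v (by rw [mul_comm, hvw])
  have huv : IsUnit v := IsUnit.of_mul_eq_one w hvw
  have hdvd : ∀ k, MvPowerSeries.X k ∣ g * w ↔ MvPowerSeries.X k ∣ g := fun k ↦ hu.dvd_mul_right
  refine ⟨⟨blowup s e * (s.eqn ^ min h.order.toNat (m 0 + m 1) * v), ?_, ?_, ?_, ?_⟩, ?_, ?_, hinv⟩
  · refine mul_ne_zero ?_ (mul_ne_zero (pow_ne_zero _ hE) huv.ne_zero)
    rwa [Ne, map_eq_zero_iff _ (blowup_injective s)]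
  · intro J hp hmem
    rw [pullback_concat, pullback_concat]
    rcases hp.mem_or_mem hmem with h1 | h1
    · exact hJ (J.comap (blowup s)) (Ideal.IsPrime.comap _) h1
    · rcases hp.mem_or_mem h1 with h2 | h2
      · have h3 := hp.mem_of_pow_mem _ h2
        have h4 : ∀ f : Ser K, MvPowerSeries.constantCoeff f = 0 → blowup s f ∈ J := by
          intro f hf
          obtain ⟨a, b, rfl⟩ := exists_eq_add_of_constantCoeff_eq_zero hf
          rw [map_add, map_mul, map_mul]
          exact J.add_mem (J.mul_mem_right _ (Ideal.mem_of_dvd _ (eqn_dvd_blowup_X s 0) h3))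
            (J.mul_mem_right _ (Ideal.mem_of_dvd _ (eqn_dvd_blowup_X s 1) h3))
        exact ⟨h4 _ (by simp [constantCoeff_pullback]), h4 _ (by simp [constantCoeff_pullback])⟩
      · exact absurd (Ideal.eq_top_of_isUnit_mem _ h2 huv) hp.ne_top
  · rw [pullback_concat, hp, map_mul, hg]
    have : s.eqn ^ h.order.toNat = s.eqn ^ min h.order.toNat (m 0 + m 1) *
        s.eqn ^ (h.order.toNat - (m 0 + m 1)) := by
      rw [← pow_add, (aux _ _).1]
    rw [this]
    linear_combination (- blowup s e * s.eqn ^ min h.order.toNat (m 0 + m 1) *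
        s.eqn ^ (h.order.toNat - (m 0 + m 1)) * g) * hvw
  · rw [pullback_concat, hq, map_mul, hv, mon_eq s.idx, hm', ← eqn_eq_X]
    have : s.eqn ^ (m 0 + m 1) = s.eqn ^ min h.order.toNat (m 0 + m 1) *
        s.eqn ^ (m 0 + m 1 - h.order.toNat) := by
      rw [← pow_add, (aux _ _).2]
    rw [this]
    ring
  · refine mul_ne_zero (pow_ne_zero _ hE) (mul_ne_zero ?_ hu.ne_zero)
    rintro rfl
    exact hgE (dvd_zero _)
  · intro k hk hd
    by_cases hks : k = s.idx
    · subst hks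
      have h0 : h.order.toNat - (m 0 + m 1) = 0 := by omega
      rw [h0, pow_zero, one_mul, hdvd, ← eqn_eq_X] at hd
      exact hgE hd
    · have hks := eq_rev_of_ne hks
      subst hks
      rcases (prime_X s.idx.rev).dvd_or_dvd hd with h1 | h1
      · have h2 := (prime_X s.idx.rev).dvd_of_dvd_pow h1
        rw [eqn_eq_X, ← res_eq_zero_iff, res_rev_X] at h2
        exact PowerSeries.X_ne_zero h2
      · exact hnd hk ((hdvd _).1 h1)

theorem blowup_coord_mon (i : Fin 2) (m : Fin 2 → ℕ) : blowup (coord i) (mon m : Ser K) =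
    MvPowerSeries.X i.rev ^ (m 0 + m 1) * MvPowerSeries.X i ^ m i := by
  rw [mon_eq i, map_mul, map_pow, map_pow, blowup_coord_X_self, blowup_coord_X_rev, add_eq i]
  ring

theorem exists_strictTransform_coord (i : Fin 2) {f : Ser K} (hf : f ≠ 0) :
    ∃ g, blowup (coord i) f = MvPowerSeries.X i.rev ^ f.order.toNat * g ∧
      ¬ MvPowerSeries.X i.rev ∣ g ∧ hform i.rev f.order.toNat f ≠ 0 ∧
      res i.rev g = (hform i.rev f.order.toNat f : PowerSeries K) ∧
      res i f = PowerSeries.X ^ f.order.toNat * res i g := by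
  obtain ⟨g, hg, hr, hne⟩ := exists_strictTransform (coord i) hf
  rw [eqn_coord] at hg
  rw [idx_coord, tform_coord] at hr
  rw [tform_coord] at hne
  refine ⟨g, hg, ?_, hne, hr, ?_⟩
  · rwa [← res_eq_zero_iff, hr, Polynomial.coe_eq_zero_iff]
  · rw [← res_blowup_coord, hg, map_mul, map_pow, res_X_rev]

/-- The strict transform meets the new exceptional line with multiplicity at most `h.order`, and
restriction to the old line `X i = 0` loses exactly `h.order`. These two facts carry the invariant
`inv` over. -/
theorem Chart.step_coord (hc : Chart p q P h m) (i : Fin 2) {g : Ser K}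
    (hg : blowup (coord i) h = MvPowerSeries.X i.rev ^ h.order.toNat * g) :
    Chart p q (P ++ [coord i])
      (MvPowerSeries.X i.rev ^ (h.order.toNat - (m 0 + m 1)) * g)
      (Function.update m i.rev (m 0 + m 1 - h.order.toNat)) := by
  obtain ⟨g', hg', hnd, hne, hr, hri⟩ := exists_strictTransform_coord i hc.ne_zero
  have : g' = g := mul_left_cancel₀ (pow_ne_zero _ (prime_X _).ne_zero) (hg'.symm.trans hg)
  subst this
  have hu : ∀ k, Function.update m i.rev k i = m i := fun k ↦
    Function.update_of_ne (rev_ne i).symm _ _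
  have hordr : (res i.rev g').order ≤ h.order.toNat := by
    rw [hr]
    exact order_coe_le hne (natDegree_hform_le _ _ _)
  have := hc.step (s := coord i) (g := g') (v := 1) (w := 1)
    (m' := Function.update m i.rev (m 0 + m 1 - h.order.toNat)) (by rw [hg', eqn_coord])
    (by rwa [eqn_coord]) ?_ (mul_one 1) (by rw [idx_coord, Function.update_self]) ?_ ?_
  · simpa using this
  · rw [blowup_coord_mon, eqn_coord, idx_coord, Fin.rev_rev, hu, mul_one]
  · rw [idx_coord, Fin.rev_rev, hu]
    intro hm hd
    apply hc.not_dvd i hm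
    rw [← res_eq_zero_iff] at hd ⊢
    rw [hri, hd, mul_zero]
  · rw [eqn_coord, mul_one]
    have hadd := add_eq i m
    rcases hc.inv with ⟨j, hj⟩ | ⟨j, hj⟩
    · by_cases hji : j = i
      · exact .inl ⟨i, by rw [hu, ← hji, hj]⟩
      · have hji := eq_rev_of_ne hji
        subst hji
        by_cases hle : m i ≤ h.order.toNat
        · exact .inl ⟨i.rev, by rw [Function.update_self]; omega⟩
        · refine .inr ⟨i, ?_⟩
          rw [hu, show h.order.toNat - (m 0 + m 1) = 0 by omega, pow_zero, one_mul]
          exact hordr.trans_lt (by exact_mod_cast not_le.1 hle)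
    -- Here the new line is polar too. If the old line `X j = 0` is still present, its pole order
    -- exceeds the restriction of `g` to the new line; otherwise both sides of the inequality drop
    -- by `h.order`, or the right one by less.
    · have h1 : h.order.toNat < m j := by
        have h2 := (order_le_order_res j.rev h).trans_lt hj
        rw [← hc.order_toNat] at h2
        exact_mod_cast h2
      have h3 := add_eq j m
      rw [show h.order.toNat - (m 0 + m 1) = 0 by omega, pow_zero, one_mul]
      by_cases hji : j = i
      · subst hji
        refine .inr ⟨j, ?_⟩
        rw [hu]
        exact hordr.trans_lt (by exact_mod_cast h1)
      · have hji := eq_rev_of_ne hji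
        subst hji
        refine .inr ⟨i.rev, ?_⟩
        rw [Function.update_self]
        rw [Fin.rev_rev] at hj ⊢
        rw [hri, PowerSeries.order_mul, PowerSeries.order_X_pow] at hj
        have h4 : res i g' ≠ 0 := by
          intro h0
          rw [h0, PowerSeries.order_zero] at hj
          simp at hj
        rw [← PowerSeries.coe_toNat_order h4] at hj ⊢
        norm_cast at hj ⊢
        omega

theorem Chart.step_fin (hc : Chart p q P h m) {a : K} {g w : Ser K}
    (hg : blowup (.fin a) h = x K ^ h.order.toNat * g)
    (hw : (y K + MvPowerSeries.C a) ^ m 1 * w = 1) :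
    Chart p q (P ++ [.fin a])
      (x K ^ (h.order.toNat - (m 0 + m 1)) * (g * w))
      ![m 0 + m 1 - h.order.toNat, 0] := by
  obtain ⟨g', hg', hr, hne⟩ := exists_strictTransform (.fin a) hc.ne_zero
  have : g' = g := mul_left_cancel₀ (pow_ne_zero _ (prime_X _).ne_zero) (hg'.symm.trans hg)
  subst this
  refine hc.step (s := .fin a) hg ?_ ?_ hw rfl ?_ (.inl ⟨1, rfl⟩)
  · rwa [eqn_dvd_iff, hr, Polynomial.coe_eq_zero_iff]
  · change _ = x K ^ _ * ((y K) ^ 0 * _)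
    rw [mon, map_mul, map_pow, map_pow, blowup_fin_x, blowup_fin_y, mul_pow]
    ring
  · intro h
    exact absurd rfl h

theorem exists_mul_eq_one {a : K} (ha : a ≠ 0) (n : ℕ) :
    ∃ w : Ser K, (y K + MvPowerSeries.C a) ^ n * w = 1 := by
  have : IsUnit ((y K + MvPowerSeries.C a) ^ n) := by
    refine IsUnit.pow _ ?_
    rw [isUnit_iff_constantCoeff_ne_zero]
    simpa using ha
  exact this.exists_right_inv

theorem Chart.exists_concat (hc : Chart p q P h m) (s : Dir K) :
    ∃ h' m', Chart p q (P ++ [s]) h' m' := by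
  rcases s.eq_coord_or with ⟨i, rfl⟩ | ⟨a, ha, rfl⟩
  · obtain ⟨g, hg, -⟩ := exists_strictTransform_coord i hc.ne_zero
    exact ⟨_, _, hc.step_coord i hg⟩
  · obtain ⟨g, hg, -⟩ := exists_strictTransform (.fin a) hc.ne_zero
    obtain ⟨w, hw⟩ := exists_mul_eq_one ha (m 1)
    exact ⟨_, _, hc.step_fin hg hw⟩

theorem Chart.exists_append (hc : Chart p q P h m) (R : NearPoint K) :
    ∃ h' m', Chart p q (P ++ R) h' m' := by
  induction R using List.reverseRecOn with
  | nil => exact ⟨h, m, by rwa [List.append_nil]⟩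
  | append_singleton R s ih =>
    obtain ⟨h', m', hc'⟩ := ih
    rw [← List.append_assoc]
    exact hc'.exists_concat s

theorem chart_nil {U : Ser K} {c : ℕ} (hU : IsUnit U) (hq : q = x K ^ c * U)
    (hp : ¬ x K ∣ p) : ∃ h m, Chart p q [] h m := by
  obtain ⟨V, hV⟩ := hU.exists_right_inv
  have hVu : IsUnit V := IsUnit.of_mul_eq_one U (by rw [mul_comm, hV])
  refine ⟨p * V, ![c, 0], ⟨U, hU.ne_zero, ?_, ?_, ?_⟩, ?_, ?_, .inl ⟨1, rfl⟩⟩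
  · intro J hJ h
    exact absurd (Ideal.eq_top_of_isUnit_mem _ h hU) hJ.ne_top
  · change p = _
    linear_combination (-p) * hV
  · change q = U * (x K ^ c * y K ^ 0)
    rw [hq]
    ring
  · refine mul_ne_zero ?_ hVu.ne_zero
    rintro rfl
    exact hp (dvd_zero _)
  · intro k hk hd
    fin_cases k
    · exact hp (hVu.dvd_mul_right.1 hd)
    · exact hk rfl

/-- The intersection number of the two members of the pencil without common exceptional factor. -/
def meas (h : Ser K) (m : Fin 2 → ℕ) : ℕ :=
  m 0 * (res 0 h).order.toNat + m 1 * (res 1 h).order.toNat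

theorem meas_eq (i : Fin 2) (h : Ser K) (m : Fin 2 → ℕ) : meas h m =
    m i * (res i h).order.toNat + m i.rev * (res i.rev h).order.toNat := by
  fin_cases i
  · rfl
  · exact add_comm _ _

theorem Chart.order_le_toNat (hc : Chart p q P h m) {k : Fin 2} (hk : m k ≠ 0) :
    h.order.toNat ≤ (res k h).order.toNat := by
  have h1 : res k h ≠ 0 := fun h0 ↦ hc.not_dvd k hk (res_eq_zero_iff.1 h0)
  have h2 := order_le_order_res k h
  rw [← hc.order_toNat, ← PowerSeries.coe_toNat_order h1] at h2
  exact_mod_cast h2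

theorem Chart.order_pos (hc : Chart p q P h m) (hb : IsBasePoint p q P) : 0 < h.order.toNat := by
  have h1 := (hc.isBasePoint_iff.1 hb).1
  rw [isUnit_iff_constantCoeff_ne_zero, not_not] at h1
  have h2 := MvPowerSeries.order_ne_zero_iff_constCoeff_eq_zero.2 h1
  rw [← hc.order_toNat] at h2
  exact Nat.pos_of_ne_zero (by exact_mod_cast h2)

theorem Chart.sum_pos (hc : Chart p q P h m) (hb : IsBasePoint p q P) : 0 < m 0 + m 1 := by
  obtain ⟨k, hk⟩ := Function.ne_iff.1 (hc.isBasePoint_iff.1 hb).2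
  rw [add_eq k]
  exact Nat.add_pos_left (Nat.pos_of_ne_zero hk) _

theorem toNat_order_X_pow_mul (n : ℕ) {r : PowerSeries K} (hr : r ≠ 0) :
    (PowerSeries.X ^ n * r).order.toNat = n + r.order.toNat := by
  rw [PowerSeries.order_mul, PowerSeries.order_X_pow, ← PowerSeries.coe_toNat_order hr]
  norm_cast

/-- Noether's formula in the form needed for termination: both the order of `h` and that of the
monomial are positive at a base point, so the intersection number strictly drops. -/
theorem Chart.meas_step_coord_lt (hc : Chart p q P h m) (hb : IsBasePoint p q P) (i : Fin 2)
    {g : Ser K} (hg : blowup (coord i) h = MvPowerSeries.X i.rev ^ h.order.toNat * g) :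
    meas (MvPowerSeries.X i.rev ^ (h.order.toNat - (m 0 + m 1)) * g)
      (Function.update m i.rev (m 0 + m 1 - h.order.toNat)) < meas h m := by
  obtain ⟨g', hg', hnd, hne, hr, hri⟩ := exists_strictTransform_coord i hc.ne_zero
  have : g' = g := mul_left_cancel₀ (pow_ne_zero _ (prime_X _).ne_zero) (hg'.symm.trans hg)
  subst this
  have hordr : (res i.rev g').order.toNat ≤ h.order.toNat := by
    have h1 : (res i.rev g').order ≤ h.order.toNat := by
      rw [hr]
      exact order_coe_le hne (natDegree_hform_le _ _ _)
    exact ENat.toNat_le_of_le_natCast h1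
  have hμ := hc.order_pos hb
  have hsum := hc.sum_pos hb
  have hi := hc.order_le_toNat (k := i)
  have hi' := hc.order_le_toNat (k := i.rev)
  have hadd := add_eq i m
  rw [meas_eq i, meas_eq i h, Function.update_of_ne (rev_ne i).symm, Function.update_self,
    map_mul, map_pow, res_X_rev]
  have hpow : m i ≠ 0 → (res i h).order.toNat = h.order.toNat + (res i g').order.toNat ∧
      (PowerSeries.X ^ (h.order.toNat - (m 0 + m 1)) * res i g').order.toNat =
        (h.order.toNat - (m 0 + m 1)) + (res i g').order.toNat := by
    intro hm
    have h1 : res i g' ≠ 0 := by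
      intro h0
      rw [h0, mul_zero] at hri
      exact hc.not_dvd i hm (res_eq_zero_iff.1 hri)
    exact ⟨by rw [hri, toNat_order_X_pow_mul _ h1], toNat_order_X_pow_mul _ h1⟩
  by_cases hle : m 0 + m 1 ≤ h.order.toNat
  · rw [Nat.sub_eq_zero_of_le hle, zero_mul, add_zero]
    by_cases hm : m i = 0
    · rw [hm, zero_mul, zero_mul, zero_add]
      have := hi' (by omega)
      exact Nat.mul_pos (by omega) (by omega)
    · obtain ⟨h1, h2⟩ := hpow hm
      rw [h1, h2]
      refine Nat.lt_add_right _ (Nat.mul_lt_mul_of_pos_left ?_ (Nat.pos_of_ne_zero hm))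
      omega
  · have h0 : h.order.toNat - (m 0 + m 1) = 0 := by omega
    rw [h0, pow_zero, pow_zero, one_mul, one_mul]
    obtain ⟨k, hk⟩ := Nat.exists_eq_add_of_lt (not_le.1 hle)
    set μ := h.order.toNat
    have h3 : m 0 + m 1 - μ = k + 1 := by omega
    rw [h3]
    have h4 : (k + 1) * (res i.rev g').order.toNat ≤ (k + 1) * μ := Nat.mul_le_mul_left _ hordr
    have h5 : m i.rev * μ ≤ m i.rev * (res i.rev h).order.toNat := by
      by_cases hm : m i.rev = 0
      · simp [hm]
      · exact Nat.mul_le_mul_left _ (hi' hm)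
    have h6 : m i * (res i g').order.toNat + m i * μ = m i * (res i h).order.toNat := by
      by_cases hm : m i = 0
      · simp [hm]
      · rw [(hpow hm).1]; ring
    have h7 : (k + 1) * μ + μ * μ = m i * μ + m i.rev * μ := by
      rw [← add_mul, ← add_mul]
      congr 1
      omega
    -- When the new line is polar, the drop is at least the square of the order of `h`.
    have h8 : 0 < μ * μ := Nat.mul_pos hμ hμ
    omega

/-- At a point off both coordinate directions only the new line can be polar; it meets the strict
transform at most `h.order` times, while the old intersection number is at least the product of the
two orders. -/
theorem Chart.meas_step_fin_lt (hc : Chart p q P h m) (hb : IsBasePoint p q P) {a : K}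
    {g w : Ser K} (hg : blowup (.fin a) h = x K ^ h.order.toNat * g) (hw : IsUnit w) :
    meas (x K ^ (h.order.toNat - (m 0 + m 1)) * (g * w))
      ![m 0 + m 1 - h.order.toNat, 0] < meas h m := by
  obtain ⟨g', hg', hr, hne⟩ := exists_strictTransform (.fin a) hc.ne_zero
  have : g' = g := mul_left_cancel₀ (pow_ne_zero _ (prime_X _).ne_zero) (hg'.symm.trans hg)
  subst this
  have hμ := hc.order_pos hb
  have hsum := hc.sum_pos hb
  have h0 := hc.order_le_toNat (k := 0)
  have h1 := hc.order_le_toNat (k := 1)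
  have hlow : (m 0 + m 1) * h.order.toNat ≤ meas h m := by
    rw [meas, add_mul]
    refine add_le_add ?_ ?_
    · by_cases hm : m 0 = 0
      · simp [hm]
      · exact Nat.mul_le_mul_left _ (h0 hm)
    · by_cases hm : m 1 = 0
      · simp [hm]
      · exact Nat.mul_le_mul_left _ (h1 hm)
  refine lt_of_lt_of_le ?_ hlow
  rw [meas]
  simp only [Matrix.cons_val_zero, Matrix.cons_val_one, zero_mul, add_zero]
  by_cases hle : m 0 + m 1 ≤ h.order.toNat
  · rw [Nat.sub_eq_zero_of_le hle, zero_mul]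
    exact Nat.mul_pos hsum hμ
  · have h2 : h.order.toNat - (m 0 + m 1) = 0 := by omega
    have h3 : (res 0 (g' * w)).order.toNat ≤ h.order.toNat := by
      rw [map_mul, PowerSeries.order_mul,
        PowerSeries.order_zero_of_unit (hw.map (res (K := K) 0)), add_zero]
      refine ENat.toNat_le_of_le_natCast ?_
      change (res (Dir.fin a).idx g').order ≤ _
      rw [hr]
      exact order_coe_le hne (natDegree_tform_le _ _ _)
    rw [h2, pow_zero, one_mul]
    refine lt_of_le_of_lt (Nat.mul_le_mul_left _ h3) (Nat.mul_lt_mul_of_pos_right ?_ hμ)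
    omega

theorem Chart.exists_concat_meas_lt (hc : Chart p q P h m) (hb : IsBasePoint p q P) (s : Dir K) :
    ∃ h' m', Chart p q (P ++ [s]) h' m' ∧ meas h' m' < meas h m := by
  rcases s.eq_coord_or with ⟨i, rfl⟩ | ⟨a, ha, rfl⟩
  · obtain ⟨g, hg, -⟩ := exists_strictTransform_coord i hc.ne_zero
    exact ⟨_, _, hc.step_coord i hg, hc.meas_step_coord_lt hb i hg⟩
  · obtain ⟨g, hg, -⟩ := exists_strictTransform (.fin a) hc.ne_zero
    obtain ⟨w, hw⟩ := exists_mul_eq_one ha (m 1)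
    refine ⟨_, _, hc.step_fin hg hw, hc.meas_step_fin_lt hb hg ?_⟩
    exact IsUnit.of_mul_eq_one _ ((mul_comm _ _).trans hw)

end Chart

/-! ### Exceptional lines on which the pencil restricts to a polynomial -/

section Polar

variable {K : Type*} [Field K] {p q : Ser K} {P Q : NearPoint K} {h : Ser K} {m : Fin 2 → ℕ}
  {i : Fin 2} {n : ℕ} {t : K} {J : Ideal (Ser K)}

theorem constantCoeff_aeval (φ : PowerSeries K) (G : K[X]) :
    PowerSeries.constantCoeff (Polynomial.aeval φ G) =
      G.eval (PowerSeries.constantCoeff φ) := by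
  rw [Polynomial.aeval_def, Polynomial.hom_eval₂, Polynomial.eval]
  congr 1

theorem coeff_one_aeval (φ : PowerSeries K) (G : K[X]) :
    PowerSeries.coeff 1 (Polynomial.aeval φ G) =
      (derivative G).eval (PowerSeries.constantCoeff φ) * PowerSeries.coeff 1 φ := by
  induction G using Polynomial.induction_on' with
  | add f g hf hg =>
    rw [map_add, map_add, hf, hg, derivative_add, eval_add, add_mul]
  | monomial k a =>
    rw [aeval_monomial, derivative_monomial, eval_monomial, PowerSeries.algebraMap_apply,
      Algebra.algebraMap_self_apply, PowerSeries.coeff_C_mul, PowerSeries.coeff_one_pow]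
    ring

/-- After subtracting its constant term `b`, `φ` is still nonzero; split off the power of `X - b` in
`G`, and what remains does not vanish at `b`. -/
theorem aeval_ne_zero {φ : PowerSeries K} (hφ : PowerSeries.coeff 1 φ ≠ 0) {G : K[X]}
    (hG : G ≠ 0) : Polynomial.aeval φ G ≠ 0 := by
  set b := PowerSeries.constantCoeff φ with hb
  obtain ⟨g, hg, hnd⟩ := Polynomial.exists_eq_pow_rootMultiplicity_mul_and_not_dvd G hG b
  rw [hg, map_mul, map_pow]
  refine mul_ne_zero (pow_ne_zero _ ?_) ?_
  · intro h0
    have h1 := congrArg (PowerSeries.coeff 1) h0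
    rw [coeff_one_aeval] at h1
    simp at h1
    exact hφ h1
  · intro h0
    have h1 := congrArg PowerSeries.constantCoeff h0
    rw [constantCoeff_aeval, map_zero, ← hb] at h1
    exact hnd (Polynomial.dvd_iff_isRoot.2 h1)

theorem Chart.mem_of_mem_strictBranches (hc : Chart p q P h m) (hf : fibre p q t ≠ 0)
    (hJ : J ∈ strictBranches p q t P) :
    IsBranch J ∧ h - MvPowerSeries.C t * mon m ∈ J := by
  obtain ⟨h1, h2, h3⟩ := (mem_strictBranches_iff hf).1 hJ
  obtain ⟨e, -, he, hp, hq⟩ := hc.factor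
  refine ⟨h1, ?_⟩
  have : pullback P (fibre p q t) = e * (h - MvPowerSeries.C t * mon m) := by
    rw [fibre, map_sub, map_mul, hp, hq, pullback_C]
    ring
  rw [this] at h2
  exact (h1.isPrime.mem_or_mem h2).resolve_left fun h4 ↦ h3 (he J h1.isPrime h4)

theorem Chart.mem_strictBranches (hc : Chart p q P h m) (hf : fibre p q t ≠ 0)
    (hJ : IsBranch J) (hh : h - MvPowerSeries.C t * mon m ∈ J)
    (hn : ¬ (pullback P (x K) ∈ J ∧ pullback P (y K) ∈ J)) : J ∈ strictBranches p q t P := by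
  rw [mem_strictBranches_iff hf]
  obtain ⟨e, -, he, hp, hq⟩ := hc.factor
  refine ⟨hJ, ?_, hn⟩
  have : pullback P (fibre p q t) = e * (h - MvPowerSeries.C t * mon m) := by
    rw [fibre, map_sub, map_mul, hp, hq, pullback_C]
    ring
  rw [this]
  exact J.mul_mem_left _ hh

/-- There are no branches at the points where `p / q` is infinite. -/
theorem Chart.notMem_strictBranches (hc : Chart p q P h m) (hf : fibre p q t ≠ 0)
    (hb : ¬ IsBasePoint p q P) (hm : m ≠ 0) : J ∉ strictBranches p q t P := by
  intro hJ
  obtain ⟨h1, h2⟩ := hc.mem_of_mem_strictBranches hf hJ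
  rw [hc.isBasePoint_iff] at hb
  have hu : IsUnit h := by
    by_contra hu
    exact hb ⟨hu, hm⟩
  refine h1.not_isUnit h2 ?_
  have hmon : ¬ IsUnit (mon m : Ser K) := fun h ↦ hm (isUnit_mon_iff.1 h)
  rw [isUnit_iff_constantCoeff_ne_zero] at hu hmon ⊢
  rw [not_not] at hmon
  rw [map_sub, map_mul, hmon, mul_zero, sub_zero]
  exact hu

/-- Following the curve `X i.rev = 0`, the order of `h` along it drops by `h.order`, the pole order
of the transversal curve by no more. -/
theorem Chart.step_along (hc : Chart p q P h m) (hi : (res i.rev h).order < m i) :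
    ∃ h' m', Chart p q (P ++ [coord i.rev]) h' m' ∧ (res i.rev h').order < m' i := by
  obtain ⟨g, hg, hnd, hne, hr, hri⟩ := exists_strictTransform_coord i.rev hc.ne_zero
  refine ⟨_, _, hc.step_coord i.rev hg, ?_⟩
  have h1 : h.order.toNat < m i := by
    have h2 := (order_le_order_res i.rev h).trans_lt hi
    rw [← hc.order_toNat] at h2
    exact_mod_cast h2
  have h3 := add_eq i m
  rw [show h.order.toNat - (m 0 + m 1) = 0 by omega, pow_zero, one_mul, Fin.rev_rev,
    Function.update_self]
  rw [hri, PowerSeries.order_mul, PowerSeries.order_X_pow] at hi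
  have h4 : res i.rev g ≠ 0 := by
    intro h0
    rw [h0, PowerSeries.order_zero] at hi
    simp at hi
  rw [← PowerSeries.coe_toNat_order h4] at hi ⊢
  norm_cast at hi ⊢
  omega

/-- A point at which, up to a common factor, `p / q` is `h / (X i) ^ n` with `h` of order at least
`n`: the restriction of `p / q` to the exceptional line is a polynomial with pole on `X i = 0`. -/
structure Polar (p q : Ser K) (Q : NearPoint K) (i : Fin 2) (n : ℕ) (h : Ser K) : Prop where
  chart : Chart p q Q h (Function.update 0 i n)
  ne_zero : n ≠ 0
  le_order : (n : ℕ∞) ≤ h.order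

/-- The point of the exceptional line at which the coordinate without pole at `X i = 0` is `b`. -/
def pt (i : Fin 2) (b : K) : Dir K :=
  open scoped Classical in
  if b = 0 then coord i.rev else .fin (if i = 0 then b else b⁻¹)

theorem pt_zero (i : Fin 2) : pt i (0 : K) = coord i.rev := if_pos rfl

theorem pt_of_ne_zero (i : Fin 2) {b : K} (hb : b ≠ 0) :
    ∃ a : K, a ≠ 0 ∧ pt i b = .fin a ∧ a = if i = 0 then b else b⁻¹ := by
  refine ⟨_, ?_, if_neg hb, rfl⟩
  split_ifs
  · exact hb
  · exact inv_ne_zero hb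

theorem pt_injective (i : Fin 2) : Function.Injective (pt i : K → Dir K) := by
  have key : ∀ b : K, b ≠ 0 → pt i (0 : K) ≠ pt i b := by
    intro b hb h
    obtain ⟨a, ha, hp, -⟩ := pt_of_ne_zero i hb
    rw [hp, pt_zero] at h
    fin_cases i
    · exact ha (Dir.fin.inj h).symm
    · cases h
  intro b c h
  by_cases hb : b = 0
  · by_cases hc : c = 0
    · rw [hb, hc]
    · rw [hb] at h
      exact absurd h (key c hc)
  · by_cases hc : c = 0
    · rw [hc] at h
      exact absurd h.symm (key b hb)
    · obtain ⟨a, ha, hp, h1⟩ := pt_of_ne_zero i hb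
      obtain ⟨a', ha', hp', h1'⟩ := pt_of_ne_zero i hc
      rw [hp, hp', Dir.fin.injEq, h1, h1'] at h
      split_ifs at h
      · exact h
      · exact inv_injective h

theorem eq_coord_or_eq_pt (i : Fin 2) (s : Dir K) : s = coord i ∨ ∃ b, s = pt i b := by
  rcases s.eq_coord_or with ⟨j, rfl⟩ | ⟨a, ha, rfl⟩
  · by_cases hj : j = i
    · exact .inl (by rw [hj])
    · exact .inr ⟨0, by rw [pt_zero, eq_rev_of_ne hj]⟩
  · right
    by_cases hi : i = 0
    · exact ⟨a, by rw [pt, if_neg ha, if_pos hi]⟩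
    · exact ⟨a⁻¹, by rw [pt, if_neg (inv_ne_zero ha), if_neg hi, inv_inv]⟩

theorem update_sum (i : Fin 2) (n : ℕ) :
    (Function.update 0 i n : Fin 2 → ℕ) 0 + (Function.update 0 i n : Fin 2 → ℕ) 1 = n := by
  rw [add_eq i, Function.update_self, Function.update_of_ne (rev_ne i)]
  rfl

theorem mon_zero : (mon 0 : Ser K) = 1 := by
  simp [mon]

theorem Polar.le_toNat (hQ : Polar p q Q i n h) : n ≤ h.order.toNat := by
  have := hQ.le_order
  rw [← hQ.chart.order_toNat] at this
  exact_mod_cast this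

theorem Polar.chart_zero (hQ : Polar p q Q i n h) :
    ∃ H, blowup (coord i.rev) h = MvPowerSeries.X i ^ n * H ∧
      Chart p q (Q ++ [coord i.rev]) H 0 ∧ res i H = (hform i n h : PowerSeries K) := by
  obtain ⟨g, hg, -⟩ := exists_strictTransform_coord i.rev hQ.chart.ne_zero
  have hc := hQ.chart.step_coord i.rev hg
  have hle := hQ.le_toNat
  rw [update_sum, Fin.rev_rev, Nat.sub_eq_zero_of_le hle, Function.update_idem] at hc
  rw [Fin.rev_rev] at hg
  have hH : blowup (coord i.rev) h =
      MvPowerSeries.X i ^ n * (MvPowerSeries.X i ^ (h.order.toNat - n) * g) := by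
    rw [hg, ← mul_assoc, ← pow_add, Nat.add_sub_cancel' hle]
  refine ⟨_, hH, ?_, ?_⟩
  · convert hc
    exact (Function.update_eq_self i 0).symm
  · obtain ⟨f, hf⟩ := exists_blowup_eq (coord i.rev) hQ.le_order
    rw [hH, eqn_coord, idx_coord, Fin.rev_rev, tform_coord, Fin.rev_rev] at hf
    rw [mul_left_cancel₀ (pow_ne_zero _ (prime_X _).ne_zero) hf, map_add, res_aeval_X, map_mul,
      res_X_self, zero_mul, add_zero]

/-- `φ` is the affine coordinate of the line expanded at the point: `X + a`, or its inverse when the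
pole is at the zero of the standard coordinate. -/
theorem Polar.chart_fin (hQ : Polar p q Q i n h) {b : K} (hb : b ≠ 0) :
    ∃ H φ, Chart p q (Q ++ [pt i b]) H 0 ∧ res 0 H = Polynomial.aeval φ (hform i n h) ∧
      PowerSeries.constantCoeff φ = b ∧ PowerSeries.coeff 1 φ ≠ 0 := by
  obtain ⟨a, ha, hp, hab⟩ := pt_of_ne_zero i hb
  rw [hp]
  obtain ⟨g, hg, -⟩ := exists_strictTransform (.fin a) hQ.chart.ne_zero
  obtain ⟨w, hw⟩ := exists_mul_eq_one ha ((Function.update 0 i n : Fin 2 → ℕ) 1)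
  have hc := hQ.chart.step_fin hg hw
  have hle := hQ.le_toNat
  rw [update_sum, Nat.sub_eq_zero_of_le hle] at hc
  have h00 : (![0, 0] : Fin 2 → ℕ) = 0 := by
    funext j
    fin_cases j <;> rfl
  rw [h00] at hc
  obtain ⟨f, hf⟩ := exists_blowup_eq (.fin a) hQ.le_order
  have hf' : x K ^ (h.order.toNat - n) * g =
      Polynomial.aeval (MvPowerSeries.X (Fin.rev 0) : Ser K) (tform (.fin a) n h) + x K * f := by
    apply mul_left_cancel₀ (pow_ne_zero n (prime_X (K := K) 0).ne_zero)
    rw [← mul_assoc, ← pow_add, Nat.add_sub_cancel' hle]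
    exact hg.symm.trans hf
  have hres : res 0 (x K ^ (h.order.toNat - n) * (g * w)) =
      ((hform 0 n h).comp (Polynomial.X + Polynomial.C a) : K[X]) * res 0 w := by
    rw [← mul_assoc, hf', map_mul, map_add, res_aeval_X, map_mul, res_X_self, zero_mul, add_zero]
    rfl
  have hcoe : (((hform 0 n h).comp (Polynomial.X + Polynomial.C a) : K[X]) : PowerSeries K) =
      Polynomial.aeval (PowerSeries.X + PowerSeries.C a : PowerSeries K) (hform 0 n h) := by
    rw [← res_aeval_X 0, Polynomial.aeval_comp, ← Polynomial.aeval_algHom_apply]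
    congr 2
    rw [map_add, Polynomial.aeval_X, Polynomial.aeval_C, map_add, res_X_rev]
    congr 1
    exact (res (K := K) 0).commutes a
  have hwr : (PowerSeries.X + PowerSeries.C a : PowerSeries K) ^
      ((Function.update 0 i n : Fin 2 → ℕ) 1) * res 0 w = 1 := by
    have := congrArg (res 0) hw
    rw [map_mul, map_pow, map_add, map_one, res_C] at this
    rw [← this, ← res_X_rev 0]
    rfl
  rw [hcoe] at hres
  by_cases hi : i = 0
  · subst hi
    have h1 : (Function.update 0 0 n : Fin 2 → ℕ) 1 = 0 := rfl
    rw [h1, pow_zero, one_mul] at hwr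
    refine ⟨_, PowerSeries.X + PowerSeries.C a, hc, ?_, ?_, ?_⟩
    · rw [hres, hwr, mul_one]
    · rw [if_pos rfl] at hab
      simp [hab]
    · simp
  · have hi1 : i = Fin.rev 0 := eq_rev_of_ne hi
    subst hi1
    have h1 : (Function.update 0 (Fin.rev 0) n : Fin 2 → ℕ) 1 = n := rfl
    rw [h1] at hwr
    set ψ : PowerSeries K := PowerSeries.X + PowerSeries.C a with hψ
    have hψ0 : PowerSeries.constantCoeff ψ = a := by simp [hψ]
    have hinv : ψ * ψ⁻¹ = 1 := PowerSeries.mul_inv_cancel _ (by rwa [hψ0])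
    let _ : Invertible ψ⁻¹ := ⟨ψ, hinv, by rw [mul_comm, hinv]⟩
    rw [if_neg hi] at hab
    have h0 : PowerSeries.constantCoeff ψ⁻¹ = b := by
      rw [PowerSeries.constantCoeff_inv, hψ0, hab, inv_inv]
    refine ⟨_, ψ⁻¹, hc, ?_, h0, ?_⟩
    -- The unit absorbed from the denominator restricts to `ψ⁻¹ ^ n`, exactly the factor that turns
    -- the reflected form at `ψ` into the form at `ψ⁻¹`.
    · have h2 := Polynomial.eval₂_reflect_mul_pow (algebraMap K (PowerSeries K)) ψ⁻¹ n
        (hform (Fin.rev 0) n h) (natDegree_hform_le _ _ _)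
      have h3 : Polynomial.reflect n (hform (Fin.rev 0) n h) = hform 0 n h := by
        rw [← hform_rev, Fin.rev_rev]
      rw [h3] at h2
      have h4 : res 0 w = ψ⁻¹ ^ n := by
        have h5 : ψ ^ n * ψ⁻¹ ^ n = 1 := by rw [← mul_pow, hinv, one_pow]
        calc res 0 w = (ψ ^ n * ψ⁻¹ ^ n) * res 0 w := by rw [h5, one_mul]
          _ = ψ⁻¹ ^ n * (ψ ^ n * res 0 w) := by ring
          _ = _ := by rw [hwr, mul_one]
      rw [hres, h4, Polynomial.aeval_def, Polynomial.aeval_def, ← h2]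
      rfl
    · have h2 := congrArg (PowerSeries.coeff 1) hinv
      rw [PowerSeries.coeff_one_mul, h0, hψ0] at h2
      have h3 : PowerSeries.coeff 1 ψ = 1 := by simp [hψ]
      rw [h3, PowerSeries.coeff_one] at h2
      intro h4
      rw [h4] at h2
      simp at h2
      exact hb h2

/-- The local description at the points of the exceptional line other than the pole. -/
theorem Polar.chart_pt (hQ : Polar p q Q i n h) (b : K) :
    ∃ H φ, Chart p q (Q ++ [pt i b]) H 0 ∧
      res (pt i b).idx H = Polynomial.aeval φ (hform i n h) ∧
      PowerSeries.constantCoeff φ = b ∧ PowerSeries.coeff 1 φ ≠ 0 := by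
  by_cases hb : b = 0
  · subst hb
    obtain ⟨H, -, hc, hr⟩ := hQ.chart_zero
    refine ⟨H, PowerSeries.X, by rwa [pt_zero], ?_, by simp, by simp⟩
    rw [pt_zero, idx_coord, Fin.rev_rev, hr, ← res_aeval_X i, ← Polynomial.aeval_algHom_apply,
      res_X_rev]
  · obtain ⟨H, φ, h1, h2, h3⟩ := hQ.chart_fin hb
    obtain ⟨a, -, hp, -⟩ := pt_of_ne_zero i hb
    refine ⟨H, φ, h1, ?_, h3⟩
    rw [← h2, hp]
    rfl

theorem Polar.isBasePoint (hQ : Polar p q Q i n h) : IsBasePoint p q Q := by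
  rw [hQ.chart.isBasePoint_iff, isUnit_iff_constantCoeff_ne_zero, not_not]
  constructor
  · rw [← MvPowerSeries.order_ne_zero_iff_constCoeff_eq_zero]
    intro h0
    have := hQ.le_order
    rw [h0] at this
    exact hQ.ne_zero (Nat.le_zero.1 (by exact_mod_cast this))
  · intro h0
    have := congrFun h0 i
    rw [Function.update_self] at this
    exact hQ.ne_zero this

/-- At the pole, `h` restricted to the line has order at most `n` minus the degree of the
polynomial, hence less than the pole order `n`. `Chart.step_along` keeps this inequality at every
further point of the line, so a pole is always present there. -/
theorem Polar.chart_pole (hQ : Polar p q Q i n h) (hG : (hform i n h).natDegree ≠ 0) (k : ℕ) :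
    ∃ h' m', Chart p q (pointAlong Q (coord i) k) h' m' ∧ m' ≠ 0 := by
  have key : ∃ h' m', Chart p q (pointAlong Q (coord i) k) h' m' ∧
      (res i.rev h').order < m' i := by
    induction k with
    | zero =>
      obtain ⟨g, hg, -⟩ := exists_strictTransform_coord i hQ.chart.ne_zero
      have hc := hQ.chart.step_coord i hg
      refine ⟨_, _, hc, ?_⟩
      rw [update_sum]
      have hH : blowup (coord i) h = MvPowerSeries.X i.rev ^ n *
          (MvPowerSeries.X i.rev ^ (h.order.toNat - n) * g) := by
        rw [hg, ← mul_assoc, ← pow_add, Nat.add_sub_cancel' hQ.le_toNat]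
      obtain ⟨f, hf⟩ := exists_blowup_eq (coord i) hQ.le_order
      rw [hH, eqn_coord, idx_coord, tform_coord] at hf
      rw [mul_left_cancel₀ (pow_ne_zero _ (prime_X _).ne_zero) hf, map_add, res_aeval_X, map_mul,
        res_X_self, zero_mul, add_zero, Function.update_of_ne (rev_ne i).symm,
        Function.update_self, hform_rev]
      have hd := natDegree_hform_le i n h
      refine lt_of_le_of_lt (PowerSeries.order_le (n - (hform i n h).natDegree) ?_) ?_
      · rw [Polynomial.coeff_coe, Polynomial.coeff_reflect,
          Polynomial.revAt_le (Nat.sub_le _ _), Nat.sub_sub_self hd]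
        refine Polynomial.leadingCoeff_ne_zero.2 ?_
        intro h0
        rw [h0] at hG
        exact hG rfl
      · norm_cast
        omega
    | succ k ih =>
      obtain ⟨h', m', hc, hi⟩ := ih
      obtain ⟨h'', m'', hc', hi'⟩ := hc.step_along hi
      refine ⟨h'', m'', ?_, hi'⟩
      have : pointAlong Q (coord i) (k + 1) = pointAlong Q (coord i) k ++ [coord i.rev] := by
        rw [pointAlong, pointAlong, along_coord, List.replicate_succ', ← List.cons_append,
          List.append_assoc]
      rwa [this]
  obtain ⟨h', m', hc, hi⟩ := key
  refine ⟨h', m', hc, ?_⟩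
  rintro rfl
  simp at hi

theorem pointAlong_zero (Q : NearPoint K) (s : Dir K) : pointAlong Q s 0 = Q ++ [s] := rfl

/-- The branches at a dicritical pass through the points which are not poles, and these are not
blown up. -/
theorem Polar.mem_branchesAt_iff (hQ : Polar p q Q i n h) (hf : fibre p q t ≠ 0)
    (hG : (hform i n h).natDegree ≠ 0) {b : (Dir K × ℕ) × Ideal (Ser K)} :
    b ∈ branchesAt p q Q t ↔
      ∃ z, b.1 = (pt i z, 0) ∧ b.2 ∈ strictBranches p q t (Q ++ [pt i z]) := by
  have hnb : ∀ z, ¬ IsBasePoint p q (Q ++ [pt i z]) := by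
    intro z
    obtain ⟨H, φ, hc, -⟩ := hQ.chart_pt z
    rw [hc.isBasePoint_iff]
    exact fun h ↦ h.2 rfl
  obtain ⟨⟨s, k⟩, J⟩ := b
  constructor
  · rintro ⟨⟨hb1, hb2⟩, hJ⟩
    simp only at hb1 hb2 hJ
    rcases eq_coord_or_eq_pt i s with rfl | ⟨z, rfl⟩
    · obtain ⟨h', m', hc, hm⟩ := hQ.chart_pole hG k
      exact absurd hJ (hc.notMem_strictBranches hf hb2 hm)
    · have hk : k = 0 := by
        by_contra hk
        exact hnb z (hb1 0 (Nat.pos_of_ne_zero hk))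
      subst hk
      exact ⟨z, rfl, hJ⟩
  · rintro ⟨z, hz, hJ⟩
    obtain ⟨rfl, rfl⟩ := Prod.mk.inj hz
    exact ⟨⟨fun j hj ↦ absurd hj (Nat.not_lt_zero j), hnb z⟩, hJ⟩

theorem Polar.eval_eq (hQ : Polar p q Q i n h) (hf : fibre p q t ≠ 0) {z : K}
    (hJ : J ∈ strictBranches p q t (Q ++ [pt i z])) : (hform i n h).eval z = t := by
  obtain ⟨H, φ, hc, hr, h0, -⟩ := hQ.chart_pt z
  obtain ⟨h1, h2⟩ := hc.mem_of_mem_strictBranches hf hJ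
  have h3 := h1.not_isUnit h2
  rw [mon_zero, mul_one, isUnit_iff_constantCoeff_ne_zero, not_not, map_sub,
    MvPowerSeries.constantCoeff_C, sub_eq_zero, ← constantCoeff_res (pt i z).idx, hr,
    constantCoeff_aeval, h0] at h3
  exact h3

/-- Off the two coordinate directions, the newest line is the only exceptional curve through the
point. -/
theorem eqn_mem_of_exceptional {a : K} (ha : a ≠ 0) (hJ : J.IsPrime)
    (hx : pullback (Q ++ [.fin a]) (x K) ∈ J) : x K ∈ J := by
  rw [pullback_concat] at hx
  have h1 := X_mem_of_pullback_mem (J := J.comap (blowup (.fin a))) (P := Q)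
    (Ideal.IsPrime.comap _) (fun J _ h ↦ .inl h) hx
  rw [Ideal.mem_comap, Ideal.mem_comap, blowup_fin_x, blowup_fin_y] at h1
  rcases h1 with h1 | h1
  · exact h1
  · refine (hJ.mem_or_mem h1).resolve_right fun h2 ↦ ?_
    refine hJ.ne_top (Ideal.eq_top_of_isUnit_mem _ h2 ?_)
    rw [isUnit_iff_constantCoeff_ne_zero]
    simpa using ha

/-- Since the polynomial is not constantly `t`, the local equation of the fibre is not divisible by
that of the line, the only exceptional curve here. At `z = 0` a second one may pass and swallow the
whole fibre, so that point is excluded. -/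
theorem Polar.exists_strictBranch (hQ : Polar p q Q i n h) (hf : fibre p q t ≠ 0)
    (hG : (hform i n h).natDegree ≠ 0) {z : K} (hz : z ≠ 0) (ht : (hform i n h).eval z = t) :
    ∃ J, J ∈ strictBranches p q t (Q ++ [pt i z]) := by
  obtain ⟨H, φ, hc, hr, h0, h1⟩ := hQ.chart_fin hz
  have hres : res 0 (H - MvPowerSeries.C t) ≠ 0 := by
    have : res 0 (H - MvPowerSeries.C t) =
        Polynomial.aeval φ (hform i n h - Polynomial.C t) := by
      rw [map_sub, map_sub, hr, res_C, Polynomial.aeval_C]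
      rfl
    rw [this]
    refine aeval_ne_zero h1 ?_
    intro h2
    rw [sub_eq_zero] at h2
    rw [h2, Polynomial.natDegree_C] at hG
    exact hG rfl
  have hne : H - MvPowerSeries.C t ≠ 0 := by
    intro h2
    rw [h2, map_zero] at hres
    exact hres rfl
  have hu : ¬ IsUnit (H - MvPowerSeries.C t) := by
    rw [isUnit_iff_constantCoeff_ne_zero, not_not, map_sub, MvPowerSeries.constantCoeff_C,
      ← constantCoeff_res 0, hr, constantCoeff_aeval, h0, ht, sub_self]
  obtain ⟨g, hg, hgd⟩ := exists_prime_factor hne hu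
  refine ⟨Ideal.span {g}, hc.mem_strictBranches hf (isBranch_span_singleton hg) ?_ ?_⟩
  · rw [mon_zero, mul_one, Ideal.mem_span_singleton]
    exact hgd
  · rintro ⟨hx, -⟩
    obtain ⟨a, ha, hp, -⟩ := pt_of_ne_zero i hz
    rw [hp] at hx
    have h2 := eqn_mem_of_exceptional ha (isBranch_span_singleton hg).isPrime hx
    rw [Ideal.mem_span_singleton] at h2
    have h3 := ((hg.dvd_prime_iff_associated (prime_X 0)).1 h2).symm.dvd.trans hgd
    exact hres (res_eq_zero_iff.2 h3)

theorem res_inVar (k : Fin 2) (α : PowerSeries K) : res k (inVar k.rev α) = α := by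
  ext n
  rw [coeff_res, coeff_inVar]
  simp

/-- A product of two nonunits has no linear term on the line, so the cofactor of a generator in `F`
is a unit. -/
theorem IsBranch.eq_span_of_coeff_one_ne_zero (hJ : IsBranch J) {k : Fin 2} {F : Ser K}
    (h1 : PowerSeries.coeff 1 (res k F) ≠ 0) (hF : F ∈ J) : J = Ideal.span {F} := by
  obtain ⟨g, hg, rfl⟩ := hJ.exists_eq_span
  obtain ⟨f, rfl⟩ := Ideal.mem_span_singleton.1 hF
  have hu : IsUnit f := by
    rw [isUnit_iff_constantCoeff_ne_zero, ← constantCoeff_res k]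
    intro h0
    have h2 : PowerSeries.constantCoeff (res k g) = 0 := by
      rw [constantCoeff_res]
      by_contra h2
      exact hg.not_isUnit (isUnit_iff_constantCoeff_ne_zero.2 h2)
    rw [map_mul, PowerSeries.coeff_one_mul, h0, h2] at h1
    simp at h1
  rw [Ideal.span_singleton_mul_right_unit hu]

theorem span_sup_span_X {k : Fin 2} {F : Ser K} (h0 : MvPowerSeries.constantCoeff F = 0)
    (h1 : PowerSeries.coeff 1 (res k F) ≠ 0) :
    Ideal.span {F} ⊔ Ideal.span {MvPowerSeries.X k} = Ideal.span {x K, y K} := by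
  apply le_antisymm
  · rw [← maximalIdeal_eq_span, sup_le_iff, Ideal.span_singleton_le_iff_mem,
      Ideal.span_singleton_le_iff_mem]
    exact ⟨mem_maximalIdeal_iff.2 h0, not_isUnit_X k⟩
  · set I := Ideal.span {F} ⊔ Ideal.span {MvPowerSeries.X k} with hI
    have hk : MvPowerSeries.X k ∈ I :=
      Ideal.mem_sup_right (Ideal.mem_span_singleton_self _)
    have hF : F ∈ I := Ideal.mem_sup_left (Ideal.mem_span_singleton_self _)
    have hrev : MvPowerSeries.X k.rev ∈ I := by
      obtain ⟨r, hr⟩ : MvPowerSeries.X k ∣ F - inVar k.rev (res k F) := by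
        rw [← res_eq_zero_iff, map_sub, res_inVar, sub_self]
      obtain ⟨α, hα⟩ : PowerSeries.X ∣ res k F := by
        rw [PowerSeries.X_dvd_iff, constantCoeff_res, h0]
      have h2 : inVar k.rev (res k F) ∈ I := by
        have : inVar k.rev (res k F) = F - MvPowerSeries.X k * r := by rw [← hr]; ring
        rw [this]
        exact I.sub_mem hF (I.mul_mem_right _ hk)
      have h3 : IsUnit (inVar k.rev α) := by
        rw [isUnit_iff_constantCoeff_ne_zero, constantCoeff_inVar]
        rw [hα, PowerSeries.coeff_one_mul] at h1
        simpa using h1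
      have h4 : inVar k.rev (PowerSeries.X : PowerSeries K) = MvPowerSeries.X k.rev := by
        rw [inVar, PowerSeries.substAlgHom_X]
      rw [hα, map_mul, h4] at h2
      exact (I.mul_unit_mem_iff_mem h3).1 h2
    rw [Ideal.span_le]
    have hall : ∀ j : Fin 2, MvPowerSeries.X j ∈ I := by
      intro j
      by_cases hj : j = k
      · rwa [hj]
      · rwa [eq_rev_of_ne hj]
    rintro f (rfl | rfl)
    · exact hall 0
    · exact hall 1

/-- At a simple zero of `q_E - t` there is at most one branch, and it is a curvette. -/
theorem Polar.eq_span_of_simple (hQ : Polar p q Q i n h) (hf : fibre p q t ≠ 0) {z : K}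
    (hz : (derivative (hform i n h)).eval z ≠ 0) :
    ∃ F, ∀ J ∈ strictBranches p q t (Q ++ [pt i z]), J = Ideal.span {F} ∧
      J ⊔ Ideal.span {(pt i z).eqn} = Ideal.span {x K, y K} := by
  obtain ⟨H, φ, hc, hr, h0, h1⟩ := hQ.chart_pt z
  refine ⟨H - MvPowerSeries.C t, fun J hJ ↦ ?_⟩
  obtain ⟨h2, h3⟩ := hc.mem_of_mem_strictBranches hf hJ
  rw [mon_zero, mul_one] at h3
  have h4 : PowerSeries.coeff 1 (res (pt i z).idx (H - MvPowerSeries.C t)) ≠ 0 := by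
    rw [map_sub, res_C, hr, map_sub, coeff_one_aeval, h0, PowerSeries.coeff_C]
    simpa using ⟨hz, h1⟩
  have h5 := h2.eq_span_of_coeff_one_ne_zero h4 h3
  refine ⟨h5, ?_⟩
  rw [h5, eqn_eq_X]
  refine span_sup_span_X ?_ h4
  by_contra h6
  exact h2.not_isUnit h3 (isUnit_iff_constantCoeff_ne_zero.2 h6)

end Polar

/-! ### Identification with `restr`, degree and separability -/

section Restr

variable {K : Type*} [Field K] {p q : Ser K} {Q : NearPoint K} {h : Ser K} {m : Fin 2 → ℕ}
  {i : Fin 2} {n : ℕ}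

theorem num_denom_eq {A B : K[X]} (hAB : IsCoprime A B) (hB : B.Monic) {r : RatFunc K}
    (hr : r = algebraMap K[X] (RatFunc K) A / algebraMap K[X] (RatFunc K) B) :
    r.num = A ∧ r.denom = B := by
  have h1 := (RatFunc.num_mul_eq_mul_denom_iff hB.ne_zero).2 hr
  have h2 : r.denom ∣ B :=
    (RatFunc.isCoprime_num_denom r).symm.dvd_of_dvd_mul_left ⟨A, by rw [h1, mul_comm]⟩
  have h3 : B ∣ r.denom := hAB.symm.dvd_of_dvd_mul_left ⟨r.num, by rw [← h1, mul_comm]⟩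
  have h4 : r.denom = B :=
    eq_of_monic_of_associated (RatFunc.monic_denom r) hB (associated_of_dvd_dvd h2 h3)
  rw [h4] at h1
  exact ⟨mul_right_cancel₀ hB.ne_zero h1, h4⟩

theorem reflect_eq_reverse_mul {G : K[X]} (hG : G.natDegree ≤ n) :
    Polynomial.reflect n G = G.reverse * Polynomial.X ^ (n - G.natDegree) := by
  ext j
  rw [Polynomial.coeff_mul_X_pow', Polynomial.coeff_reflect]
  by_cases hj : j ≤ n
  · rw [Polynomial.revAt_le hj]
    split_ifs with h1
    · rw [Polynomial.coeff_reverse, Polynomial.revAt_le (by omega)]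
      congr 1
      omega
    · exact Polynomial.coeff_eq_zero_of_natDegree_lt (by omega)
  · rw [Polynomial.revAt_eq_self_of_lt (by omega), if_pos (by omega), Polynomial.coeff_reverse,
      Polynomial.revAt_eq_self_of_lt (by omega),
      Polynomial.coeff_eq_zero_of_natDegree_lt (by omega),
      Polynomial.coeff_eq_zero_of_natDegree_lt (by omega)]

/-- Every exponent occurring in `G` vanishes in `K`, so those of the reversed polynomial are all
congruent to the degree. -/
theorem derivative_reverse_mul_X {G : K[X]} (hG : derivative G = 0) :
    derivative G.reverse * Polynomial.X = G.reverse * (G.natDegree : K[X]) := by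
  have hc : ∀ j : ℕ, G.coeff j * (j : K) = 0 := by
    intro j
    cases j with
    | zero => simp
    | succ j =>
      have := congrArg (fun P ↦ P.coeff j) hG
      rw [Polynomial.coeff_derivative, Polynomial.coeff_zero] at this
      exact_mod_cast this
  have hX : ∀ j, (derivative G.reverse * Polynomial.X).coeff j = G.reverse.coeff j * (j : K) := by
    intro j
    cases j with
    | zero => simp
    | succ j => rw [Polynomial.coeff_mul_X, Polynomial.coeff_derivative]; norm_cast
  ext j
  rw [hX, Polynomial.coeff_mul_natCast, Polynomial.coeff_reverse]
  by_cases hj : j ≤ G.natDegree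
  · rw [Polynomial.revAt_le hj]
    have h1 := hc (G.natDegree - j)
    rw [Nat.cast_sub hj, mul_sub, sub_eq_zero] at h1
    exact h1.symm
  · rw [Polynomial.revAt_eq_self_of_lt (by omega),
      Polynomial.coeff_eq_zero_of_natDegree_lt (by omega), zero_mul, zero_mul]

theorem hform_mon (m : Fin 2 → ℕ) : hform 0 (m 0 + m 1) (mon m : Ser K) = Polynomial.X ^ m 1 := by
  ext j
  rw [coeff_hform, Polynomial.coeff_X_pow, mon, MvPowerSeries.X_pow_eq, MvPowerSeries.X_pow_eq,
    MvPowerSeries.monomial_mul_monomial, one_mul, MvPowerSeries.coeff_monomial]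
  have key : Finsupp.single (0 : Fin 2) (m 0 + m 1 - j) + Finsupp.single (Fin.rev 0) j =
      Finsupp.single 0 (m 0) + Finsupp.single 1 (m 1) ↔ m 0 + m 1 - j = m 0 ∧ j = m 1 := by
    constructor
    · intro h
      have h0 := DFunLike.congr_fun h 0
      have h1 := DFunLike.congr_fun h 1
      simp at h0 h1
      exact ⟨h0, h1⟩
    · rintro ⟨h0, rfl⟩
      rw [h0]
      rfl
  rw [if_congr key rfl rfl]
  split_ifs <;> first | rfl | omega

theorem Chart.order_pullback (hc : Chart p q Q h m) :
    (pullback Q p).order = (pullback Q q).order ↔ h.order = (m 0 + m 1 : ℕ) := by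
  obtain ⟨e, he, -, hp, hq⟩ := hc.factor
  rw [hp, hq, MvPowerSeries.order_mul, MvPowerSeries.order_mul, order_mon,
    ← (MvPowerSeries.ne_zero_iff_order_finite).1 he, ← hc.order_toNat]
  norm_cast
  exact Nat.add_left_cancel_iff

theorem initialPoly_mul {f g : Ser K} (hf : f ≠ 0) (hg : g ≠ 0) :
    initialPoly (f * g) = initialPoly f * initialPoly g := by
  have h1 := (MvPowerSeries.ne_zero_iff_order_finite).1 hf
  have h2 := (MvPowerSeries.ne_zero_iff_order_finite).1 hg
  rw [initialPoly_eq, initialPoly_eq, initialPoly_eq, MvPowerSeries.order_mul, ← h1, ← h2,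
    ← Nat.cast_add, ENat.toNat_natCast, ENat.toNat_natCast, ENat.toNat_natCast, hform_mul]
  · exact h1.le
  · exact h2.le

theorem Chart.restr_eq (hc : Chart p q Q h m) (ho : h.order = (m 0 + m 1 : ℕ)) :
    restr p q Q = algebraMap K[X] (RatFunc K) (hform 0 (m 0 + m 1) h) /
      algebraMap K[X] (RatFunc K) (Polynomial.X ^ m 1) := by
  obtain ⟨e, he, -, hp, hq⟩ := hc.factor
  have he' : initialPoly e ≠ 0 := by
    have h1 := (MvPowerSeries.ne_zero_iff_order_finite).1 he
    rw [initialPoly_eq, Ne, hform_eq_zero_iff 0 h1.le]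
    intro h2
    have h3 := h2.trans h1.ge
    norm_cast at h3
    omega
  have h1 : initialPoly h = hform 0 (m 0 + m 1) h := by
    rw [initialPoly_eq, ho, ENat.toNat_natCast]
  have h2 : initialPoly (mon m : Ser K) = Polynomial.X ^ m 1 := by
    rw [initialPoly_eq, order_mon, ENat.toNat_natCast, hform_mon]
  rw [restr, hp, hq, initialPoly_mul he hc.ne_zero, initialPoly_mul he (mon_ne_zero m), h1, h2,
    map_mul, map_mul, mul_div_mul_left]
  exact RatFunc.algebraMap_ne_zero he'

theorem Polar.order_eq (hQ : Polar p q Q i n h) (hG : hform i n h ≠ 0) : h.order = n := by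
  rw [Ne, hform_eq_zero_iff i hQ.le_order, ← hQ.chart.order_toNat] at hG
  have := hQ.le_toNat
  rw [← hQ.chart.order_toNat]
  norm_cast at hG ⊢
  omega

theorem Polar.restr_eq (hQ : Polar p q Q i n h) (ho : h.order = n) :
    restr p q Q = algebraMap K[X] (RatFunc K) (hform 0 n h) /
      algebraMap K[X] (RatFunc K) (Polynomial.X ^ (Function.update 0 i n : Fin 2 → ℕ) 1) := by
  have := hQ.chart.restr_eq (by rw [update_sum, ho])
  rwa [update_sum] at this

theorem Polar.restr_eq_C_iff (hQ : Polar p q Q i n h) (ho : h.order = n) {a : K} :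
    restr p q Q = RatFunc.C a ↔ hform i n h = Polynomial.C a := by
  rw [hQ.restr_eq ho, div_eq_iff (RatFunc.algebraMap_ne_zero (pow_ne_zero _ Polynomial.X_ne_zero)),
    ← RatFunc.algebraMap_C, ← map_mul, (RatFunc.algebraMap_injective K).eq_iff]
  by_cases hi : i = 0
  · subst hi
    change _ = Polynomial.C a * Polynomial.X ^ 0 ↔ _
    rw [pow_zero, mul_one]
  · have hi := eq_rev_of_ne hi
    subst hi
    rw [hform_rev]
    change _ = Polynomial.C a * Polynomial.X ^ n ↔ _
    constructor
    · intro h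
      rw [h, Polynomial.reflect_C_mul_X_pow, Polynomial.revAt_le le_rfl, Nat.sub_self, pow_zero,
        mul_one]
    · intro h
      rw [← Polynomial.reflect_C, ← h]
      ext j
      rw [Polynomial.coeff_reflect, Polynomial.coeff_reflect, Polynomial.revAt_invol]

theorem Polar.isDicritical_iff (hQ : Polar p q Q i n h) :
    IsDicritical p q Q ↔ (hform i n h).natDegree ≠ 0 := by
  rw [IsDicritical, hQ.chart.order_pullback, update_sum]
  constructor
  · rintro ⟨ho, hne⟩ hd
    exact hne _ ((hQ.restr_eq_C_iff ho).2 (Polynomial.eq_C_of_natDegree_eq_zero hd))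
  · intro hd
    have ho : h.order = n := hQ.order_eq (by rintro h0; rw [h0] at hd; exact hd rfl)
    refine ⟨ho, fun a ha ↦ hd ?_⟩
    rw [(hQ.restr_eq_C_iff ho).1 ha, Polynomial.natDegree_C]

/-- In the fixed coordinate `y / x` the restriction is `G(z)` or `G(1/z)`; reversing puts the latter
in lowest terms. -/
theorem Polar.num_denom (hQ : Polar p q Q i n h) (hG : (hform i n h).natDegree ≠ 0) :
    (i = 0 ∧ (restr p q Q).num = hform i n h ∧ (restr p q Q).denom = 1) ∨
    (i = 1 ∧ (restr p q Q).num = (hform i n h).reverse ∧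
      (restr p q Q).denom = Polynomial.X ^ (hform i n h).natDegree) := by
  have hG0 : hform i n h ≠ 0 := by rintro h0; rw [h0] at hG; exact hG rfl
  have hr := hQ.restr_eq (hQ.order_eq hG0)
  by_cases hi : i = 0
  · subst hi
    exact .inl ⟨rfl, num_denom_eq isCoprime_one_right monic_one hr⟩
  · have hi := eq_rev_of_ne hi
    subst hi
    refine .inr ⟨rfl, ?_⟩
    have hd := natDegree_hform_le (Fin.rev 0) n h
    apply num_denom_eq
    · refine IsCoprime.pow_right ?_
      refine ((Polynomial.irreducible_X.coprime_iff_not_dvd).2 ?_).symm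
      rw [Polynomial.X_dvd_iff, Polynomial.coeff_zero_reverse]
      exact Polynomial.leadingCoeff_ne_zero.2 hG0
    · exact Polynomial.monic_X_pow _
    · have h0 : hform 0 n h = Polynomial.reflect n (hform (Fin.rev 0) n h) := by
        rw [← hform_rev, Fin.rev_rev]
      rw [hr, h0, reflect_eq_reverse_mul hd]
      change _ / algebraMap _ _ (Polynomial.X ^ n) = _
      have h1 : (Polynomial.X ^ n : K[X]) = Polynomial.X ^ (hform (Fin.rev 0) n h).natDegree *
          Polynomial.X ^ (n - (hform (Fin.rev 0) n h).natDegree) := by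
        rw [← pow_add, Nat.add_sub_cancel' hd]
      rw [h1, map_mul, map_mul, mul_div_mul_right]
      exact RatFunc.algebraMap_ne_zero (pow_ne_zero _ Polynomial.X_ne_zero)

theorem Polar.dicriticalDegree_eq (hQ : Polar p q Q i n h) (hG : (hform i n h).natDegree ≠ 0) :
    dicriticalDegree p q Q = (hform i n h).natDegree := by
  rw [dicriticalDegree]
  rcases hQ.num_denom hG with ⟨-, h1, h2⟩ | ⟨-, h1, h2⟩
  · rw [h1, h2, Polynomial.natDegree_one, max_eq_left (Nat.zero_le _)]
  · rw [h1, h2, Polynomial.natDegree_X_pow, max_eq_right (Polynomial.reverse_natDegree_le _)]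

theorem Polar.derivative_ne_zero (hQ : Polar p q Q i n h) (hG : (hform i n h).natDegree ≠ 0)
    (hs : IsSeparableAt p q Q) : derivative (hform i n h) ≠ 0 := by
  intro h0
  apply hs
  rcases hQ.num_denom hG with ⟨-, h1, h2⟩ | ⟨-, h1, h2⟩
  · rw [h1, h2, h0]
    simp
  · obtain ⟨k, hk⟩ := Nat.exists_eq_succ_of_ne_zero hG
    rw [h1, h2, Polynomial.derivative_X_pow, hk, Nat.succ_sub_one, pow_succ, ← hk]
    have := derivative_reverse_mul_X h0
    simp only [map_natCast]
    linear_combination Polynomial.X ^ k * this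

/-- The second alternative of `inv` forces the order of `h` below a single exponent of the monomial,
so two polar curves cannot cross here. -/
theorem Chart.exists_polar (hc : Chart p q Q h m) (hm : m ≠ 0)
    (hle : m 0 + m 1 ≤ h.order.toNat) :
    ∃ i n, m = (Function.update 0 i n : Fin 2 → ℕ) ∧ Polar p q Q i n h := by
  have hinv : ∃ i, m i = 0 := by
    rcases hc.inv with h1 | ⟨i, hi⟩
    · exact h1
    · have h2 := (order_le_order_res i.rev h).trans_lt hi
      rw [← hc.order_toNat] at h2
      have h3 := add_eq i m
      norm_cast at h2
      omega
  obtain ⟨j, hj⟩ := hinv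
  have hm' : m = (Function.update 0 j.rev (m j.rev) : Fin 2 → ℕ) := by
    funext k
    by_cases hk : k = j
    · subst hk
      rw [Function.update_of_ne (rev_ne k).symm, hj]
      rfl
    · rw [eq_rev_of_ne hk, Function.update_self]
  refine ⟨j.rev, m j.rev, hm', by rwa [← hm'], ?_, ?_⟩
  · intro h0
    rw [h0] at hm'
    exact hm (hm'.trans (Function.update_eq_self j.rev (0 : Fin 2 → ℕ)))
  · rw [← hc.order_toNat]
    rw [add_eq j, hj, zero_add] at hle
    exact_mod_cast hle

theorem IsDicritical.exists_polar (hd : IsDicritical p q Q) (hc : Chart p q Q h m) :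
    ∃ i n, Polar p q Q i n h ∧ (hform i n h).natDegree ≠ 0 := by
  have ho := hc.order_pullback.1 hd.1
  by_cases hm : m = 0
  · subst hm
    refine absurd ?_ (hd.2 ((hform 0 0 h).coeff 0))
    rw [hc.restr_eq ho]
    change algebraMap _ _ (hform 0 0 h) / algebraMap _ _ (Polynomial.X ^ 0) = _
    rw [pow_zero, map_one, div_one, ← RatFunc.algebraMap_C]
    congr 1
    exact Polynomial.eq_C_of_natDegree_eq_zero (Nat.le_zero.1 (natDegree_hform_le 0 0 h))
  · obtain ⟨i, n, -, hP⟩ := hc.exists_polar hm (by rw [ho, ENat.toNat_natCast])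
    exact ⟨i, n, hP, hP.isDicritical_iff.1 hd⟩

end Restr

/-! ### Atypical values at one dicritical -/

section AtypicalAt

variable {K : Type*} [Field K] {p q : Ser K} {Q : NearPoint K} {h : Ser K}
  {i : Fin 2} {n : ℕ} {t : K}

theorem fibre_ne_zero (hp : ¬ x K ∣ p) (hq : x K ∣ q) (t : K) : fibre p q t ≠ 0 := by
  intro h
  rw [fibre, sub_eq_zero] at h
  exact hp (h ▸ hq.mul_left _)

/-- The points of `P` where a polynomial takes a given value, as a finset. -/
def level (G : K[X]) (t : K) : Finset K :=
  open scoped Classical in (G - Polynomial.C t).roots.toFinset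

theorem mem_level {G : K[X]} (hG : G.natDegree ≠ 0) {z : K} : z ∈ level G t ↔ G.eval z = t := by
  classical
  have h0 : G - Polynomial.C t ≠ 0 := by
    intro h0
    rw [sub_eq_zero] at h0
    rw [h0, Polynomial.natDegree_C] at hG
    exact hG rfl
  rw [level, Multiset.mem_toFinset, Polynomial.mem_roots h0, Polynomial.IsRoot, Polynomial.eval_sub,
    Polynomial.eval_C, sub_eq_zero]

theorem card_level_of_simple [IsAlgClosed K] {G : K[X]} (hG : G.natDegree ≠ 0)
    (ht : ∀ z, G.eval z = t → (derivative G).eval z ≠ 0) : (level G t).card = G.natDegree := by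
  classical
  have h0 : G - Polynomial.C t ≠ 0 := by
    intro h0
    rw [sub_eq_zero] at h0
    rw [h0, Polynomial.natDegree_C] at hG
    exact hG rfl
  rw [← Polynomial.natDegree_sub_C (a := t), ← IsAlgClosed.card_roots_eq_natDegree, level]
  have hn : (G - Polynomial.C t).roots.Nodup := by
    rw [Multiset.nodup_iff_count_le_one]
    intro a
    rw [Polynomial.count_roots]
    by_contra hlt
    obtain ⟨h1, h2⟩ := (Polynomial.one_lt_rootMultiplicity_iff_isRoot h0).1 (not_le.1 hlt)
    rw [Polynomial.IsRoot, Polynomial.eval_sub, Polynomial.eval_C, sub_eq_zero] at h1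
    rw [Polynomial.derivative_sub, Polynomial.derivative_C, sub_zero] at h2
    exact ht a h1 h2
  convert Multiset.toFinset_card_of_nodup hn

/-- The critical points of a polynomial off a given fibre are fewer than the points of the fibre. -/
theorem card_critical_lt [IsAlgClosed K] {G : K[X]} (hG : G.natDegree ≠ 0)
    (hG' : derivative G ≠ 0) {T : Finset K}
    (hT : ∀ w ∈ T, (derivative G).eval w = 0 ∧ G.eval w ≠ t) : T.card < (level G t).card := by
  classical
  set F := G - Polynomial.C t with hF
  have hFd : derivative F = derivative G := by
    rw [hF, Polynomial.derivative_sub, Polynomial.derivative_C, sub_zero]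
  have h1 : ∑ z ∈ level G t, F.roots.count z = G.natDegree := by
    rw [Multiset.sum_count_eq_card, IsAlgClosed.card_roots_eq_natDegree, hF,
      Polynomial.natDegree_sub_C]
    intro a ha
    rw [level, Multiset.mem_toFinset]
    exact ha
  have h2 : ∀ z ∈ level G t, F.roots.count z ≤ (derivative G).roots.count z + 1 := by
    intro z _
    rw [Polynomial.count_roots, Polynomial.count_roots, ← hFd]
    have := Polynomial.rootMultiplicity_sub_one_le_derivative_rootMultiplicity_of_ne_zero F z
      (by rwa [hFd])
    omega
  have h3 : ∀ z ∈ T, 1 ≤ (derivative G).roots.count z := by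
    intro z hz
    rw [Multiset.one_le_count_iff_mem, Polynomial.mem_roots hG']
    exact (hT z hz).1
  have hdis : Disjoint (level G t) T := by
    rw [Finset.disjoint_left]
    intro z hz hzT
    exact (hT z hzT).2 ((mem_level hG).1 hz)
  -- A root of `G - t` of multiplicity `e` is a root of `G'` of multiplicity at least `e - 1`, so
  -- the fibre uses up at least `deg G` minus its cardinality of the `deg G - 1` available roots.
  have h4 : ∑ z ∈ level G t ∪ T, (derivative G).roots.count z ≤ G.natDegree - 1 := by
    refine le_trans ?_ (Polynomial.natDegree_derivative_le G)
    refine le_trans ?_ (Polynomial.card_roots' _)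
    calc _ ≤ ∑ z ∈ (level G t ∪ T) ∪ (derivative G).roots.toFinset,
          (derivative G).roots.count z :=
            Finset.sum_le_sum_of_subset Finset.subset_union_left
      _ = _ := Multiset.sum_count_eq_card fun a ha ↦
            Finset.mem_union_right _ (Multiset.mem_toFinset.2 ha)
  rw [Finset.sum_union hdis] at h4
  have h5 := Finset.sum_le_sum h2
  have h6 := Finset.sum_le_sum h3
  rw [Finset.sum_add_distrib, Finset.sum_const, smul_eq_mul, mul_one] at h5
  rw [Finset.sum_const, smul_eq_mul, mul_one] at h6
  omega

theorem pt_prod_injective (i : Fin 2) :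
    Function.Injective (fun z : K ↦ ((pt i z, 0) : Dir K × ℕ)) :=
  fun _ _ h ↦ pt_injective i (Prod.mk.inj h).1

theorem Polar.image_fst_subset (hQ : Polar p q Q i n h) (hf : fibre p q t ≠ 0)
    (hG : (hform i n h).natDegree ≠ 0) :
    Prod.fst '' branchesAt p q Q t ⊆
      (fun z : K ↦ ((pt i z, 0) : Dir K × ℕ)) '' (level (hform i n h) t) := by
  rintro _ ⟨b, hb, rfl⟩
  obtain ⟨z, hz, hJ⟩ := (hQ.mem_branchesAt_iff hf hG).1 hb
  exact ⟨z, (mem_level hG).2 (hQ.eval_eq hf hJ), hz.symm⟩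

theorem Polar.subset_image_fst (hQ : Polar p q Q i n h) (hf : fibre p q t ≠ 0)
    (hG : (hform i n h).natDegree ≠ 0) :
    (fun z : K ↦ ((pt i z, 0) : Dir K × ℕ)) '' (↑(level (hform i n h) t) \ {0}) ⊆
      Prod.fst '' branchesAt p q Q t := by
  rintro _ ⟨z, ⟨hz, hz0⟩, rfl⟩
  obtain ⟨J, hJ⟩ := hQ.exists_strictBranch hf hG hz0 ((mem_level hG).1 hz)
  exact ⟨((pt i z, 0), J), (hQ.mem_branchesAt_iff hf hG).2 ⟨z, rfl, hJ⟩, rfl⟩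

theorem Polar.encard_level_le (hQ : Polar p q Q i n h) (hf : fibre p q t ≠ 0)
    (hG : (hform i n h).natDegree ≠ 0) :
    ((level (hform i n h) t : Set K) \ {0}).encard ≤ (branchesAt p q Q t).encard :=
  calc _ = ((fun z : K ↦ ((pt i z, 0) : Dir K × ℕ)) ''
        (↑(level (hform i n h) t) \ {0})).encard :=
          ((pt_prod_injective i).injOn.encard_image).symm
    _ ≤ (Prod.fst '' branchesAt p q Q t).encard :=
          Set.encard_le_encard (hQ.subset_image_fst hf hG)
    _ ≤ _ := Set.encard_image_le _ _

theorem Polar.isTypicalAt [IsAlgClosed K] (hQ : Polar p q Q i n h) (hf : fibre p q t ≠ 0)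
    (hG : (hform i n h).natDegree ≠ 0)
    (ht : ∀ z, (hform i n h).eval z = t → (derivative (hform i n h)).eval z ≠ 0)
    (ht0 : (hform i n h).eval 0 ≠ t) : IsTypicalAt p q Q t := by
  have hinj : Set.InjOn Prod.fst (branchesAt p q Q t) := by
    rintro ⟨b, J⟩ hb ⟨b', J'⟩ hb' (rfl : b = b')
    obtain ⟨z, hz, hJ⟩ := (hQ.mem_branchesAt_iff hf hG).1 hb
    obtain ⟨z', hz', hJ'⟩ := (hQ.mem_branchesAt_iff hf hG).1 hb'
    have := pt_prod_injective i (hz.symm.trans hz')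
    subst this
    obtain ⟨F, hF⟩ := hQ.eq_span_of_simple hf (ht z (hQ.eval_eq hf hJ))
    have : J = J' := ((hF J hJ).1).trans ((hF J' hJ').1).symm
    rw [this]
  refine ⟨?_, ?_, hinj⟩
  · have h0 : (0 : K) ∉ level (hform i n h) t := fun h0 ↦ ht0 ((mem_level hG).1 h0)
    have heq : Prod.fst '' branchesAt p q Q t =
        (fun z : K ↦ ((pt i z, 0) : Dir K × ℕ)) '' (level (hform i n h) t) := by
      refine (hQ.image_fst_subset hf hG).antisymm ?_
      have h1 := hQ.subset_image_fst hf hG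
      rwa [Set.sdiff_singleton_eq_self (by exact_mod_cast h0)] at h1
    rw [← hinj.encard_image, heq, (pt_prod_injective i).injOn.encard_image,
      Set.encard_coe_eq_coe_finsetCard, card_level_of_simple hG ht, hQ.dicriticalDegree_eq hG]
  · intro b hb
    obtain ⟨z, hz, hJ⟩ := (hQ.mem_branchesAt_iff hf hG).1 hb
    obtain ⟨F, hF⟩ := hQ.eq_span_of_simple hf (ht z (hQ.eval_eq hf hJ))
    rw [hz]
    exact (hF _ hJ).2

theorem Polar.atypicalAt_subset [IsAlgClosed K] (hQ : Polar p q Q i n h)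
    (hf : ∀ t, fibre p q t ≠ 0) (hG : (hform i n h).natDegree ≠ 0) :
    atypicalAt p q Q ⊆ insert ((hform i n h).eval 0)
      ((fun z ↦ (hform i n h).eval z) '' {w | (derivative (hform i n h)).eval w = 0}) := by
  intro t ht
  by_contra hn
  rw [Set.mem_insert_iff, not_or] at hn
  refine ht (hQ.isTypicalAt (hf t) hG (fun z hz hz' ↦ hn.2 ⟨z, hz', hz⟩) (Ne.symm hn.1))

theorem Polar.encard_atypicalAt_le [IsAlgClosed K] (hQ : Polar p q Q i n h)
    (hf : ∀ t, fibre p q t ≠ 0) (hG : (hform i n h).natDegree ≠ 0)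
    (hs : derivative (hform i n h) ≠ 0) :
    (atypicalAt p q Q).encard ≤ (hform i n h).natDegree := by
  classical
  set G := hform i n h with hGdef
  have h1 : {w | (derivative G).eval w = 0} = ((derivative G).roots.toFinset : Set K) := by
    ext w
    rw [Finset.mem_coe, Multiset.mem_toFinset, Polynomial.mem_roots hs]
    rfl
  have h2 : (derivative G).roots.toFinset.card + 1 ≤ G.natDegree := by
    have h3 := Multiset.toFinset_card_le (derivative G).roots
    have h4 := Polynomial.card_roots' (derivative G)
    have h5 := Polynomial.natDegree_derivative_lt hG
    omega
  calc (atypicalAt p q Q).encard ≤ _ := Set.encard_le_encard (hQ.atypicalAt_subset hf hG)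
    _ ≤ _ + 1 := Set.encard_insert_le _ _
    _ ≤ ((derivative G).roots.toFinset.card : ℕ∞) + 1 := by
      gcongr
      rw [h1]
      exact (Set.encard_image_le _ _).trans (Set.encard_coe_eq_coe_finsetCard _).le
    _ ≤ G.natDegree := by exact_mod_cast h2

/-- The fibre over `t` without `z = 0` injects into the branches at the line, so it suffices to
bound atypical values by its cardinality. -/
theorem Polar.encard_atypicalAt_diff_le [IsAlgClosed K] (hQ : Polar p q Q i n h)
    (hf : ∀ t, fibre p q t ≠ 0) (hG : (hform i n h).natDegree ≠ 0)
    (hs : derivative (hform i n h) ≠ 0) (t : K) :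
    (atypicalAt p q Q \ {t}).encard ≤ (branchesAt p q Q t).encard := by
  classical
  refine le_trans ?_ (hQ.encard_level_le (hf t) hG)
  set G := hform i n h with hGdef
  set T := (derivative G).roots.toFinset.filter fun w ↦ G.eval w ≠ t with hT
  have hlt := card_critical_lt (t := t) hG hs (T := T) (by
    intro w hw
    rw [hT, Finset.mem_filter, Multiset.mem_toFinset, Polynomial.mem_roots hs] at hw
    exact hw)
  have hsub : ∀ u ∈ atypicalAt p q Q \ {t}, u ∈ insert (G.eval 0) ((fun z ↦ G.eval z) '' T) := by
    rintro u ⟨hu, hut⟩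
    rcases hQ.atypicalAt_subset hf hG hu with h1 | ⟨w, hw, rfl⟩
    · exact .inl h1
    · refine .inr ⟨w, ?_, rfl⟩
      rw [Finset.mem_coe, hT, Finset.mem_filter, Multiset.mem_toFinset, Polynomial.mem_roots hs]
      exact ⟨hw, hut⟩
  have himg : ((fun z ↦ G.eval z) '' (T : Set K)).encard ≤ T.card :=
    (Set.encard_image_le _ _).trans (Set.encard_coe_eq_coe_finsetCard _).le
  -- The possible failure at `z = 0` is paid for once: if `G(0) = t`, the fibre loses a point but
  -- the value `G(0)` is excluded; if not, the fibre is intact and `G(0)` counts as one extra value.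
  by_cases h0 : G.eval 0 = t
  · have h1 : atypicalAt p q Q \ {t} ⊆ (fun z ↦ G.eval z) '' (T : Set K) := by
      intro u hu
      rcases hsub u hu with h1 | h1
      · exact absurd (h1.trans h0) hu.2
      · exact h1
    refine (Set.encard_le_encard h1).trans (himg.trans ?_)
    have h2 : (0 : K) ∈ level G t := (mem_level hG).2 h0
    rw [← Finset.coe_erase, Set.encard_coe_eq_coe_finsetCard, Finset.card_erase_of_mem h2]
    exact_mod_cast Nat.le_sub_one_of_lt hlt
  · have h2 : (0 : K) ∉ level G t := fun h2 ↦ h0 ((mem_level hG).1 h2)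
    rw [← Finset.coe_erase, Set.encard_coe_eq_coe_finsetCard, Finset.erase_eq_of_notMem h2]
    calc _ ≤ _ := Set.encard_le_encard hsub
      _ ≤ _ + 1 := Set.encard_insert_le _ _
      _ ≤ (T.card : ℕ∞) + 1 := by gcongr
      _ ≤ _ := by exact_mod_cast hlt

end AtypicalAt

/-! ### Exceptional curves contained in a fibre force atypicality -/

section Critical

variable {K : Type*} [Field K] {p q : Ser K} {Q : NearPoint K} {h : Ser K} {m : Fin 2 → ℕ}
  {i : Fin 2} {n : ℕ} {t : K}

theorem eqn_dvd_blowup (s : Dir K) {f : Ser K} (hf : MvPowerSeries.constantCoeff f = 0) :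
    s.eqn ∣ blowup s f := by
  obtain ⟨a, b, rfl⟩ := exists_eq_add_of_constantCoeff_eq_zero hf
  rw [map_add, map_mul, map_mul]
  exact dvd_add ((eqn_dvd_blowup_X s 0).mul_right _) ((eqn_dvd_blowup_X s 1).mul_right _)

/-- A fibre with `deg G` distinct points has no multiple root. -/
theorem derivative_ne_zero_of_card_level [IsAlgClosed K] {G : K[X]} (hG : G.natDegree ≠ 0)
    (hc : (level G t).card = G.natDegree) {z : K} (hz : G.eval z = t) :
    (derivative G).eval z ≠ 0 := by
  classical
  intro hz'
  have h0 : G - Polynomial.C t ≠ 0 := by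
    intro h0
    rw [sub_eq_zero] at h0
    rw [h0, Polynomial.natDegree_C] at hG
    exact hG rfl
  rw [← Polynomial.natDegree_sub_C (a := t), ← IsAlgClosed.card_roots_eq_natDegree] at hc
  have hn : (G - Polynomial.C t).roots.Nodup := by
    rw [← Multiset.toFinset_card_eq_card_iff_nodup]
    rw [level] at hc
    convert hc
  have h1 : 1 < (G - Polynomial.C t).rootMultiplicity z := by
    rw [Polynomial.one_lt_rootMultiplicity_iff_isRoot h0]
    constructor
    · simp [hz]
    · simp [hz']
  have h2 := Multiset.nodup_iff_count_le_one.1 hn z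
  rw [Polynomial.count_roots] at h2
  omega

/-- The function `p / q` has the value `t` along the exceptional curve `X i.rev = 0`, which meets
the poles of `p / q`. -/
structure ConstAlong (p q : Ser K) (t : K) (Q : NearPoint K) (i : Fin 2) (n : ℕ) (h : Ser K) :
    Prop where
  chart : Chart p q Q h (Function.update 0 i n)
  ne_zero : n ≠ 0
  dvd : MvPowerSeries.X i.rev ∣ h - MvPowerSeries.C t * MvPowerSeries.X i ^ n
  dvd_x : MvPowerSeries.X i.rev ∣ pullback Q (x K)
  dvd_y : MvPowerSeries.X i.rev ∣ pullback Q (y K)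

theorem ConstAlong.isBasePoint (hQ : ConstAlong p q t Q i n h) : IsBasePoint p q Q := by
  rw [hQ.chart.isBasePoint_iff, isUnit_iff_constantCoeff_ne_zero, not_not]
  constructor
  · obtain ⟨k, hk⟩ := hQ.dvd
    have := congrArg MvPowerSeries.constantCoeff (sub_eq_iff_eq_add.1 hk)
    rw [this]
    simp [hQ.ne_zero]
  · intro h0
    have := congrFun h0 i
    rw [Function.update_self] at this
    exact hQ.ne_zero this

theorem dvd_blowup_coord_rev (i : Fin 2) {f : Ser K} (hf : MvPowerSeries.X i.rev ∣ f) :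
    MvPowerSeries.X i * MvPowerSeries.X i.rev ∣ blowup (coord i.rev) f := by
  obtain ⟨g, rfl⟩ := hf
  rw [map_mul, blowup_coord_X_self]
  rw [Fin.rev_rev]
  exact dvd_mul_right _ _

theorem dvd_of_dvd_X_pow_mul (i : Fin 2) (n : ℕ) {f : Ser K}
    (hf : MvPowerSeries.X i.rev ∣ MvPowerSeries.X i ^ n * f) : MvPowerSeries.X i.rev ∣ f := by
  refine ((prime_X i.rev).dvd_or_dvd hf).resolve_left fun h1 ↦ ?_
  have h2 := (prime_X i.rev).dvd_of_dvd_pow h1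
  rw [← res_eq_zero_iff, res_rev_X] at h2
  exact PowerSeries.X_ne_zero h2

/-- When the new exceptional line is itself polar, the configuration recurs at the point where it
meets the strict transform of the curve on which `r = t`. -/
theorem ConstAlong.step_rev (hQ : ConstAlong p q t Q i n h) (hlt : h.order.toNat < n) :
    ∃ n' h', ConstAlong p q t (Q ++ [coord i.rev]) i n' h' ∧
      meas h' (Function.update 0 i n') < meas h (Function.update 0 i n) := by
  obtain ⟨g, hg, -⟩ := exists_strictTransform_coord i.rev hQ.chart.ne_zero
  have hc := hQ.chart.step_coord i.rev hg
  have hm := hQ.chart.meas_step_coord_lt hQ.isBasePoint i.rev hg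
  rw [update_sum, Fin.rev_rev, Nat.sub_eq_zero_of_le hlt.le, Function.update_idem, pow_zero,
    one_mul] at hc hm
  refine ⟨_, g, ⟨hc, by omega, ?_, ?_, ?_⟩, hm⟩
  · apply dvd_of_dvd_X_pow_mul i h.order.toNat
    have h1 := (dvd_mul_left _ _).trans (dvd_blowup_coord_rev i hQ.dvd)
    rw [map_sub, map_mul, map_pow, blowup_C, hg, Fin.rev_rev] at h1
    have h2 : blowup (coord i.rev) (MvPowerSeries.X i : Ser K) = MvPowerSeries.X i := by
      have := blowup_coord_X_rev (K := K) i.rev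
      rwa [Fin.rev_rev] at this
    rw [h2] at h1
    convert h1 using 1
    rw [mul_sub, mul_left_comm, ← pow_add, Nat.add_sub_cancel' hlt.le]
  · rw [pullback_concat]
    exact (dvd_mul_left _ _).trans (dvd_blowup_coord_rev i hQ.dvd_x)
  · rw [pullback_concat]
    exact (dvd_mul_left _ _).trans (dvd_blowup_coord_rev i hQ.dvd_y)

/-- If `p / q` is constant on the exceptional line of `Q`, then it is so along this line at
its point where the denominator vanishes. -/
theorem Polar.constAlong (hQ : Polar p q Q i n h) (hG : hform i n h = Polynomial.C t) :
    ∃ h', ConstAlong p q t (Q ++ [coord i]) i n h' ∧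
      meas h' (Function.update 0 i n) < meas h (Function.update 0 i n) := by
  obtain ⟨g, hg, -⟩ := exists_strictTransform_coord i hQ.chart.ne_zero
  have hc := hQ.chart.step_coord i hg
  have hm := hQ.chart.meas_step_coord_lt hQ.isBasePoint i hg
  have hu : Function.update (Function.update 0 i n : Fin 2 → ℕ) i.rev 0 =
      (Function.update 0 i n : Fin 2 → ℕ) := by
    rw [Function.update_eq_iff]
    exact ⟨(Function.update_of_ne (rev_ne i) n (0 : Fin 2 → ℕ)).symm, fun _ _ ↦ rfl⟩
  rw [update_sum, Nat.sub_eq_zero_of_le hQ.le_toNat, hu] at hc hm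
  refine ⟨_, ⟨hc, hQ.ne_zero, ?_, ?_, ?_⟩, hm⟩
  · have hH : blowup (coord i) h = MvPowerSeries.X i.rev ^ n *
        (MvPowerSeries.X i.rev ^ (h.order.toNat - n) * g) := by
      rw [hg, ← mul_assoc, ← pow_add, Nat.add_sub_cancel' hQ.le_toNat]
    obtain ⟨f, hf⟩ := exists_blowup_eq (coord i) hQ.le_order
    rw [hH, eqn_coord, idx_coord, tform_coord, Fin.rev_rev, hform_rev, hG,
      Polynomial.reflect_C] at hf
    rw [mul_left_cancel₀ (pow_ne_zero _ (prime_X _).ne_zero) hf, map_mul, map_pow,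
      Polynomial.aeval_C, Polynomial.aeval_X]
    exact ⟨f, add_sub_cancel_left _ _⟩
  · rw [pullback_concat, ← eqn_coord]
    exact eqn_dvd_blowup _ (by simp [constantCoeff_pullback])
  · rw [pullback_concat, ← eqn_coord]
    exact eqn_dvd_blowup _ (by simp [constantCoeff_pullback])

theorem ConstAlong.coeff_zero_hform (hQ : ConstAlong p q t Q i n h) :
    (hform i n h).coeff 0 = t := by
  have h1 := res_eq_zero_iff.2 hQ.dvd
  have h2 : res i.rev (MvPowerSeries.X i : Ser K) = PowerSeries.X := by
    have := res_X_rev (K := K) i.rev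
    rwa [Fin.rev_rev] at this
  rw [map_sub, map_mul, map_pow, res_C, h2, sub_eq_zero] at h1
  have h3 := congrArg (PowerSeries.coeff n) h1
  rw [coeff_res, Fin.rev_rev, PowerSeries.coeff_C_mul, PowerSeries.coeff_X_pow_self, mul_one] at h3
  rw [coeff_hform, if_pos (Nat.zero_le n), Nat.sub_zero, Finsupp.single_zero, add_zero, h3]

/-- Typicality would need `deg G` distinct simple roots, each carrying a branch, including `z = 0`.
But there the fibre already contains the old exceptional curve, and a further branch makes the root
multiple. -/
theorem ConstAlong.not_isTypicalAt [IsAlgClosed K] (hQ : ConstAlong p q t Q i n h)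
    (hf : fibre p q t ≠ 0) (hP : Polar p q Q i n h) (hG : (hform i n h).natDegree ≠ 0) :
    ¬ IsTypicalAt p q Q t := by
  rintro ⟨h1, -, hinj⟩
  rw [hP.dicriticalDegree_eq hG, ← hinj.encard_image] at h1
  set G := hform i n h with hGdef
  have hsub := hP.image_fst_subset hf hG
  have hle : G.natDegree ≤ (level G t).card := by
    have := Set.encard_le_encard hsub
    rw [h1, (pt_prod_injective i).injOn.encard_image, Set.encard_coe_eq_coe_finsetCard] at this
    exact_mod_cast this
  have hge : (level G t).card ≤ G.natDegree := by
    classical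
    rw [← Polynomial.natDegree_sub_C (a := t), level]
    refine le_trans ?_ (Polynomial.card_roots' _)
    convert Multiset.toFinset_card_le _
  have hcard := le_antisymm hge hle
  have h0 : G.eval 0 = t := by
    rw [← Polynomial.coeff_zero_eq_eval_zero]
    exact hQ.coeff_zero_hform
  have hd := derivative_ne_zero_of_card_level hG hcard h0
  have hmem : ((pt i 0, 0) : Dir K × ℕ) ∈ Prod.fst '' branchesAt p q Q t := by
    have heq := Set.Finite.eq_of_subset_of_encard_le
      (((level G t).finite_toSet.image _).subset hsub) hsub (by
        rw [(pt_prod_injective i).injOn.encard_image, Set.encard_coe_eq_coe_finsetCard, h1, hcard])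
    rw [heq]
    exact ⟨0, (mem_level hG).2 h0, rfl⟩
  obtain ⟨⟨b, J⟩, hb, hbz⟩ := hmem
  obtain ⟨z, hz, hJ⟩ := (hP.mem_branchesAt_iff hf hG).1 hb
  have hz0 : z = 0 := pt_prod_injective i (hz.symm.trans hbz)
  subst hz0
  simp only at hJ
  obtain ⟨H, hH, hc, hr⟩ := hP.chart_zero
  rw [pt_zero] at hJ
  obtain ⟨hJ1, hJ2⟩ := hc.mem_of_mem_strictBranches hf hJ
  rw [mon_zero, mul_one] at hJ2
  -- `X i.rev` is exceptional, hence not in `J`, so `k` is a nonunit in `J`; restricted to the line,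
  -- the product has no linear term, that is, `G'(0) = 0`.
  obtain ⟨k, hk⟩ : MvPowerSeries.X i.rev ∣ H - MvPowerSeries.C t := by
    apply dvd_of_dvd_X_pow_mul i n
    have h2 := (dvd_mul_left _ _).trans (dvd_blowup_coord_rev i hQ.dvd)
    have h3 : blowup (coord i.rev) (MvPowerSeries.X i : Ser K) = MvPowerSeries.X i := by
      have := blowup_coord_X_rev (K := K) i.rev
      rwa [Fin.rev_rev] at this
    rw [map_sub, map_mul, map_pow, blowup_C, hH, h3] at h2
    convert h2 using 1
    ring
  have hX : MvPowerSeries.X i.rev ∉ J := by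
    intro hX
    refine ((mem_strictBranches_iff hf).1 hJ).2.2 ?_
    rw [pullback_concat, pullback_concat]
    have hdvd : ∀ f : Ser K, MvPowerSeries.X i.rev ∣ f → blowup (coord i.rev) f ∈ J := fun f hf ↦
      Ideal.mem_of_dvd _ ((dvd_mul_left _ _).trans (dvd_blowup_coord_rev i hf)) hX
    exact ⟨hdvd _ hQ.dvd_x, hdvd _ hQ.dvd_y⟩
  rw [hk] at hJ2
  have hkJ := (hJ1.isPrime.mem_or_mem hJ2).resolve_left hX
  have hk0 : MvPowerSeries.constantCoeff k = 0 := by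
    by_contra h4
    exact hJ1.not_isUnit hkJ (isUnit_iff_constantCoeff_ne_zero.2 h4)
  have h5 : PowerSeries.coeff 1 (res i (H - MvPowerSeries.C t)) =
      PowerSeries.coeff 1 (res i (MvPowerSeries.X i.rev * k)) := by rw [hk]
  rw [map_sub, hr, res_C, map_mul, res_X_rev, PowerSeries.coeff_one_mul, constantCoeff_res, hk0]
    at h5
  apply hd
  rw [← Polynomial.coeff_zero_eq_eval_zero, Polynomial.coeff_derivative]
  simpa [PowerSeries.coeff_C] using h5

/-- Blow up until a dicritical appears: follow the given curve while the new line is polar. If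
instead the new line has constant value, that value is `t`, and one continues with this line at its
point with pole. The intersection number drops each time. -/
theorem ConstAlong.exists_not_isTypicalAt [IsAlgClosed K] (hQ : ConstAlong p q t Q i n h)
    (hf : fibre p q t ≠ 0) : ∃ Q', IsDicritical p q Q' ∧ ¬ IsTypicalAt p q Q' t := by
  induction hN : meas h (Function.update 0 i n) using Nat.strong_induction_on
    generalizing Q n h with
  | _ N ih =>
    subst hN
    by_cases hlt : h.order.toNat < n
    · obtain ⟨n', h', hQ', hm⟩ := hQ.step_rev hlt
      exact ih _ hm hQ' rfl
    · have hP : Polar p q Q i n h := by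
        refine ⟨hQ.chart, hQ.ne_zero, ?_⟩
        rw [← hQ.chart.order_toNat]
        exact_mod_cast not_lt.1 hlt
      by_cases hG : (hform i n h).natDegree = 0
      · have hG' : hform i n h = Polynomial.C t := by
          rw [← hQ.coeff_zero_hform]
          exact Polynomial.eq_C_of_natDegree_eq_zero hG
        obtain ⟨h', hQ', hm⟩ := hP.constAlong hG'
        exact ih _ hm hQ' rfl
      · exact ⟨Q, hP.isDicritical_iff.2 hG, hQ.not_isTypicalAt hf hP hG⟩

end Critical

/-! ### From branches at dicriticals to branches at the origin -/

section Global

variable {K : Type*} [Field K] {p q : Ser K} {Q Q' : NearPoint K} {h : Ser K} {m : Fin 2 → ℕ}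
  {t : K}

theorem IsBasePoint.of_prefix (h : IsBasePoint p q Q') (hQ : Q <+: Q') : IsBasePoint p q Q := by
  obtain ⟨R, rfl⟩ := hQ
  rw [IsBasePoint, pullback_append, pullback_append] at h
  exact ⟨fun hd ↦ h.1 (map_dvd _ hd), fun hd ↦ h.2 (map_dvd _ hd)⟩

/-- The branch at the origin of which the given branch is the strict transform. -/
def toBranch (Q : NearPoint K) (b : (Dir K × ℕ) × Ideal (Ser K)) : Ideal (Ser K) :=
  b.2.comap (pullback (pointAlong Q b.1.1 b.1.2))

theorem liesOver_toBranch (hf : fibre p q t ≠ 0) {b : (Dir K × ℕ) × Ideal (Ser K)}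
    (hb : b ∈ branchesAt p q Q t) :
    LiesOver (pointAlong Q b.1.1 b.1.2) b.2 (toBranch Q b) := by
  obtain ⟨h1, h2, h3⟩ := (mem_strictBranches_iff hf).1 hb.2
  exact liesOver_comap h1 hf h2 h3

theorem toBranch_mem (hf : fibre p q t ≠ 0) {b : (Dir K × ℕ) × Ideal (Ser K)}
    (hb : b ∈ branchesAt p q Q t) : toBranch Q b ∈ branches p q t :=
  (mem_branches_iff hf).2
    ⟨(liesOver_toBranch hf hb).base, ((mem_strictBranches_iff hf).1 hb.2).2.1⟩

/-- Two points on the same branch are comparable. Each of these two is the first point on the branch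
that is not a base point, as prefixes of base points are base points, so they coincide; then the
lifts do. -/
theorem toBranch_injective (h0 : ∃ h m, Chart p q [] h m) (hf : fibre p q t ≠ 0)
    (hQ : IsDicritical p q Q) (hQ' : IsDicritical p q Q') {b b' : (Dir K × ℕ) × Ideal (Ser K)}
    (hb : b ∈ branchesAt p q Q t) (hb' : b' ∈ branchesAt p q Q' t)
    (h : toBranch Q b = toBranch Q' b') : Q = Q' ∧ b = b' := by
  have key : ∀ {Q : NearPoint K}, IsDicritical p q Q → ∀ {b : (Dir K × ℕ) × Ideal (Ser K)},
      b ∈ branchesAt p q Q t → b.1.2 = 0 ∧ IsBasePoint p q Q ∧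
        ¬ IsBasePoint p q (Q ++ [b.1.1]) := by
    intro Q hQ b hb
    obtain ⟨h, m, hc⟩ := h0
    obtain ⟨h', m', hc'⟩ := hc.exists_append Q
    obtain ⟨i, n, hP, hG⟩ := hQ.exists_polar hc'
    obtain ⟨z, hz, -⟩ := (hP.mem_branchesAt_iff hf hG).1 hb
    have h1 := hb.1.2
    rw [hz] at h1 ⊢
    exact ⟨rfl, hP.isBasePoint, h1⟩
  obtain ⟨hk, hbase, hn⟩ := key hQ hb
  obtain ⟨hk', hbase', hn'⟩ := key hQ' hb'
  have hL := liesOver_toBranch hf hb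
  have hL' := liesOver_toBranch hf hb'
  rw [h] at hL
  obtain ⟨⟨s, k⟩, J⟩ := b
  obtain ⟨⟨s', k'⟩, J'⟩ := b'
  simp only at hk hk' hL hL' hn hn'
  subst hk
  subst hk'
  rw [pointAlong_zero] at hL hL'
  have aux : ∀ {Q Q' : NearPoint K} {s s' : Dir K}, ¬ IsBasePoint p q (Q ++ [s]) →
      IsBasePoint p q Q' → Q ++ [s] <+: Q' ++ [s'] → Q ++ [s] = Q' ++ [s'] := by
    intro Q Q' s s' hn hb hp
    rcases List.prefix_concat_iff.1 hp with h | h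
    · exact h
    · exact absurd (hb.of_prefix h) hn
  have heq : Q ++ [s] = Q' ++ [s'] := by
    rcases hL.prefix_or hL' with hp | hp
    · exact aux hn hbase' hp
    · exact (aux hn' hbase hp).symm
  rw [heq] at hL
  have hJ := hL.unique hL'
  obtain ⟨rfl, hs⟩ := List.append_inj' heq rfl
  obtain rfl := List.singleton_inj.1 hs
  rw [hJ]
  exact ⟨rfl, rfl⟩

/-- Following a branch through the base points. -/
theorem LiesOver.exists_notBasePoint [IsAlgClosed K] {I J : Ideal (Ser K)}
    (hL : LiesOver Q J I) (hc : Chart p q Q h m) (hb : IsBasePoint p q Q) :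
    ∃ Q' s J', IsBasePoint p q Q' ∧ ¬ IsBasePoint p q (Q' ++ [s]) ∧
      LiesOver (Q' ++ [s]) J' I := by
  induction hN : meas h m using Nat.strong_induction_on generalizing Q h m J with
  | _ N ih =>
    subst hN
    obtain ⟨s, J', hL'⟩ := hL.exists_concat
    by_cases hb' : IsBasePoint p q (Q ++ [s])
    · obtain ⟨h', m', hc', hm⟩ := hc.exists_concat_meas_lt hb s
      exact ih _ hm hL' hc' hb' rfl
    · exact ⟨Q, s, J', hb, hb', hL'⟩

/-- A branch at a resolved point excludes poles there: the new line is then not polar, so the order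
of `h` is at least that of the monomial, and the point is not the one lying on the old polar curve.
-/
theorem Chart.exists_polar_of_strictBranch (hc : Chart p q Q h m) (hf : fibre p q t ≠ 0)
    (hb : IsBasePoint p q Q) {s : Dir K} (hs : ¬ IsBasePoint p q (Q ++ [s])) {J : Ideal (Ser K)}
    (hJ : J ∈ strictBranches p q t (Q ++ [s])) :
    ∃ i n b, Polar p q Q i n h ∧ s = pt i b := by
  have hm := (hc.isBasePoint_iff.1 hb).2
  have hle : m 0 + m 1 ≤ h.order.toNat := by
    rcases s.eq_coord_or with ⟨j, rfl⟩ | ⟨a, ha, rfl⟩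
    · obtain ⟨g, hg, -⟩ := exists_strictTransform_coord j hc.ne_zero
      have hc' := hc.step_coord j hg
      by_contra hlt
      refine hc'.notMem_strictBranches hf hs (fun h0 ↦ ?_) hJ
      have := congrFun h0 j.rev
      rw [Function.update_self, Pi.zero_apply] at this
      omega
    · obtain ⟨g, hg, -⟩ := exists_strictTransform (.fin a) hc.ne_zero
      obtain ⟨w, hw⟩ := exists_mul_eq_one ha (m 1)
      have hc' := hc.step_fin hg hw
      by_contra hlt
      refine hc'.notMem_strictBranches hf hs (fun h0 ↦ ?_) hJ
      have := congrFun h0 0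
      simp only [Matrix.cons_val_zero, Pi.zero_apply] at this
      omega
  obtain ⟨i, n, rfl, hP⟩ := hc.exists_polar hm hle
  rcases eq_coord_or_eq_pt i s with rfl | ⟨b, rfl⟩
  · obtain ⟨g, hg, -⟩ := exists_strictTransform_coord i hc.ne_zero
    have hc' := hc.step_coord i hg
    refine absurd hJ (hc'.notMem_strictBranches hf hs fun h0 ↦ ?_)
    have := congrFun h0 i
    rw [Function.update_of_ne (rev_ne i).symm, Function.update_self] at this
    exact hP.ne_zero this
  · exact ⟨i, n, b, hP, rfl⟩

/-- If `t` is typical at all dicriticals, then the branches of `C_t` are those at the dicriticals. -/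
theorem exists_toBranch_eq [IsAlgClosed K] (h0 : ∃ h m, Chart p q [] h m)
    (hb0 : IsBasePoint p q []) (hf : fibre p q t ≠ 0)
    (ht : ∀ Q, IsDicritical p q Q → IsTypicalAt p q Q t) {I : Ideal (Ser K)}
    (hI : I ∈ branches p q t) :
    ∃ Q, IsDicritical p q Q ∧ ∃ b ∈ branchesAt p q Q t, toBranch Q b = I := by
  obtain ⟨h, m, hc⟩ := h0
  obtain ⟨hI1, hI2⟩ := (mem_branches_iff hf).1 hI
  have hL : LiesOver [] I I := ⟨hI1, hI1, rfl⟩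
  obtain ⟨Q, s, J, hQ, hs, hLJ⟩ := hL.exists_notBasePoint hc hb0
  have hJ : J ∈ strictBranches p q t (Q ++ [s]) := by
    refine (mem_strictBranches_iff hf).2 ⟨hLJ.isBranch, ?_, ?_⟩
    · rwa [← Ideal.mem_comap, hLJ.comap_eq]
    · rintro ⟨hx, hy⟩
      rw [← Ideal.mem_comap, hLJ.comap_eq] at hx hy
      exact hI1.not_mem ⟨hx, hy⟩
  obtain ⟨h', m', hc'⟩ := hc.exists_append Q
  obtain ⟨i, n, z, hP, rfl⟩ := hc'.exists_polar_of_strictBranch hf hQ hs hJ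
  by_cases hG : (hform i n h').natDegree = 0
  · exfalso
    have hG' := Polynomial.eq_C_of_natDegree_eq_zero hG
    have ht' := hP.eval_eq hf hJ
    rw [hG', Polynomial.eval_C] at ht'
    rw [ht'] at hG'
    obtain ⟨h'', hC, -⟩ := hP.constAlong hG'
    obtain ⟨Q', hQ', hn⟩ := hC.exists_not_isTypicalAt hf
    exact hn (ht Q' hQ')
  · exact ⟨Q, hP.isDicritical_iff.2 hG, ((pt i z, 0), J),
      (hP.mem_branchesAt_iff hf hG).2 ⟨z, rfl, hJ⟩, hLJ.comap_eq⟩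

end Global

/-! ### Counting branches and finiteness of the dicriticals -/

section Count

variable {K : Type*} [Field K] {p q : Ser K} {Q : NearPoint K} {t : K}

/-- Each branch contributes its own prime factor of `F`, which vanishes at the origin and so
contributes at least 1 to the order on the line. -/
theorem card_le_order_res (k : Fin 2) {F : Ser K} (T : Finset (Ideal (Ser K)))
    (hT : ∀ J ∈ T, IsBranch J ∧ F ∈ J) : (T.card : ℕ∞) ≤ (res k F).order := by
  classical
  induction T using Finset.induction_on generalizing F with
  | empty => simp
  | insert J T hJT ih =>
    obtain ⟨hJ, hF⟩ := hT J (Finset.mem_insert_self _ _)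
    obtain ⟨g, hg, rfl⟩ := hJ.exists_eq_span
    obtain ⟨F', rfl⟩ := Ideal.mem_span_singleton.1 hF
    have h1 : (T.card : ℕ∞) ≤ (res k F').order := by
      refine ih fun J' hJ' ↦ ?_
      obtain ⟨h1, h2⟩ := hT J' (Finset.mem_insert_of_mem hJ')
      refine ⟨h1, (h1.isPrime.mem_or_mem h2).resolve_left fun h3 ↦ hJT ?_⟩
      have h4 := h1.eq_of_le hJ.isPrime hJ.ne_bot
        ((Ideal.span_singleton_le_iff_mem _).2 h3)
      rwa [h4]
    have h2 : 1 ≤ (res k g).order := by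
      rw [Order.one_le_iff_ne_zero, PowerSeries.order_ne_zero_iff_constCoeff_eq_zero,
        constantCoeff_res]
      by_contra h2
      exact hg.not_isUnit (isUnit_iff_constantCoeff_ne_zero.2 h2)
    rw [Finset.card_insert_of_notMem hJT, map_mul, PowerSeries.order_mul, Nat.cast_add,
      Nat.cast_one, add_comm]
    exact add_le_add h2 h1

/-- All members of the pencil have the same restriction to `x = 0`, so this bound is uniform in `t`.
-/
theorem encard_branches_le (hp : ¬ x K ∣ p) (hq : x K ∣ q) (t : K) :
    (branches p q t).encard ≤ (res 0 p).order := by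
  have hf := fibre_ne_zero hp hq t
  have hres : res 0 (fibre p q t) = res 0 p := by
    rw [fibre, map_sub, map_mul, res_eq_zero_iff.2 hq, mul_zero, sub_zero]
  have hfin : ∀ T : Finset (Ideal (Ser K)), (T : Set (Ideal (Ser K))) ⊆ branches p q t →
      (T.card : ℕ∞) ≤ (res 0 p).order := fun T hT ↦ by
    rw [← hres]
    exact card_le_order_res 0 T fun J hJ ↦ (mem_branches_iff hf).1 (hT hJ)
  by_contra hlt
  rw [not_le] at hlt
  have hne : res 0 p ≠ 0 := fun h0 ↦ hp (res_eq_zero_iff.1 h0)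
  rw [← PowerSeries.coe_toNat_order hne] at hlt hfin
  obtain ⟨T, hT, hcard⟩ := Set.exists_subset_encard_eq (Order.add_one_le_of_lt hlt)
  have hTf : T.Finite := Set.finite_of_encard_eq_coe (k := (res 0 p).order.toNat + 1)
    (by rw [hcard]; norm_cast)
  have h1 := hfin hTf.toFinset (by rwa [hTf.coe_toFinset])
  rw [← Set.encard_coe_eq_coe_finsetCard, hTf.coe_toFinset, hcard] at h1
  norm_cast at h1
  omega

theorem encard_biUnion_toBranch (h0 : ∃ h m, Chart p q [] h m) (hf : fibre p q t ≠ 0)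
    (F : Finset (NearPoint K)) (hF : ∀ Q ∈ F, IsDicritical p q Q) :
    (⋃ Q ∈ F, toBranch Q '' branchesAt p q Q t).encard =
      ∑ Q ∈ F, (branchesAt p q Q t).encard := by
  have h1 := F.finite_toSet.encard_biUnion (s := fun Q ↦ toBranch Q '' branchesAt p q Q t) (by
    intro Q hQ Q' hQ' hne
    rw [Function.onFun, Set.disjoint_left]
    rintro _ ⟨b, hb, rfl⟩ ⟨b', hb', he⟩
    exact hne (toBranch_injective h0 hf (hF Q hQ) (hF Q' hQ') hb hb' he.symm).1)
  simp only [Finset.mem_coe] at h1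
  rw [h1, finsum_mem_finset_eq_sum]
  refine Finset.sum_congr rfl fun Q hQ ↦ ?_
  refine Set.InjOn.encard_image fun b hb b' hb' he ↦ ?_
  exact (toBranch_injective h0 hf (hF Q hQ) (hF Q hQ) hb hb' he).2

theorem sum_encard_branchesAt_le (h0 : ∃ h m, Chart p q [] h m) (hf : fibre p q t ≠ 0)
    (F : Finset (NearPoint K)) (hF : ∀ Q ∈ F, IsDicritical p q Q) :
    ∑ Q ∈ F, (branchesAt p q Q t).encard ≤ (branches p q t).encard := by
  rw [← encard_biUnion_toBranch h0 hf F hF]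
  refine Set.encard_le_encard (Set.iUnion₂_subset fun Q _ ↦ ?_)
  rintro _ ⟨b, hb, rfl⟩
  exact toBranch_mem hf hb

theorem IsDicritical.polar (h0 : ∃ h m, Chart p q [] h m) (hQ : IsDicritical p q Q) :
    ∃ i n h, Polar p q Q i n h ∧ (hform i n h).natDegree ≠ 0 := by
  obtain ⟨h, m, hc⟩ := h0
  obtain ⟨h', m', hc'⟩ := hc.exists_append Q
  obtain ⟨i, n, hP⟩ := hQ.exists_polar hc'
  exact ⟨i, n, h', hP⟩

theorem encard_atypicalAt_le [IsAlgClosed K] (h0 : ∃ h m, Chart p q [] h m)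
    (hf : ∀ t, fibre p q t ≠ 0) (hQ : IsDicritical p q Q) (hs : IsSeparableAt p q Q) :
    (atypicalAt p q Q).encard ≤ dicriticalDegree p q Q := by
  obtain ⟨i, n, h, hP, hG⟩ := hQ.polar h0
  rw [hP.dicriticalDegree_eq hG]
  exact hP.encard_atypicalAt_le hf hG (hP.derivative_ne_zero hG hs)

theorem encard_atypicalAt_diff_le [IsAlgClosed K] (h0 : ∃ h m, Chart p q [] h m)
    (hf : ∀ t, fibre p q t ≠ 0) (hQ : IsDicritical p q Q) (hs : IsSeparableAt p q Q) (t : K) :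
    (atypicalAt p q Q \ {t}).encard ≤ (branchesAt p q Q t).encard := by
  obtain ⟨i, n, h, hP, hG⟩ := hQ.polar h0
  exact hP.encard_atypicalAt_diff_le hf hG (hP.derivative_ne_zero hG hs) t

theorem dicriticalDegree_ne_zero (h0 : ∃ h m, Chart p q [] h m) (hQ : IsDicritical p q Q) :
    dicriticalDegree p q Q ≠ 0 := by
  obtain ⟨i, n, h, hP, hG⟩ := hQ.polar h0
  rwa [hP.dicriticalDegree_eq hG]

theorem finite_setOf_isDicritical [IsAlgClosed K] (h0 : ∃ h m, Chart p q [] h m)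
    (hp : ¬ x K ∣ p) (hq : x K ∣ q) (hs : ∀ Q, IsDicritical p q Q → IsSeparableAt p q Q) :
    {Q | IsDicritical p q Q}.Finite := by
  have hf := fibre_ne_zero hp hq
  have hne : res 0 p ≠ 0 := fun h0 ↦ hp (res_eq_zero_iff.1 h0)
  by_contra hinf
  obtain ⟨F, hF, hcard⟩ :=
    Set.Infinite.exists_subset_card_eq hinf ((res 0 p).order.toNat + 1)
  have hFd : ∀ Q ∈ F, IsDicritical p q Q := fun Q hQ ↦ hF hQ
  have hfin : (⋃ Q ∈ F, atypicalAt p q Q).Finite :=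
    F.finite_toSet.biUnion fun Q hQ ↦ Set.finite_of_encard_le_coe
      (encard_atypicalAt_le h0 hf (hFd Q hQ) (hs Q (hFd Q hQ)))
  -- `K` is infinite, so some `t` is typical at every dicritical in `F`; each then carries at least
  -- one branch of `C_t`, and these are too many.
  obtain ⟨t, ht⟩ := hfin.exists_notMem
  have h1 := (sum_encard_branchesAt_le h0 (hf t) F hFd).trans (encard_branches_le hp hq t)
  have h2 : (F.card : ℕ∞) ≤ ∑ Q ∈ F, (branchesAt p q Q t).encard := by
    rw [Finset.card_eq_sum_ones, Nat.cast_sum]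
    refine Finset.sum_le_sum fun Q hQ ↦ ?_
    have htQ : IsTypicalAt p q Q t := by
      by_contra hn
      exact ht (Set.mem_biUnion hQ hn)
    rw [htQ.1]
    exact_mod_cast Nat.one_le_iff_ne_zero.2 (dicriticalDegree_ne_zero h0 (hFd Q hQ))
  have h3 := (h2.trans h1).trans (PowerSeries.coe_toNat_order hne).ge
  rw [hcard] at h3
  norm_cast at h3
  omega

theorem isBasePoint_nil {U : Ser K} {c : ℕ} (hc : 0 < c) (hU : IsUnit U) (hq : q = x K ^ c * U)
    (hp : ¬ x K ∣ p) (hp0 : MvPowerSeries.constantCoeff p = 0) : IsBasePoint p q [] := by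
  have hp' : p ≠ 0 := by
    rintro rfl
    exact hp (dvd_zero _)
  refine ⟨fun h ↦ hp ?_, fun h ↦ hp ?_⟩
  · refine dvd_trans ?_ h
    rw [hq]
    exact (dvd_pow_self _ hc.ne').mul_right U
  · obtain ⟨g, hg, hgp⟩ := exists_prime_factor hp' fun hu ↦
      isUnit_iff_constantCoeff_ne_zero.1 hu hp0
    have h1 : g ∣ x K ^ c * U := hq ▸ hgp.trans h
    have h2 := hg.dvd_of_dvd_pow (hU.dvd_mul_right.1 h1)
    exact ((hg.dvd_prime_iff_associated (prime_X 0)).1 h2).symm.dvd.trans hgp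

end Count

end PlanePencil

end

theorem mainTheorem4 {K : Type*} [Field K] [IsAlgClosed K]
    (p U q : PlanePencil.Ser K) (c : ℕ) (hc : 0 < c) (hU : IsUnit U)
    (hq : q = PlanePencil.x K ^ c * U)
    (hp : ¬ PlanePencil.x K ∣ p) (hp0 : MvPowerSeries.constantCoeff p = 0) :
    (∀ Q : PlanePencil.NearPoint K,
      PlanePencil.IsDicritical p q Q → PlanePencil.IsSeparableAt p q Q →
        (PlanePencil.atypicalAt p q Q).encard ≤ PlanePencil.dicriticalDegree p q Q ∧
        ∀ (t₀ : K) (r : ℕ), (PlanePencil.branchesAt p q Q t₀).encard = r →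
          (PlanePencil.atypicalAt p q Q \ {t₀}).encard ≤ r) ∧
    ((∀ Q : PlanePencil.NearPoint K,
        PlanePencil.IsDicritical p q Q → PlanePencil.IsSeparableAt p q Q) →
      ∃ νgen : ℕ,
        (∀ᶠ t : K in Filter.cofinite, (PlanePencil.branches p q t).encard = νgen) ∧
        (PlanePencil.atypical p q).encard ≤
          min (νgen : ℕ∞) ((⨅ t : K, (PlanePencil.branches p q t).encard) + 1)) := by
  open PlanePencil in
  have hxq : x K ∣ q := by
    rw [hq]
    exact (dvd_pow_self _ hc.ne').mul_right U
  have hf := fibre_ne_zero hp hxq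
  have h0 := chart_nil hU hq hp
  have hb0 := isBasePoint_nil hc hU hq hp hp0
  refine ⟨fun Q hQ hs ↦ ⟨encard_atypicalAt_le h0 hf hQ hs, fun t₀ r hr ↦ ?_⟩, fun hs ↦ ?_⟩
  · rw [← hr]
    exact encard_atypicalAt_diff_le h0 hf hQ hs t₀
  have hfin := finite_setOf_isDicritical h0 hp hxq hs
  set F := hfin.toFinset with hF
  have hFd : ∀ Q, Q ∈ F ↔ IsDicritical p q Q := fun Q ↦ hfin.mem_toFinset
  have hsub : atypical p q ⊆ ⋃ Q ∈ F, atypicalAt p q Q := by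
    intro t ht
    obtain ⟨Q, hQ⟩ := not_forall.1 ht
    obtain ⟨hQ, hn⟩ := Classical.not_imp.1 hQ
    exact Set.mem_biUnion (Finset.mem_coe.2 ((hFd Q).2 hQ)) hn
  have hgen : (atypical p q).encard ≤ (∑ Q ∈ F, dicriticalDegree p q Q : ℕ) := by
    refine (Set.encard_le_encard hsub).trans ((F.set_encard_biUnion_le _).trans ?_)
    rw [Nat.cast_sum]
    exact Finset.sum_le_sum fun Q hQ ↦
      encard_atypicalAt_le h0 hf ((hFd Q).1 hQ) (hs Q ((hFd Q).1 hQ))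
  -- For typical `t` the branches of `C_t` are the disjoint union of those at the dicriticals, `d_E`
  -- at each.
  refine ⟨∑ Q ∈ F, dicriticalDegree p q Q, ?_, le_min hgen ?_⟩
  · refine (Set.finite_of_encard_le_coe hgen).subset fun t ht ↦ ?_
    by_contra htyp
    have htyp' : ∀ Q, IsDicritical p q Q → IsTypicalAt p q Q t := not_not.1 htyp
    refine ht ?_
    have heq : branches p q t = ⋃ Q ∈ F, toBranch Q '' branchesAt p q Q t := by
      apply Set.Subset.antisymm
      · intro I hI
        obtain ⟨Q, hQ, b, hb, rfl⟩ := exists_toBranch_eq h0 hb0 (hf t) htyp' hI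
        exact Set.mem_biUnion (Finset.mem_coe.2 ((hFd Q).2 hQ)) ⟨b, hb, rfl⟩
      · refine Set.iUnion₂_subset fun Q _ ↦ ?_
        rintro _ ⟨b, hb, rfl⟩
        exact toBranch_mem (hf t) hb
    change (branches p q t).encard = _
    rw [heq, encard_biUnion_toBranch h0 (hf t) F fun Q hQ ↦ (hFd Q).1 hQ, Nat.cast_sum]
    exact Finset.sum_congr rfl fun Q hQ ↦ (htyp' Q ((hFd Q).1 hQ)).1
  -- The minimum is attained at some `t`; the summand 1 allows for `t` itself, and the other
  -- atypical values are bounded dicritical by dicritical through the branches of `C_t`.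
  · obtain ⟨t, ht⟩ := ciInf_mem fun t : K ↦ (branches p q t).encard
    rw [← ht]
    have hsub' : atypical p q ⊆ insert t (⋃ Q ∈ F, (atypicalAt p q Q \ {t})) := by
      intro u hu
      by_cases hut : u = t
      · exact .inl hut
      · obtain ⟨Q, hQ, huQ⟩ := Set.mem_iUnion₂.1 (hsub hu)
        exact .inr (Set.mem_biUnion (Finset.mem_coe.2 hQ) ⟨huQ, hut⟩)
    refine (Set.encard_le_encard hsub').trans ((Set.encard_insert_le _ _).trans ?_)
    gcongr
    refine ((F.set_encard_biUnion_le _).trans ?_).trans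
      (sum_encard_branchesAt_le h0 (hf t) F fun Q hQ ↦ (hFd Q).1 hQ)
    exact Finset.sum_le_sum fun Q hQ ↦
      encard_atypicalAt_diff_le h0 hf ((hFd Q).1 hQ) (hs Q ((hFd Q).1 hQ)) t
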